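/- Let $G$ be an abelian group (finite or infinite), written additively. Conventions. Let $S$ be a finite generating subset of $G$ with $0\in S$. For a finite $X\subset G$ put $\partial_S(X)=(X+S)\setminus X$ and $X^S=G\setminus(X+S)$. For $k\ge 1$ with $|G|\ge 2k-1$ put $$\kappa_k(S)=\min\{|\partial_S(X)| : X\subset G,\ k\le |X|<\infty,\ |X^S|\ge k\},\qquad \min\emptyset=|G|-2k+1 .$$ A finite set $X$ with $|X|\ge k$, $|X^S|\ge k$ and $|\partial_S(X)|=\kappa_k(S)$ is a $k$-fragment of $S$. The set $S$ is degenerate if some subgroup of $G$ is a $2$-fragment of $S$; a hyper-atom of $S$ is a subgroup of $G$ that is maximal (with respect to inclusion) among the subgroups that are $2$-fragments of $S$. A subset $X$ of $G$ is aperiodic if $g+X=X$ holds only for $g=0$. A progression with difference $d$ is a set $\{a,a+d,\dots,a+(n-1)d\}$ with $n\ge 1$; in particular, a one-element set is a progression with difference $d$ for every $d$. For a nonempty set $T$, $T^*$ denotes an arbitrary translate $T-t$ with $t\in T$; $\kappa_2(T^*)$ is defined by the formula above. Theorem. Let $\mu\in\{0,1\}$. Let $S$ be a degenerate generating subset of $G$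 with $0\in S$, let $H$ be a hyper-atom of $S$, and let $\phi:G\to G/H$ be the canonical morphism. Let $T$ be a finite subset of $G$ such that $3-\mu\le |S|$, $\max(4-2\mu,|S|)\le |T|$, the set $S+T$ is aperiodic, and $$|S+T|=|S|+|T|-\mu\le \frac{2|G|+2\mu}{3}$$ (the last inequality being void if $G$ is infinite). Then one of the following conditions holds: (i) $\mu=0$ and $|G|=3|S|=3|T|=4\kappa_2(T^*)=12$ (for every choice of the translate $T^*$); (ii) $|\phi(S+T)|=|\phi(S)|+|\phi(T)|-1$, and $\phi(S)$ and $\phi(T)$ are progressions with the same difference. -/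

import Mathlib

open scoped Pointwise

namespace SmallSum

variable {G : Type*} [AddCommGroup G] [DecidableEq G]

/-- The boundary `∂_S(X) = (X + S) \ X`. -/
def boundary (S X : Finset G) : Finset G := (X + S) \ X

/-- The set `X^S = G \ (X + S)`. -/
def coSum (X S : Finset G) : Set G := ((X + S : Finset G) : Set G)ᶜ

/-- The finite sets `X` over which the `k`-th connectivity of `S` is minimised:
`k ≤ |X| < ∞` and `k ≤ |X^S|` (the latter may be infinite). -/
def Admissible (k : ℕ) (S X : Finset G) : Prop :=
  k ≤ X.card ∧ (k : ℕ∞) ≤ (coSum X S).encard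

open Classical in
/-- The `k`-th connectivity `κ_k(S)`, the minimum of `|∂_S(X)|` over the admissible `X`, with the
convention `min ∅ = |G| - 2k + 1` (relevant for `|G| ≥ 2k - 1` only). If `G` is infinite, every `X`
with `k` elements is admissible, so that the convention is only ever used for finite `G`. -/
noncomputable def kappa (k : ℕ) (S : Finset G) : ℕ :=
  if ∃ X : Finset G, Admissible k S X then
    sInf {m : ℕ | ∃ X : Finset G, Admissible k S X ∧ m = (boundary S X).card}
  else Nat.card G + 1 - 2 * k

/-- `X` is a `k`-fragment of `S`. -/
def IsFragment (k : ℕ) (S X : Finset G) : Prop :=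
  Admissible k S X ∧ (boundary S X).card = kappa k S

/-- The subgroup `H` is (finite and) a `2`-fragment of `S`. -/
def IsSubgroupFragment (S : Finset G) (H : AddSubgroup G) : Prop :=
  ∃ X : Finset G, (X : Set G) = (H : Set G) ∧ IsFragment 2 S X

/-- `S` is degenerate: some subgroup is a `2`-fragment of `S`. -/
def IsDegenerate (S : Finset G) : Prop := ∃ H : AddSubgroup G, IsSubgroupFragment S H

/-- `H` is a hyper-atom of `S`: a subgroup that is maximal (for inclusion) among the subgroups
which are `2`-fragments of `S`. -/
def IsHyperAtom (S : Finset G) (H : AddSubgroup G) : Prop :=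
  Maximal (fun K : AddSubgroup G => IsSubgroupFragment S K) H

/-- `X` is aperiodic: its period `{g | g + X = X}` is trivial. -/
def IsAperiodic (X : Finset G) : Prop := AddAction.stabilizer G (X : Set G) = ⊥

/-- The translated copy `T - t` of `T` (it contains `0` when `t ∈ T`). -/
def translate (T : Finset G) (t : G) : Finset G := T.image (fun x => x - t)

/-- `X` is an arithmetic progression `{a, a + d, …, a + (n - 1) d}` with difference `d`, where
`n ≥ 1`. A one-element set is a progression with difference `d` for every `d`. -/
def IsProgression {A : Type*} [AddCommGroup A] (d : A) (X : Set A) : Prop :=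
  ∃ (a : A) (n : ℕ), 1 ≤ n ∧ X = {x | ∃ i < n, x = a + i • d}

end SmallSum

/-! Write h = |H|, A = φ(S), B = φ(T), u = |A|, v = |B|, q = |G/H|. Since H is a 2-fragment, κ₂(S) =
(u-1)h. Tested on T (S + T misses two elements) this gives |S| ≥ (u-1)h + μ: the u cosets met by S
are filled by S up to a total defect of at most h - μ. Tested on unions of cosets it gives the
Cauchy–Davenport inequality |X + A| ≥ |X| + |A| - 1 in G/H whenever X + A is not everything, and
maximality of H makes this strict when X is a coset of a nontrivial finite subgroup.

Both facts feed an inverse theorem of Vosper type, `isProgression_of_fragment`: if equality holds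
for some X with |X| ≥ 2 and two elements outside X + A, then A is a progression whose difference
generates G/H. A smallest such X meets each of its other translates in at most one point unless it
is a coset. Cosets are excluded, a Sidon set with two elements makes A a progression, and larger
Sidon sets expand too much.

A Hall matching between cosets shows |A + B| < |A| + |B| (`Config.card_img_add_lt`). Hence |A + B| =
|A| + |B| - 1 as soon as A + B ≠ G/H, and then B is a progression once A is one with generating
difference.

Let u ≥ 3. If A + B misses two elements, the inverse theorem applies with X = B. Otherwise |T| and
the number of elements missing from S + T are bounded through the defects of the fibres of S.
Together with the size hypothesis this excludes u + v > q, hence A + B = G/H. If exactly one element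
is missed and A is no progression, every other element of G/H has two representations a + b unless
the counts already conflict, and a double count refutes that.

Let u = 2, A = {0, d}. If A + B = G/H but B ≠ G/H, then B is the complement of a point, which is a
progression. If B = G/H, then κ₂(S) = h, applied to single fibres of T, to fibres of the complement
of S + T and to intersections of T with its translates, forces q = 3, h = 4 and fibres of T of sizes
2, 1, 1. In that case T is a four-term progression generating a group of order 12, so κ₂(T*) = 3;
this is condition (i). -/

namespace SmallSum

/-! ### Sets whose complement has at least two elements -/

/-- At least two elements lie outside `Y`. -/
def TwoOut {G : Type*} (Y : Finset G) : Prop := ∃ p r, p ≠ r ∧ p ∉ Y ∧ r ∉ Y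

theorem TwoOut.mono {G : Type*} {Y Z : Finset G} (h : TwoOut Y) (hZ : Z ⊆ Y) : TwoOut Z := by
  obtain ⟨p, r, hpr, hp, hr⟩ := h
  exact ⟨p, r, hpr, fun h => hp (hZ h), fun h => hr (hZ h)⟩

theorem finite_of_not_twoOut {G : Type*} {Y : Finset G} (h : ¬ TwoOut Y) : Finite G := by
  classical
  by_cases hY : ∃ p, p ∉ Y
  · obtain ⟨p, hp⟩ := hY
    refine Set.finite_univ_iff.1 ((insert p Y).finite_toSet.subset fun x _ => ?_)
    by_contra hx
    simp only [Finset.coe_insert, Set.mem_insert_iff, Finset.mem_coe, not_or] at hx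
    exact h ⟨x, p, hx.1, hx.2, hp⟩
  · push Not at hY
    exact Set.finite_univ_iff.1 (Y.finite_toSet.subset fun x _ => hY x)

theorem card_le_of_not_twoOut {G : Type*} [Fintype G] {Y : Finset G} (h : ¬ TwoOut Y) :
    Fintype.card G ≤ Y.card + 1 := by
  classical
  have h1 : (Yᶜ).card ≤ 1 := by
    refine Finset.card_le_one.2 fun a ha b hb => ?_
    by_contra hab
    exact h ⟨a, b, hab, by simpa using ha, by simpa using hb⟩
  have := Finset.card_add_card_compl Y
  omega

theorem twoOut_of_card {G : Type*} [Fintype G] {Y : Finset G} (h : Y.card + 2 ≤ Fintype.card G) :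
    TwoOut Y := by
  by_contra h'
  have := card_le_of_not_twoOut h'
  omega

theorem card_add_two_le_of_twoOut {G : Type*} [Fintype G] {Y : Finset G} (h : TwoOut Y) :
    Y.card + 2 ≤ Fintype.card G := by
  classical
  obtain ⟨p, r, hpr, hp, hr⟩ := h
  have h1 : ({p, r} : Finset G) ⊆ Yᶜ := by
    intro x hx
    simp only [Finset.mem_insert, Finset.mem_singleton] at hx
    rcases hx with rfl | rfl <;> simpa
  have h2 := Finset.card_le_card h1
  rw [Finset.card_pair hpr] at h2
  have := Finset.card_add_card_compl Y
  omega

/-! ### Atoms: smallest fragments are cosets or Sidon sets -/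

section Atoms

variable {G : Type*} [AddCommGroup G] [DecidableEq G]

/-- Every nonzero element has at most one representation as a difference of elements of `N`. -/
def IsSidon (N : Finset G) : Prop :=
  ∀ g ≠ 0, ∀ x ∈ N, ∀ y ∈ N, x + g ∈ N → y + g ∈ N → x = y

/-- `N` is a coset of the subgroup `K`. -/
def IsCoset (K : AddSubgroup G) (N : Finset G) : Prop :=
  ∃ n ∈ N, ∀ x, x ∈ N ↔ x - n ∈ K

theorem twoOut_vadd {Y : Finset G} (g : G) (h : TwoOut Y) : TwoOut (g +ᵥ Y) := by
  obtain ⟨p, r, hpr, hp, hr⟩ := h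
  exact ⟨g +ᵥ p, g +ᵥ r, by simpa using hpr, by simpa using hp, by simpa using hr⟩

theorem mem_vadd_iff {Y : Finset G} {g x : G} : x ∈ g +ᵥ Y ↔ x - g ∈ Y := by
  rw [Finset.mem_vadd_finset]
  constructor
  · rintro ⟨y, hy, rfl⟩
    simpa [add_comm] using hy
  · intro h
    exact ⟨_, h, by simp⟩

/-- The reflected complement of a sumset `N + S` is again a fragment. -/
theorem dual_fragment [Fintype G] {S N : Finset G} {κ : ℕ} (hN2 : 2 ≤ N.card)
    (hN : TwoOut (N + S)) (hle : (N + S).card ≤ N.card + κ) :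
    ∃ M : Finset G, M.card + (N + S).card = Fintype.card G ∧ 2 ≤ M.card ∧ TwoOut (M + S) ∧
      (M + S).card ≤ M.card + κ := by
  set M : Finset G := -((N + S)ᶜ) with hM
  have hMc : M.card + (N + S).card = Fintype.card G := by
    rw [hM, Finset.card_neg, add_comm, Finset.card_add_card_compl]
  have h2 := card_add_two_le_of_twoOut hN
  -- So M + S misses |N| ≥ 2 elements, and |M + S| ≤ |G| - |N| while |M| = |G| - |N + S|.
  have hsub : M + S ⊆ (-N)ᶜ := by
    intro x hx
    obtain ⟨m, hm, s, hs, rfl⟩ := Finset.mem_add.1 hx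
    simp only [hM, Finset.mem_neg', Finset.mem_compl] at hm
    simp only [Finset.mem_compl, Finset.mem_neg']
    intro hn
    exact hm (Finset.mem_add.2 ⟨_, hn, s, hs, by abel⟩)
  have h3 := Finset.card_le_card hsub
  have h4 := Finset.card_add_card_compl (-N)
  rw [Finset.card_neg] at h4
  refine ⟨M, hMc, by omega, twoOut_of_card (by omega), by omega⟩

/-- X ↦ |X + S| is submodular, so a fragment N of least cardinality shares at most one point with
each translate different from N. If some nonzero translation fixes N, this makes N a coset of its
stabilizer; if none does, it is the Sidon property. -/
theorem exists_atom {S : Finset G} {κ : ℕ}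
    (hκ : ∀ X : Finset G, 2 ≤ X.card → TwoOut (X + S) → X.card + κ ≤ (X + S).card)
    (hex : ∃ X : Finset G, 2 ≤ X.card ∧ TwoOut (X + S) ∧ (X + S).card ≤ X.card + κ) :
    ∃ N : Finset G, 2 ≤ N.card ∧ TwoOut (N + S) ∧ (N + S).card ≤ N.card + κ ∧
      ((∃ K, IsCoset K N) ∨ IsSidon N) := by
  classical
  have hex' : ∃ n : ℕ, ∃ X : Finset G, (2 ≤ X.card ∧ TwoOut (X + S) ∧ (X + S).card ≤ X.card + κ) ∧
      X.card = n := by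
    obtain ⟨X, hX⟩ := hex
    exact ⟨_, X, hX, rfl⟩
  obtain ⟨N, ⟨hN2, hNo, hNle⟩, hNc⟩ := Nat.find_spec hex'
  have hmin : ∀ X : Finset G, 2 ≤ X.card → TwoOut (X + S) → (X + S).card ≤ X.card + κ →
      N.card ≤ X.card := by
    intro X h1 h2 h3
    rw [hNc]
    exact Nat.find_min' hex' ⟨X, ⟨h1, h2, h3⟩, rfl⟩
  have hNeq : (N + S).card = N.card + κ := le_antisymm hNle (hκ N hN2 hNo)
  have key : ∀ g : G, 2 ≤ (N ∩ (g +ᵥ N)).card → g +ᵥ N = N := by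
    intro g hg
    by_contra hne
    obtain ⟨N', hN'⟩ : ∃ N' : Finset G, N' = g +ᵥ N := ⟨_, rfl⟩
    rw [← hN'] at hg hne
    have hNc' : N'.card = N.card := by rw [hN', Finset.card_vadd_finset]
    have hgS : (N' + S).card = N.card + κ := by
      rw [hN', vadd_add_assoc, Finset.card_vadd_finset, hNeq]
    have hIlt : (N ∩ N').card < N.card := by
      by_contra hge
      have h1 : N ∩ N' = N := Finset.eq_of_subset_of_card_le Finset.inter_subset_left (by omega)
      have h2 : N ⊆ N' := by rw [← h1]; exact Finset.inter_subset_right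
      exact hne (Finset.eq_of_subset_of_card_le h2 hNc'.le).symm
    have hIS : (N ∩ N') + S ⊆ N + S := Finset.add_subset_add_right Finset.inter_subset_left
    have hIS' : (N ∩ N') + S ⊆ N' + S := Finset.add_subset_add_right Finset.inter_subset_right
    have hI := hmin (N ∩ N') hg (hNo.mono hIS)
    have hI' : (N ∩ N').card + κ + 1 ≤ ((N ∩ N') + S).card := by
      by_contra hlt
      have := hI (by omega)
      omega
    have hU := Finset.card_union_add_card_inter (N + S) (N' + S)
    have hU' := Finset.card_union_add_card_inter N N'
    rw [← Finset.union_add] at hU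
    have hint := Finset.card_le_card (Finset.subset_inter hIS hIS')
    -- The intersection is too small to be a fragment, so by submodularity the union would have
    -- boundary below κ.
    have hnot : ¬ TwoOut ((N ∪ N') + S) := by
      intro h
      have := hκ (N ∪ N') (by omega) h
      omega
    have := finite_of_not_twoOut hnot
    have := Fintype.ofFinite G
    have h5 := card_le_of_not_twoOut hnot
    -- Now |G| ≤ |N ∪ N'| + κ ≤ 2|N| - 2 + κ, so the dual fragment, of size |G| - |N| - κ, is
    -- smaller than N.
    obtain ⟨M, hM1, hM2, hM3, hM4⟩ := dual_fragment hN2 hNo hNle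
    have h6 := hmin M hM2 hM3 hM4
    omega
  refine ⟨N, hN2, hNo, hNle, ?_⟩
  by_cases hst : ∃ g : G, g ≠ 0 ∧ g +ᵥ N = N
  · left
    obtain ⟨g, hg0, hgN⟩ := hst
    obtain ⟨n, hn⟩ : N.Nonempty := Finset.card_pos.1 (by omega)
    refine ⟨AddAction.stabilizer G N, n, hn, fun x => ⟨fun hx => ?_, fun hx => ?_⟩⟩
    · rw [AddAction.mem_stabilizer_iff]
      apply key
      -- Both x and x + g lie in N and in its translate by x - n, because g fixes N.
      refine le_trans ?_ (Finset.card_le_card (s := ({x, x + g} : Finset G)) ?_)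
      · rw [Finset.card_pair]
        simpa using hg0
      · have hxg : x + g ∈ N := by
          rw [← hgN, mem_vadd_iff]; simpa using hx
        have hng : n + g ∈ N := by
          rw [← hgN, mem_vadd_iff]; simpa using hn
        intro y hy
        simp only [Finset.mem_insert, Finset.mem_singleton] at hy
        rw [Finset.mem_inter, mem_vadd_iff]
        rcases hy with rfl | rfl
        · exact ⟨hx, by simpa using hn⟩
        · exact ⟨hxg, by convert hng using 1; abel⟩
    · rw [AddAction.mem_stabilizer_iff] at hx
      rw [← hx, mem_vadd_iff]
      simpa using hn
  · right
    intro g hg x hx y hy hxg hyg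
    by_contra hxy
    refine hst ⟨g, hg, key g ?_⟩
    refine le_trans ?_ (Finset.card_le_card (s := ({x + g, y + g} : Finset G)) ?_)
    · rw [Finset.card_pair]
      simpa using hxy
    · intro z hz
      simp only [Finset.mem_insert, Finset.mem_singleton] at hz
      rw [Finset.mem_inter, mem_vadd_iff]
      rcases hz with rfl | rfl
      · exact ⟨hxg, by simpa using hx⟩
      · exact ⟨hyg, by simpa using hy⟩

end Atoms

end SmallSum

namespace SmallSum

/-! ### Sumsets with Sidon sets -/

section Vosper

variable {G : Type*} [AddCommGroup G] [DecidableEq G]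

theorem vadd_eq_of_mem_zmultiples {Y : Finset G} {d g : G} (h : d +ᵥ Y = Y)
    (hg : g ∈ AddSubgroup.zmultiples d) : g +ᵥ Y = Y := by
  have h1 : AddSubgroup.zmultiples d ≤ AddAction.stabilizer G Y := by
    rw [AddSubgroup.zmultiples_le]
    exact h
  exact h1 hg

theorem IsSidon.card_inter_le {M : Finset G} (hM : IsSidon M) {a b : G} (hab : a ≠ b) :
    ((a +ᵥ M) ∩ (b +ᵥ M)).card ≤ 1 := by
  refine Finset.card_le_one.2 fun x hx y hy => ?_
  simp only [Finset.mem_inter, mem_vadd_iff] at hx hy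
  have := hM (a - b) (sub_ne_zero.2 hab) (x - a) hx.1 (y - a) hy.1
    (by convert hx.2 using 1; abel) (by convert hy.2 using 1; abel)
  simpa using this

theorem IsSidon.card_add_pair {M N : Finset G} (hM : IsSidon M) (hN : 2 ≤ N.card) :
    2 * M.card ≤ (N + M).card + 1 := by
  obtain ⟨a, ha, b, hb, hab⟩ := Finset.one_lt_card.1 hN
  have h1 := Finset.card_union_add_card_inter (a +ᵥ M) (b +ᵥ M)
  have h2 := hM.card_inter_le hab
  have h3 : (a +ᵥ M) ∪ (b +ᵥ M) ⊆ N + M :=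
    Finset.union_subset (Finset.vadd_finset_subset_add ha) (Finset.vadd_finset_subset_add hb)
  have h4 := Finset.card_le_card h3
  simp only [Finset.card_vadd_finset] at h1
  omega

theorem IsSidon.card_add_triple {M N : Finset G} (hM : IsSidon M) (hN : 3 ≤ N.card) :
    3 * M.card ≤ (N + M).card + 3 := by
  obtain ⟨a, ha, b, hb, c, hc, hab, hac, hbc⟩ := Finset.two_lt_card.1 hN
  have h1 := Finset.card_union_add_card_inter (a +ᵥ M) (b +ᵥ M)
  have h1' := Finset.card_union_add_card_inter ((a +ᵥ M) ∪ (b +ᵥ M)) (c +ᵥ M)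
  have h2 := hM.card_inter_le hab
  have h2' := hM.card_inter_le hac
  have h2'' := hM.card_inter_le hbc
  rw [Finset.union_inter_distrib_right] at h1'
  have h5 := Finset.card_union_le ((a +ᵥ M) ∩ (c +ᵥ M)) ((b +ᵥ M) ∩ (c +ᵥ M))
  have h3 : ((a +ᵥ M) ∪ (b +ᵥ M)) ∪ (c +ᵥ M) ⊆ N + M :=
    Finset.union_subset (Finset.union_subset (Finset.vadd_finset_subset_add ha)
      (Finset.vadd_finset_subset_add hb)) (Finset.vadd_finset_subset_add hc)
  have h4 := Finset.card_le_card h3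
  simp only [Finset.card_vadd_finset] at h1 h1'
  omega

/-- N + M contains the two full cosets N and m + N, plus a translate of the part of M outside K and
m + K. If that were too few elements, M would have at least |N| + 1 elements in these two cosets,
and their differences would repeat. -/
theorem IsSidon.card_coset_add {M N : Finset G} (hM : IsSidon M) (h0 : (0 : G) ∈ M)
    {K : AddSubgroup G} (hK : IsCoset K N) (hN : 2 ≤ N.card) {m : G} (hm : m ∈ M) (hmK : m ∉ K) :
    N.card + M.card ≤ (N + M).card := by
  classical
  obtain ⟨n, hn, hK⟩ := hK
  by_contra hlt
  set M₀ := M.filter (fun x => x ∈ K) with hM₀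
  set M₁ := M.filter (fun x => x - m ∈ K) with hM₁
  have hdisj : Disjoint M₀ M₁ := by
    rw [Finset.disjoint_left]
    intro x hx hx'
    simp only [hM₀, hM₁, Finset.mem_filter] at hx hx'
    apply hmK
    have := K.sub_mem hx.2 hx'.2
    simpa using this
  have hsub : M₀ ∪ M₁ ⊆ M := Finset.union_subset (Finset.filter_subset _ _) (Finset.filter_subset _ _)
  have hc1 := Finset.card_union_of_disjoint hdisj
  have hc2 := Finset.card_sdiff_add_card_eq_card hsub
  set M₂ := M \ (M₀ ∪ M₁) with hM₂
  have hmem₂ : ∀ x ∈ M₂, x ∈ M ∧ x ∉ K ∧ x - m ∉ K := by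
    intro x hx
    simp only [hM₂, hM₀, hM₁, Finset.mem_sdiff, Finset.mem_union, Finset.mem_filter, not_or,
      not_and] at hx
    exact ⟨hx.1, hx.2.1 hx.1, hx.2.2 hx.1⟩
  have hbig : (N ∪ (m +ᵥ N)) ∪ (n +ᵥ M₂) ⊆ N + M := by
    refine Finset.union_subset (Finset.union_subset ?_ ?_) ?_
    · intro x hx
      exact Finset.mem_add.2 ⟨x, hx, 0, h0, by simp⟩
    · rw [add_comm]; exact Finset.vadd_finset_subset_add hm
    · refine (Finset.vadd_finset_subset_vadd_finset Finset.sdiff_subset).trans ?_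
      exact Finset.vadd_finset_subset_add hn
  have hd1 : Disjoint N (m +ᵥ N) := by
    rw [Finset.disjoint_left]
    intro x hx hx'
    rw [mem_vadd_iff, hK] at hx'
    rw [hK] at hx
    apply hmK
    have := K.sub_mem hx hx'
    convert this using 1; abel
  have hd2 : Disjoint (N ∪ (m +ᵥ N)) (n +ᵥ M₂) := by
    rw [Finset.disjoint_left]
    intro x hx hx'
    rw [mem_vadd_iff] at hx'
    have h3 := hmem₂ _ hx'
    rw [Finset.mem_union, mem_vadd_iff, hK, hK] at hx
    rcases hx with hx | hx
    · exact h3.2.1 hx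
    · exact h3.2.2 (by convert hx using 1; abel)
  have hc3 := Finset.card_le_card hbig
  rw [Finset.card_union_of_disjoint hd2, Finset.card_union_of_disjoint hd1,
    Finset.card_vadd_finset, Finset.card_vadd_finset] at hc3
  have hp : N.card + 1 ≤ M₀.card + M₁.card := by omega
  -- All these pairs have distinct nonzero differences in K, by the Sidon property.
  have hoff : (M₀.offDiag ∪ M₁.offDiag).card ≤ ((-n +ᵥ N).erase 0).card := by
    refine Finset.card_le_card_of_injOn (fun p => p.1 - p.2) ?_ ?_
    · intro p hp
      simp only [Finset.coe_union, Set.mem_union, Finset.mem_coe, Finset.mem_offDiag, hM₀, hM₁,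
        Finset.mem_filter] at hp
      rw [Finset.mem_coe, Finset.mem_erase, mem_vadd_iff, hK]
      rcases hp with ⟨h1, h2, h3⟩ | ⟨h1, h2, h3⟩
      · exact ⟨sub_ne_zero.2 h3, by simpa using K.sub_mem h1.2 h2.2⟩
      · exact ⟨sub_ne_zero.2 h3, by simpa using K.sub_mem h1.2 h2.2⟩
    · intro p hp p' hp' heq
      have hmm : ∀ p : G × G, p ∈ ((M₀.offDiag ∪ M₁.offDiag : Finset (G × G)) : Set (G × G)) →
          p.1 ∈ M ∧ p.2 ∈ M ∧ p.1 ≠ p.2 := by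
        intro p hp
        simp only [Finset.coe_union, Set.mem_union, Finset.mem_coe, Finset.mem_offDiag, hM₀, hM₁,
          Finset.mem_filter] at hp
        rcases hp with ⟨h1, h2, h3⟩ | ⟨h1, h2, h3⟩
        · exact ⟨h1.1, h2.1, h3⟩
        · exact ⟨h1.1, h2.1, h3⟩
      obtain ⟨a1, a2, a3⟩ := hmm p hp
      obtain ⟨b1, b2, b3⟩ := hmm p' hp'
      simp only at heq
      have h2 : p.2 = p'.2 := by
        refine hM (p.1 - p.2) (sub_ne_zero.2 a3) _ a2 _ b2 (by simpa using a1) ?_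
        rw [heq]; simpa using b1
      refine Prod.ext ?_ h2
      rw [h2] at heq
      simpa using heq
  have hdo : Disjoint M₀.offDiag M₁.offDiag := by
    rw [Finset.disjoint_left]
    intro p hp hp'
    rw [Finset.mem_offDiag] at hp hp'
    exact Finset.disjoint_left.1 hdisj hp.1 hp'.1
  have h0e : (0 : G) ∈ -n +ᵥ N := by rw [mem_vadd_iff]; simpa using hn
  rw [Finset.card_union_of_disjoint hdo, Finset.offDiag_card, Finset.offDiag_card,
    Finset.card_erase_of_mem h0e, Finset.card_vadd_finset] at hoff
  have e0 : M₀.card ≤ M₀.card * M₀.card := Nat.le_mul_self _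
  have e1 : M₁.card ≤ M₁.card * M₁.card := Nat.le_mul_self _
  zify [e0, e1, (by omega : 1 ≤ N.card)] at hoff
  zify at hp hN
  nlinarith [sq_nonneg ((M₀.card : ℤ) - M₁.card)]

/-- An atom N of M is a coset or itself a Sidon set. A coset is handled by `IsSidon.card_coset_add`,
and in the other case the Sidon bounds for N and M can be combined. -/
theorem IsSidon.card_add_le {M X : Finset G} (hM : IsSidon M) (h0 : (0 : G) ∈ M)
    (hgen : AddSubgroup.closure (M : Set G) = ⊤) (hM3 : 3 ≤ M.card) (hX : 2 ≤ X.card)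
    (hXo : TwoOut (X + M)) : X.card + M.card ≤ (X + M).card := by
  classical
  by_contra hlt
  have hmono : ∀ X : Finset G, X.card ≤ (X + M).card := fun X => by
    refine Finset.card_le_card fun x hx => ?_
    exact Finset.mem_add.2 ⟨x, hx, 0, h0, by simp⟩
  -- The least such k plays the role of the second connectivity of M.
  have hex : ∃ k, ∃ X : Finset G, 2 ≤ X.card ∧ TwoOut (X + M) ∧ (X + M).card ≤ X.card + k :=
    ⟨(X + M).card, X, hX, hXo, by omega⟩
  obtain ⟨N, hN2, hNo, hNle, hN⟩ := exists_atom (S := M) (κ := Nat.find hex) (fun Y h1 h2 => by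
    have := hmono Y
    have := Nat.find_min' hex (m := (Y + M).card - Y.card) ⟨Y, h1, h2, by omega⟩
    omega) (Nat.find_spec hex)
  have hk := Nat.find_min' hex (m := (X + M).card - X.card) ⟨X, hX, hXo, by omega⟩
  have := hmono X
  have hNM : (N + M).card + 1 ≤ N.card + M.card := by omega
  rcases hN with ⟨K, hK⟩ | hN
  · by_cases hMK : ∀ m ∈ M, m ∈ K
    · have hKtop : K = ⊤ := by
        rw [eq_top_iff, ← hgen, AddSubgroup.closure_le]
        exact hMK
      obtain ⟨p, r, hpr, hp, hr⟩ := hNo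
      obtain ⟨n, hn, hK⟩ := hK
      refine hp (Finset.mem_add.2 ⟨p, (hK p).2 (by rw [hKtop]; trivial), 0, h0, by simp⟩)
    · push Not at hMK
      obtain ⟨m, hm, hmK⟩ := hMK
      have := hM.card_coset_add h0 hK hN2 hm hmK
      omega
  · rcases Nat.lt_or_ge N.card 3 with h | h
    · have := hM.card_add_pair hN2
      omega
    -- Adding the two bounds gives 3(|M| + |N|) ≤ 2|N + M| + 6, which with |N + M| < |M| + |N|
    -- forces |M| + |N| ≤ 4.
    · have h1 := hM.card_add_triple h
      have h2 := hN.card_add_triple hM3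
      rw [add_comm M N] at h2
      omega

/-- A version of `IsSidon.card_add_le` inside a coset of the subgroup generated by `M`. -/
theorem IsSidon.card_add_le_of_coset {M X : Finset G} (hM : IsSidon M) (h0 : (0 : G) ∈ M)
    (hM3 : 3 ≤ M.card) (hX : 2 ≤ X.card) {a : G}
    (hXa : ∀ x ∈ X, x - a ∈ AddSubgroup.closure (M : Set G))
    (hXo : ∃ p r, p ≠ r ∧ p - a ∈ AddSubgroup.closure (M : Set G) ∧
      r - a ∈ AddSubgroup.closure (M : Set G) ∧ p ∉ X + M ∧ r ∉ X + M) :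
    X.card + M.card ≤ (X + M).card := by
  classical
  set L := AddSubgroup.closure (M : Set G) with hL
  set M' : Finset L := M.subtype (fun x => x ∈ L) with hM'
  set X' : Finset L := (-a +ᵥ X).subtype (fun x => x ∈ L) with hX'
  have hML : ∀ x ∈ M, x ∈ L := fun x hx => AddSubgroup.subset_closure hx
  have hXL : ∀ x ∈ -a +ᵥ X, x ∈ L := fun x hx => by
    rw [mem_vadd_iff] at hx
    simpa using hXa _ hx
  have i1 : M'.image L.subtype = M := by
    ext x
    simp only [hM', Finset.mem_image, Finset.mem_subtype]
    exact ⟨by rintro ⟨y, hy, rfl⟩; exact hy, fun hx => ⟨⟨x, hML x hx⟩, hx, rfl⟩⟩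
  have i2 : X'.image L.subtype = -a +ᵥ X := by
    ext x
    simp only [hX', Finset.mem_image, Finset.mem_subtype]
    exact ⟨by rintro ⟨y, hy, rfl⟩; exact hy, fun hx => ⟨⟨x, hXL x hx⟩, hx, rfl⟩⟩
  have i3 : (X' + M').image L.subtype = -a +ᵥ (X + M) := by
    rw [Finset.image_add, i1, i2, vadd_add_assoc]
  have inj : Function.Injective L.subtype := L.subtype_injective
  have c1 : M'.card = M.card := by rw [← i1, Finset.card_image_of_injective _ inj]
  have c2 : X'.card = X.card := by
    rw [← Finset.card_vadd_finset (-a) X, ← i2, Finset.card_image_of_injective _ inj]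
  have c3 : (X' + M').card = (X + M).card := by
    rw [← Finset.card_vadd_finset (-a) (X + M), ← i3, Finset.card_image_of_injective _ inj]
  have hnot : ∀ p (hp : p - a ∈ L), p ∉ X + M → (⟨p - a, hp⟩ : L) ∉ X' + M' := by
    intro p hp hpo hmem
    have : L.subtype ⟨p - a, hp⟩ ∈ -a +ᵥ (X + M) := by
      rw [← i3]; exact Finset.mem_image_of_mem _ hmem
    rw [mem_vadd_iff] at this
    exact hpo (by simpa using this)
  have hS : IsSidon M' := by
    intro g hg x hx y hy hxg hyg
    simp only [hM', Finset.mem_subtype] at hx hy hxg hyg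
    exact Subtype.ext (hM g (by simpa using hg) x hx y hy hxg hyg)
  have hgen : AddSubgroup.closure (M' : Set L) = ⊤ := by
    rw [← AddSubgroup.closure_closure_coe_preimage (k := (M : Set G))]
    congr 1
    ext x
    simp [hM']
  obtain ⟨p, r, hpr, hpL, hrL, hp, hr⟩ := hXo
  have := hS.card_add_le (X := X') (by simp [hM', h0]) hgen (by omega) (by omega)
    ⟨⟨p - a, hpL⟩, ⟨r - a, hrL⟩, by simpa using hpr, hnot p hpL hp, hnot r hrL hr⟩
  omega

end Vosper

end SmallSum

namespace SmallSum

/-! ### Progressions and almost invariant sets -/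

section Progressions

variable {G : Type*} [AddCommGroup G] [DecidableEq G]

/-- The progression `{a, a + d, …, a + (n - 1) d}` as a finset. -/
def prog (a d : G) (n : ℕ) : Finset G := (Finset.range n).image fun i => a + i • d

theorem mem_prog {a d x : G} {n : ℕ} : x ∈ prog a d n ↔ ∃ i < n, x = a + i • d := by
  simp only [prog, Finset.mem_image, Finset.mem_range]
  exact ⟨fun ⟨i, hi, h⟩ => ⟨i, hi, h.symm⟩, fun ⟨i, hi, h⟩ => ⟨i, hi, h.symm⟩⟩

theorem coe_prog (a d : G) (n : ℕ) : (prog a d n : Set G) = {x | ∃ i < n, x = a + i • d} := by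
  ext x; simp [mem_prog]

theorem isProgression_prog (a d : G) {n : ℕ} (hn : 1 ≤ n) : IsProgression d (prog a d n : Set G) :=
  ⟨a, n, hn, coe_prog a d n⟩

theorem card_prog_le (a d : G) (n : ℕ) : (prog a d n).card ≤ n :=
  Finset.card_image_le.trans (by simp)

theorem vadd_eq_of_subset {Y : Finset G} {g : G} (h : g +ᵥ Y ⊆ Y) : g +ᵥ Y = Y :=
  Finset.eq_of_subset_of_card_le h (by rw [Finset.card_vadd_finset])

theorem eq_univ_of_vadd_eq {Y : Finset G} {d : G} (hd : AddSubgroup.zmultiples d = ⊤)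
    (hY : Y.Nonempty) (h : d +ᵥ Y = Y) (x : G) : x ∈ Y := by
  obtain ⟨y, hy⟩ := hY
  have := vadd_eq_of_mem_zmultiples h (g := x - y) (by rw [hd]; trivial)
  rw [← this, mem_vadd_iff]
  simpa using hy

/-- A finite set which is almost invariant under `g` is a `g`-progression plus an invariant set. -/
theorem exists_prog_union {B : Finset G} {g : G} (hB : (B ∪ (g +ᵥ B)).card ≤ B.card + 1)
    (hne : g +ᵥ B ≠ B) : ∃ b n R, 1 ≤ n ∧ b ∈ B ∧ g +ᵥ R = R ∧ B = prog b g n ∪ R ∧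
      Disjoint (prog b g n) R := by
  have hb : ∃ b ∈ B, b - g ∉ B := by
    by_contra hcon
    push Not at hcon
    refine hne (Finset.eq_of_subset_of_card_le ?_ (by rw [Finset.card_vadd_finset])).symm
    intro x hx
    rw [mem_vadd_iff]
    exact hcon x hx
  -- At most one g-chain of B has an end.
  have huniq : ∀ x ∈ B, ∀ y ∈ B, x + g ∉ B → y + g ∉ B → x = y := by
    intro x hx y hy hxg hyg
    have h1 : (g +ᵥ B) \ B = (B ∪ (g +ᵥ B)) \ B := by
      ext z; simp only [Finset.mem_sdiff, Finset.mem_union]; tauto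
    have h2 : ((g +ᵥ B) \ B).card ≤ 1 := by
      rw [h1, Finset.card_sdiff_of_subset Finset.subset_union_left]; omega
    have h3 := Finset.card_le_one.1 h2 (x + g) (by
      rw [Finset.mem_sdiff, mem_vadd_iff]; exact ⟨by simpa using hx, hxg⟩) (y + g) (by
      rw [Finset.mem_sdiff, mem_vadd_iff]; exact ⟨by simpa using hy, hyg⟩)
    simpa using h3
  obtain ⟨b, hb, hbg⟩ := hb
  -- Otherwise the chain from b would close up in the finite set B and contain b - g.
  have hex : ∃ n : ℕ, b + n • g ∉ B := by
    by_contra hcon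
    push Not at hcon
    obtain ⟨i, j, hij, heq⟩ := Finite.exists_ne_map_eq_of_infinite
      (fun n : ℕ => (⟨b + n • g, hcon n⟩ : B))
    have key : ∀ i j : ℕ, i < j → b + i • g = b + j • g → False := by
      intro i j hij heq
      apply hbg
      obtain ⟨k, rfl⟩ : ∃ k, j = i + (k + 1) := ⟨j - i - 1, by omega⟩
      have h0 : (k + 1) • g = 0 := by
        rw [add_smul] at heq
        have : b + i • g + (k + 1) • g = b + i • g := by rw [add_assoc]; exact heq.symm
        simpa using this
      have h1 : b - g = b + k • g := by
        rw [add_smul, one_smul] at h0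
        rw [eq_neg_of_add_eq_zero_left h0]; abel
      rw [h1]
      exact hcon k
    have heq' := congrArg Subtype.val heq
    simp only at heq'
    rcases lt_or_gt_of_ne hij with h | h
    · exact key i j h heq'
    · exact key j i h heq'.symm
  have hn := Nat.find_spec hex
  have hlt : ∀ i < Nat.find hex, b + i • g ∈ B := fun i hi => by
    simpa using Nat.find_min hex hi
  have hpos : 1 ≤ Nat.find hex := by
    by_contra h0
    have : Nat.find hex = 0 := by omega
    rw [this] at hn
    exact hn (by simpa using hb)
  obtain ⟨n, hnn⟩ : ∃ n, Nat.find hex = n + 1 := ⟨Nat.find hex - 1, by omega⟩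
  rw [hnn] at hn hlt
  have hsub : prog b g (n + 1) ⊆ B := by
    intro x hx
    obtain ⟨i, hi, rfl⟩ := mem_prog.1 hx
    exact hlt i hi
  refine ⟨b, n + 1, B \ prog b g (n + 1), by omega, hb, vadd_eq_of_subset fun x hx => ?_,
    (Finset.union_sdiff_of_subset hsub).symm, Finset.disjoint_sdiff⟩
  rw [mem_vadd_iff, Finset.mem_sdiff] at hx
  rw [Finset.mem_sdiff]
  refine ⟨?_, fun hxP => ?_⟩
  · by_contra hxB
    have h1 : x - g = b + n • g := huniq _ hx.1 _ (hlt n (by omega)) (by simpa using hxB)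
      (by rw [add_smul, one_smul, ← add_assoc] at hn; exact hn)
    exact hx.2 (mem_prog.2 ⟨n, by omega, h1⟩)
  · obtain ⟨i, hi, rfl⟩ := mem_prog.1 hxP
    cases i with
    | zero => exact hbg (by simpa using hx.1)
    | succ i =>
      apply hx.2
      exact mem_prog.2 ⟨i, by omega, by rw [add_smul, one_smul]; abel⟩

theorem prog_succ_add (B : Finset G) (a d : G) {n : ℕ} (hn : 1 ≤ n) :
    B + prog a d (n + 1) = (B + prog a d n) ∪ (d +ᵥ (B + prog a d n)) := by
  ext x
  simp only [Finset.mem_union, mem_vadd_iff, Finset.mem_add, mem_prog]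
  constructor
  · rintro ⟨b, hb, _, ⟨i, hi, rfl⟩, rfl⟩
    rcases Nat.lt_or_ge i n with h | h
    · exact Or.inl ⟨b, hb, _, ⟨i, h, rfl⟩, rfl⟩
    · obtain ⟨m, rfl⟩ : ∃ m, n = m + 1 := ⟨n - 1, by omega⟩
      have : i = m + 1 := by omega
      subst this
      refine Or.inr ⟨b, hb, _, ⟨m, by omega, rfl⟩, ?_⟩
      rw [add_smul, one_smul]; abel
  · rintro (⟨b, hb, _, ⟨i, hi, rfl⟩, rfl⟩ | ⟨b, hb, _, ⟨i, hi, rfl⟩, h⟩)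
    · exact ⟨b, hb, _, ⟨i, by omega, rfl⟩, rfl⟩
    · refine ⟨b, hb, _, ⟨i + 1, by omega, rfl⟩, ?_⟩
      rw [add_smul, one_smul, ← add_assoc a, ← add_assoc, h]; abel

/-- If the extra term added nothing, the sumset would be invariant under the generator d, hence
everything. -/
theorem card_add_prog_succ {B : Finset G} {a d : G} {n : ℕ} (hn : 1 ≤ n) (hB : B.Nonempty)
    (hd : AddSubgroup.zmultiples d = ⊤) (hne : ∃ p, p ∉ B + prog a d n) :
    (B + prog a d n).card + 1 ≤ (B + prog a d (n + 1)).card := by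
  rw [prog_succ_add B a d hn]
  by_contra hlt
  have h1 : (B + prog a d n) ∪ (d +ᵥ (B + prog a d n)) = B + prog a d n :=
    (Finset.eq_of_subset_of_card_le Finset.subset_union_left (by omega)).symm
  obtain ⟨p, hp⟩ := hne
  refine hp (eq_univ_of_vadd_eq hd ?_ (vadd_eq_of_subset ?_) p)
  · exact hB.add ⟨a, mem_prog.2 ⟨0, by omega, by simp⟩⟩
  · exact Finset.union_eq_left.1 h1

theorem prog_mono (a d : G) {m n : ℕ} (h : m ≤ n) : prog a d m ⊆ prog a d n := by
  intro x hx
  obtain ⟨i, hi, rfl⟩ := mem_prog.1 hx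
  exact mem_prog.2 ⟨i, by omega, rfl⟩

theorem card_add_prog_ge {B : Finset G} {a d : G} {m n : ℕ} (hm : 1 ≤ m) (hmn : m ≤ n)
    (hB : B.Nonempty) (hd : AddSubgroup.zmultiples d = ⊤) (hne : ∃ p, p ∉ B + prog a d n) :
    (B + prog a d m).card + (n - m) ≤ (B + prog a d n).card := by
  induction n, hmn using Nat.le_induction with
  | base => simp
  | succ n hmn ih =>
    have hne' : ∃ p, p ∉ B + prog a d n := by
      obtain ⟨p, hp⟩ := hne
      exact ⟨p, fun h => hp (Finset.add_subset_add_left (prog_mono a d (by omega)) h)⟩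
    have := ih hne'
    have := card_add_prog_succ (a := a) (by omega : 1 ≤ n) hB hd hne'
    omega

theorem add_prog_one (B : Finset G) (a d : G) : B + prog a d 1 = a +ᵥ B := by
  have : prog a d 1 = {a} := by simp [prog]
  rw [this, add_comm, Finset.singleton_add]

/-- If a set has a small sum with a progression, then it is a progression. -/
theorem isProgression_of_card_add_prog {B : Finset G} {a d : G} {n : ℕ} (hn : 2 ≤ n)
    (hd : AddSubgroup.zmultiples d = ⊤) (hB : B.Nonempty) (hne : ∃ p, p ∉ B + prog a d n)
    (hc : (B + prog a d n).card + 1 ≤ B.card + n) : IsProgression d (B : Set G) := by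
  -- Each of the last n - 2 terms costs an element, which leaves |B ∪ (d + B)| ≤ |B| + 1.
  have h1 := card_add_prog_ge (m := 2) (by omega) hn hB hd hne
  rw [prog_succ_add B a d le_rfl, add_prog_one] at h1
  have h2 : (a +ᵥ B) ∪ (d +ᵥ (a +ᵥ B)) = a +ᵥ (B ∪ (d +ᵥ B)) := by
    rw [Finset.vadd_finset_union, vadd_comm]
  rw [h2, Finset.card_vadd_finset] at h1
  have hBne : d +ᵥ B ≠ B := by
    intro h
    obtain ⟨p, hp⟩ := hne
    refine hp (Finset.mem_add.2 ⟨p - a, eq_univ_of_vadd_eq hd hB h _, a,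
      mem_prog.2 ⟨0, by omega, by simp⟩, by simp⟩)
  obtain ⟨b, k, R, hk, -, hR, hBR, -⟩ := exists_prog_union (by omega) hBne
  rcases R.eq_empty_or_nonempty with rfl | hRne
  · rw [Finset.union_empty] at hBR
    rw [hBR]
    exact isProgression_prog b d hk
  · obtain ⟨p, hp⟩ := hne
    exfalso
    refine hp (Finset.mem_add.2 ⟨p - a, ?_, a, mem_prog.2 ⟨0, by omega, by simp⟩, by simp⟩)
    rw [hBR]
    exact Finset.mem_union_right _ (eq_univ_of_vadd_eq hd hRne hR _)

/-- The shortest presentation of A has no repeated term: if terms i < j coincide, the first j terms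
already give everything. -/
theorem exists_prog_of_isProgression {d : G} {A : Finset G} (h : IsProgression d (A : Set G)) :
    ∃ a, A = prog a d A.card := by
  obtain ⟨a, n, hn, hA⟩ := h
  have hex : ∃ n, A = prog a d n := ⟨n, by rw [← Finset.coe_inj, hA, coe_prog]⟩
  have hspec := Nat.find_spec hex
  refine ⟨a, ?_⟩
  have hle : A.card ≤ Nat.find hex := by
    conv_lhs => rw [hspec]
    exact card_prog_le _ _ _
  suffices h : A.card = Nat.find hex by rw [h]; exact hspec
  refine le_antisymm hle ?_
  have hinj : Set.InjOn (fun i : ℕ => a + i • d) (Finset.range (Nat.find hex) : Finset ℕ) := by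
    have key : ∀ i j : ℕ, i < j → j < Nat.find hex → a + i • d = a + j • d → False := by
      intro i j hij hj heq
      refine Nat.find_min hex (m := j) hj ?_
      rw [hspec]
      refine Finset.Subset.antisymm ?_ (prog_mono a d hj.le)
      intro x hx
      obtain ⟨k, -, rfl⟩ := mem_prog.1 hx
      induction k using Nat.strong_induction_on with
      | _ k ih =>
        rcases Nat.lt_or_ge k j with hk | hk
        · exact mem_prog.2 ⟨k, hk, rfl⟩
        · have e : a + k • d = a + (k - j + i) • d := by
            have e1 : k = (k - j) + j := by omega
            have heq' : i • d = j • d := by simpa using heq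
            conv_lhs => rw [e1]
            rw [add_smul, add_smul, heq']
          rw [e] at hx ⊢
          exact ih _ (by omega) hx
    intro i hi j hj heq
    simp only [Finset.coe_range, Set.mem_Iio] at hi hj
    rcases lt_trichotomy i j with h | h | h
    · exact (key i j h hj heq).elim
    · exact h
    · exact (key j i h hi heq.symm).elim
  have := Finset.card_image_of_injOn hinj
  rw [Finset.card_range] at this
  rw [← this]
  conv_rhs => rw [hspec]
  exact le_rfl

end Progressions

end SmallSum

namespace SmallSum

/-! ### The inverse theorem: failure of Vosper's inequality forces a progression -/

section Inverse

variable {G : Type*} [AddCommGroup G] [DecidableEq G]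

theorem vadd_eq_of_mem_closure {R : Finset G} {s : Set G} (h : ∀ m ∈ s, m +ᵥ R = R) {g : G}
    (hg : g ∈ AddSubgroup.closure s) : g +ᵥ R = R := by
  have h1 : AddSubgroup.closure s ≤ AddAction.stabilizer G R := by
    rw [AddSubgroup.closure_le]
    exact h
  exact h1 hg

theorem exists_isCoset_of_invariant {K : AddSubgroup G} {R : Finset G} (hR : R.Nonempty)
    (hinv : ∀ k ∈ K, k +ᵥ R = R) : ∃ N : Finset G, (∀ x, x ∈ N ↔ x ∈ K) ∧ IsCoset K N ∧
      N.card ≤ R.card := by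
  classical
  obtain ⟨r, hr⟩ := hR
  have hN : ∀ x, x ∈ (-r +ᵥ R).filter (fun x => x ∈ K) ↔ x ∈ K := by
    intro x
    rw [Finset.mem_filter, mem_vadd_iff]
    refine ⟨fun h => h.2, fun h => ⟨?_, h⟩⟩
    rw [← hinv x h, mem_vadd_iff]
    simpa using hr
  refine ⟨_, hN, ⟨0, (hN 0).2 K.zero_mem, fun x => by rw [hN, sub_zero]⟩, ?_⟩
  refine (Finset.card_filter_le _ _).trans ?_
  rw [Finset.card_vadd_finset]

/-- Adding K to A changes nothing in R and at most completes one further coset, so |K + A| ≤ |R| +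
|K| < |A| + |K|, against `hNS`. If K + A is everything, then |G| ≤ |R| + |K| ≤ 2|R|, against
`hsmall`. -/
theorem no_periodic_part {A : Finset G}
    (hNS : ∀ (K : AddSubgroup G) (N : Finset G), IsCoset K N → 2 ≤ N.card → (∃ p, p ∉ N + A) →
      N.card + A.card ≤ (N + A).card)
    (hsmall : Finite G → 3 * A.card ≤ Nat.card G + 3)
    {K : AddSubgroup G} {R : Finset G} (hR : R.Nonempty) (hRA : R ⊆ A)
    (hinv : ∀ k ∈ K, k +ᵥ R = R) {k : G} (hk : k ∈ K) (hk0 : k ≠ 0) {a : G} (ha : a ∈ A)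
    (haR : a ∉ R) (hrest : ∀ x ∈ A, x ∉ R → x - a ∈ K) : False := by
  obtain ⟨N, hN, hNc, hNR⟩ := exists_isCoset_of_invariant hR hinv
  have hN2 : 2 ≤ N.card :=
    Finset.one_lt_card.2 ⟨0, (hN 0).2 K.zero_mem, k, (hN k).2 hk, hk0.symm⟩
  have hsub : N + A ⊆ R ∪ (a +ᵥ N) := by
    intro x hx
    obtain ⟨n, hn, y, hy, rfl⟩ := Finset.mem_add.1 hx
    rw [Finset.mem_union]
    by_cases hyR : y ∈ R
    · left
      rw [← hinv n ((hN n).1 hn), mem_vadd_iff]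
      simpa using hyR
    · right
      rw [mem_vadd_iff, hN]
      have := K.add_mem ((hN n).1 hn) (hrest y hy hyR)
      convert this using 1; abel
  have h1 := Finset.card_le_card hsub
  have h2 := Finset.card_union_le R (a +ᵥ N)
  rw [Finset.card_vadd_finset] at h2
  have h3 : R.card + 1 ≤ A.card := by
    have := Finset.card_le_card (Finset.insert_subset ha hRA)
    rwa [Finset.card_insert_of_notMem haR] at this
  by_cases hp : ∃ p, p ∉ N + A
  · have := hNS K N hNc hN2 hp
    omega
  · push Not at hp
    have hfin : Finite G :=
      Set.finite_univ_iff.1 ((N + A).finite_toSet.subset fun x _ => hp x)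
    have := Fintype.ofFinite G
    have h4 := hsmall hfin
    have h5 : N + A = Finset.univ := Finset.eq_univ_of_forall hp
    rw [h5, Finset.card_univ, ← Nat.card_eq_fintype_card] at h1
    have : 0 < R.card := Finset.card_pos.2 hR
    omega

theorem vadd_eq_of_add_card_le {R M : Finset G} (h0 : (0 : G) ∈ M) (h : (R + M).card ≤ R.card)
    {g : G} (hg : g ∈ AddSubgroup.closure (M : Set G)) : g +ᵥ R = R := by
  refine vadd_eq_of_mem_closure (fun m hm => ?_) hg
  have h1 : R ⊆ R + M := fun x hx => Finset.mem_add.2 ⟨x, hx, 0, h0, by simp⟩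
  have h2 : R = R + M := Finset.eq_of_subset_of_card_le h1 h
  refine vadd_eq_of_subset ?_
  conv_rhs => rw [h2]
  rw [add_comm]
  exact Finset.vadd_finset_subset_add hm

/-- A Sidon set with at least three elements is not a `2`-fragment. -/
theorem not_sidon_fragment {A M : Finset G} (hA0 : (0 : G) ∈ A)
    (hgen : AddSubgroup.closure (A : Set G) = ⊤) (hA2 : 2 ≤ A.card)
    (hNS : ∀ (K : AddSubgroup G) (N : Finset G), IsCoset K N → 2 ≤ N.card → (∃ p, p ∉ N + A) →
      N.card + A.card ≤ (N + A).card)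
    (hsmall : Finite G → 3 * A.card ≤ Nat.card G + 3)
    (hM : IsSidon M) (h0 : (0 : G) ∈ M) (hM3 : 3 ≤ M.card) (hMo : TwoOut (A + M))
    (hle : (A + M).card + 1 ≤ A.card + M.card) : False := by
  classical
  set L := AddSubgroup.closure (M : Set G) with hL
  have hML : ∀ x ∈ M, x ∈ L := fun x hx => AddSubgroup.subset_closure hx
  obtain ⟨k, hk, hk0⟩ : ∃ k ∈ M, k ≠ 0 := by
    by_contra hcon
    push Not at hcon
    have : M ⊆ {0} := fun x hx => by simpa using hcon x hx
    have := Finset.card_le_card this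
    simp at this
    omega
  have hsplit : ∀ a, ((A.filter (fun x => x - a ∈ L)) + M).card +
      ((A.filter (fun x => ¬ x - a ∈ L)) + M).card ≤ (A + M).card := by
    intro a
    rw [← Finset.card_union_of_disjoint]
    · refine Finset.card_le_card (Finset.union_subset ?_ ?_) <;>
      exact Finset.add_subset_add_right (Finset.filter_subset _ _)
    · rw [Finset.disjoint_left]
      intro x hx hx'
      obtain ⟨y, hy, m, hm, rfl⟩ := Finset.mem_add.1 hx
      obtain ⟨y', hy', m', hm', heq⟩ := Finset.mem_add.1 hx'
      rw [Finset.mem_filter] at hy hy'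
      apply hy'.2
      have : y' - a = (y - a) + (m - m') := by
        rw [eq_sub_of_add_eq heq]; abel
      rw [this]
      exact L.add_mem hy.2 (L.sub_mem (hML m hm) (hML m' hm'))
  have hcardsplit : ∀ a, (A.filter (fun x => x - a ∈ L)).card +
      (A.filter (fun x => ¬ x - a ∈ L)).card = A.card := fun a =>
    Finset.card_filter_add_card_filter_not _
  have hmono : ∀ X : Finset G, X.card ≤ (X + M).card := fun X =>
    Finset.card_le_card fun x hx => Finset.mem_add.2 ⟨x, hx, 0, h0, by simp⟩
  -- A is cut along the cosets of the subgroup L generated by M. If one piece grows by at least |M|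
  -- - 1, the rest of A cannot grow, hence is L-invariant.
  by_cases hbad : ∃ a ∈ A, (A.filter (fun x => x - a ∈ L)).card + M.card ≤
      ((A.filter (fun x => x - a ∈ L)) + M).card + 1
  · obtain ⟨a, ha, hbad⟩ := hbad
    have h1 := hsplit a
    have h2 := hcardsplit a
    have hinv : ∀ g ∈ L, g +ᵥ (A.filter (fun x => ¬ x - a ∈ L)) =
        A.filter (fun x => ¬ x - a ∈ L) := fun g hg =>
      vadd_eq_of_add_card_le h0 (by omega) hg
    rcases (A.filter (fun x => ¬ x - a ∈ L)).eq_empty_or_nonempty with hR | hR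
    · have hall : ∀ x ∈ A, x - a ∈ L := by
        intro x hx
        by_contra hcon
        have : x ∈ A.filter (fun x => ¬ x - a ∈ L) := Finset.mem_filter.2 ⟨hx, hcon⟩
        rw [hR] at this
        simp at this
      have hLtop : L = ⊤ := by
        rw [eq_top_iff, ← hgen, AddSubgroup.closure_le]
        intro x hx
        have := L.sub_mem (hall x hx) (hall 0 hA0)
        simpa using this
      obtain ⟨p, r, hpr, hp, hr⟩ := hMo
      have := hM.card_add_le_of_coset h0 hM3 hA2 hall
        ⟨p, r, hpr, by rw [← hL, hLtop]; trivial, by rw [← hL, hLtop]; trivial, hp, hr⟩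
      omega
    · refine no_periodic_part hNS hsmall hR (Finset.filter_subset _ _) hinv (hML k hk) hk0 ha
        (by simp) ?_
      intro x hx hxR
      simpa [hx] using hxR
  · push Not at hbad
    -- Every piece now grows by less than |M| - 1, so by the Sidon inequality its sum with M misses
    -- at most one point of its coset. The reflected set p - M then rules out a missing point p.
    have hfull : ∀ a ∈ A, ∀ p, p - a ∈ L → p ∈ (A.filter (fun x => x - a ∈ L)) + M := by
      intro a ha p hp
      by_contra hpo
      have h1 := hbad a ha
      have haX : a ∈ A.filter (fun x => x - a ∈ L) := by simp [ha]
      have hX1 : 0 < (A.filter (fun x => x - a ∈ L)).card := Finset.card_pos.2 ⟨a, haX⟩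
      have hX2 : 2 ≤ (A.filter (fun x => x - a ∈ L)).card := by
        by_contra hlt
        have := Finset.card_le_card (Finset.vadd_finset_subset_add (t := M) haX)
        rw [Finset.card_vadd_finset] at this
        omega
      have hone : ∀ r, r - a ∈ L → r ∉ (A.filter (fun x => x - a ∈ L)) + M → r = p := by
        intro r hr hro
        by_contra hrp
        have := hM.card_add_le_of_coset h0 hM3 hX2 (a := a)
          (fun x hx => (Finset.mem_filter.1 hx).2) ⟨r, p, hrp, hr, hp, hro, hpo⟩
        omega
      have hd : Disjoint (A.filter (fun x => x - a ∈ L)) (p +ᵥ (-M)) := by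
        rw [Finset.disjoint_left]
        intro x hx hx'
        rw [mem_vadd_iff, Finset.mem_neg'] at hx'
        exact hpo (Finset.mem_add.2 ⟨x, hx, _, hx', by abel⟩)
      have hsub : A.filter (fun x => x - a ∈ L) ∪ (p +ᵥ (-M)) ⊆
          insert p ((A.filter (fun x => x - a ∈ L)) + M) := by
        intro x hx
        rw [Finset.mem_insert]
        by_contra hcon
        push Not at hcon
        apply hcon.1
        refine hone x ?_ hcon.2
        rw [Finset.mem_union] at hx
        rcases hx with hx | hx
        · exact (Finset.mem_filter.1 hx).2
        · rw [mem_vadd_iff, Finset.mem_neg'] at hx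
          have := L.sub_mem hp (hML _ hx)
          convert this using 1; abel
      have h3 := Finset.card_le_card hsub
      have h4 := Finset.card_insert_le p ((A.filter (fun x => x - a ∈ L)) + M)
      rw [Finset.card_union_of_disjoint hd, Finset.card_vadd_finset, Finset.card_neg] at h3
      omega
    have hinv : ∀ g ∈ L, g +ᵥ (A + M) = A + M := by
      intro g hg
      refine vadd_eq_of_subset fun x hx => ?_
      rw [mem_vadd_iff] at hx
      obtain ⟨y, hy, m, hm, hym⟩ := Finset.mem_add.1 hx
      refine Finset.add_subset_add_right (Finset.filter_subset _ _) (hfull y hy x ?_)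
      have : x - y = g + m := by rw [eq_add_of_sub_eq hym.symm]; abel
      rw [this]
      exact L.add_mem hg (hML m hm)
    obtain ⟨N, hN, hNc, -⟩ := exists_isCoset_of_invariant ⟨0 + 0, Finset.add_mem_add hA0 h0⟩ hinv
    have hMN : M ⊆ N := fun x hx => (hN x).2 (hML x hx)
    have hMNc := Finset.card_le_card hMN
    -- As A + M is L-invariant, |L + A| ≤ |A + M| < |A| + |M| ≤ |A| + |L|, which `hNS` forbids.
    have hNA : N + A ⊆ A + M := by
      intro x hx
      obtain ⟨n, hn, y, hy, rfl⟩ := Finset.mem_add.1 hx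
      rw [← hinv n ((hN n).1 hn), mem_vadd_iff]
      exact Finset.mem_add.2 ⟨y, hy, 0, h0, by abel⟩
    obtain ⟨p, r, hpr, hp, hr⟩ := hMo
    have h1 := hNS L N hNc (by omega) ⟨p, fun h => hp (hNA h)⟩
    have h2 := Finset.card_le_card hNA
    omega

theorem IsSidon.vadd {M : Finset G} (hM : IsSidon M) (a : G) : IsSidon (a +ᵥ M) := by
  intro g hg x hx y hy hxg hyg
  rw [mem_vadd_iff] at hx hy hxg hyg
  have := hM g hg _ hx _ hy (by convert hxg using 1; abel) (by convert hyg using 1; abel)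
  simpa using this

/-- Inverse theorem: a generating set all of whose subgroup expansions are large, and for which
Vosper's inequality fails, is a progression. -/
theorem isProgression_of_fragment {A : Finset G} (hA0 : (0 : G) ∈ A)
    (hgen : AddSubgroup.closure (A : Set G) = ⊤) (hA2 : 2 ≤ A.card)
    (hCD : ∀ X : Finset G, X.Nonempty → (∃ p, p ∉ X + A) → X.card + A.card ≤ (X + A).card + 1)
    (hNS : ∀ (K : AddSubgroup G) (N : Finset G), IsCoset K N → 2 ≤ N.card → (∃ p, p ∉ N + A) →
      N.card + A.card ≤ (N + A).card)
    (hsmall : Finite G → 3 * A.card ≤ Nat.card G + 3)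
    {X : Finset G} (hX2 : 2 ≤ X.card) (hXo : TwoOut (X + A))
    (hXle : (X + A).card + 1 ≤ X.card + A.card) :
    ∃ d, AddSubgroup.zmultiples d = ⊤ ∧ IsProgression d (A : Set G) := by
  obtain ⟨M, hM2, hMo, hMle, hM⟩ := exists_atom (S := A) (κ := A.card - 1) (fun Y h1 h2 => by
    obtain ⟨p, r, hpr, hp, hr⟩ := h2
    have := hCD Y (Finset.card_pos.1 (by omega)) ⟨p, hp⟩
    omega) ⟨X, hX2, hXo, by omega⟩
  rcases hM with ⟨K, hK⟩ | hM
  · obtain ⟨p, r, hpr, hp, hr⟩ := hMo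
    have := hNS K M hK hM2 ⟨p, hp⟩
    omega
  -- A two-element atom {m, m + g} says that A is almost invariant under g.
  rcases Nat.lt_or_ge M.card 3 with h | h
  · obtain ⟨m, m', hmm, rfl⟩ := Finset.card_eq_two.1 (by omega : M.card = 2)
    set g := m' - m with hg
    have hg0 : g ≠ 0 := sub_ne_zero.2 hmm.symm
    have hsum : ({m, m'} : Finset G) + A = m +ᵥ (A ∪ (g +ᵥ A)) := by
      ext x
      simp only [Finset.mem_add, Finset.mem_insert, Finset.mem_singleton, mem_vadd_iff,
        Finset.mem_union]
      constructor
      · rintro ⟨y, rfl | rfl, a, ha, rfl⟩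
        · left; simpa using ha
        · right
          convert ha using 1
          rw [hg]; abel
      · rintro (h | h)
        · exact ⟨m, Or.inl rfl, _, h, by abel⟩
        · exact ⟨m', Or.inr rfl, _, h, by rw [hg]; abel⟩
    rw [hsum, Finset.card_vadd_finset, Finset.card_pair hmm] at hMle
    by_cases hinv : g +ᵥ A = A
    · obtain ⟨N, hN, hNc, -⟩ := exists_isCoset_of_invariant (K := AddSubgroup.zmultiples g)
        ⟨0, hA0⟩ (fun k hk => vadd_eq_of_mem_zmultiples hinv hk)
      have hNA : N + A ⊆ A := by
        intro x hx
        obtain ⟨n, hn, y, hy, rfl⟩ := Finset.mem_add.1 hx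
        rw [← vadd_eq_of_mem_zmultiples hinv ((hN n).1 hn), mem_vadd_iff]
        simpa using hy
      have hN2 : 2 ≤ N.card := Finset.one_lt_card.2
        ⟨0, (hN 0).2 (zero_mem _), g, (hN g).2 (AddSubgroup.mem_zmultiples g), hg0.symm⟩
      have h1 := Finset.card_le_card hNA
      obtain ⟨p, r, hpr, hp, hr⟩ := hXo
      have hAX : ∃ p, p ∉ A := by
        obtain ⟨x, hx⟩ : X.Nonempty := Finset.card_pos.1 (by omega)
        exact ⟨p - x, fun hcon => hp (Finset.mem_add.2 ⟨x, hx, _, hcon, by abel⟩)⟩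
      obtain ⟨p', hp'⟩ := hAX
      have := hNS _ N hNc hN2 ⟨p', fun h => hp' (hNA h)⟩
      omega
    · obtain ⟨b, n, R, hn, hb, hR, hAR, hdis⟩ := exists_prog_union (by omega) hinv
      rcases R.eq_empty_or_nonempty with rfl | hRne
      · rw [Finset.union_empty] at hAR
        refine ⟨g, ?_, by rw [hAR]; exact isProgression_prog b g hn⟩
        rw [eq_top_iff, ← hgen, AddSubgroup.closure_le]
        rw [hAR] at hA0 ⊢
        obtain ⟨i, -, hi⟩ := mem_prog.1 hA0
        intro x hx
        obtain ⟨j, -, hj⟩ := mem_prog.1 (Finset.mem_coe.1 hx)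
        have : x = (j : ℤ) • g - (i : ℤ) • g := by
          rw [hj, natCast_zsmul, natCast_zsmul, eq_neg_of_add_eq_zero_left hi.symm]; abel
        rw [this]
        exact sub_mem (zsmul_mem (AddSubgroup.mem_zmultiples g) _)
          (zsmul_mem (AddSubgroup.mem_zmultiples g) _)
      -- A is a g-chain together with a nonempty invariant set under the subgroup generated by g.
      · exfalso
        have hbP : b ∈ prog b g n := mem_prog.2 ⟨0, by omega, by simp⟩
        refine no_periodic_part hNS hsmall (K := AddSubgroup.zmultiples g) hRne
          (by rw [hAR]; exact Finset.subset_union_right)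
          (fun k hk => vadd_eq_of_mem_zmultiples hR hk) (AddSubgroup.mem_zmultiples g) hg0 hb
          (fun h => Finset.disjoint_left.1 hdis hbP h) ?_
        intro x hx hxR
        rw [hAR, Finset.mem_union] at hx
        obtain ⟨i, -, rfl⟩ := mem_prog.1 (hx.resolve_right hxR)
        simp
  · exfalso
    obtain ⟨m, hm⟩ : M.Nonempty := Finset.card_pos.1 (by omega)
    have hsum : A + (-m +ᵥ M) = -m +ᵥ (M + A) := by rw [add_comm A, vadd_add_assoc]
    refine not_sidon_fragment hA0 hgen hA2 hNS hsmall (hM.vadd (-m))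
      (by rw [mem_vadd_iff]; simpa using hm) (by rwa [Finset.card_vadd_finset]) ?_ ?_
    · rw [hsum]; exact twoOut_vadd _ hMo
    · rw [hsum, Finset.card_vadd_finset, Finset.card_vadd_finset]; omega

end Inverse

end SmallSum

namespace SmallSum

/-! ### The second connectivity as a bound on sumsets -/

section Kappa

variable {G : Type*} [AddCommGroup G] [DecidableEq G]

theorem twoOut_iff {Y : Finset G} : TwoOut Y ↔ (2 : ℕ∞) ≤ ((Y : Set G)ᶜ).encard := by
  have : (2 : ℕ∞) ≤ ((Y : Set G)ᶜ).encard ↔ 1 < ((Y : Set G)ᶜ).encard := by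
    rw [← one_add_one_eq_two, ENat.add_one_le_iff (by simp)]
  rw [this, Set.one_lt_encard_iff]
  constructor
  · rintro ⟨p, r, hpr, hp, hr⟩
    exact ⟨p, r, by simpa using hp, by simpa using hr, hpr⟩
  · rintro ⟨p, r, hp, hr, hpr⟩
    exact ⟨p, r, hpr, by simpa using hp, by simpa using hr⟩

theorem admissible_two_iff {S X : Finset G} : Admissible 2 S X ↔ 2 ≤ X.card ∧ TwoOut (X + S) := by
  rw [twoOut_iff]; rfl

theorem card_boundary {S X : Finset G} (h0 : (0 : G) ∈ S) :
    X.card + (boundary S X).card = (X + S).card := by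
  have h : X ⊆ X + S := fun x hx => Finset.mem_add.2 ⟨x, hx, 0, h0, by simp⟩
  have := Finset.card_sdiff_add_card_eq_card h
  unfold boundary
  omega

theorem card_add_kappa_le {S X : Finset G} (h0 : (0 : G) ∈ S) (hX : 2 ≤ X.card)
    (hXo : TwoOut (X + S)) : X.card + kappa 2 S ≤ (X + S).card := by
  have hadm : Admissible 2 S X := admissible_two_iff.2 ⟨hX, hXo⟩
  rw [← card_boundary h0]
  have : kappa 2 S ≤ (boundary S X).card := by
    rw [kappa, if_pos ⟨X, hadm⟩]
    exact Nat.sInf_le ⟨X, hadm, rfl⟩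
  omega

theorem kappa_eq_of_forall {S X : Finset G} {k : ℕ} (h0 : (0 : G) ∈ S) (hX : 2 ≤ X.card)
    (hXo : TwoOut (X + S)) (hXk : (X + S).card = X.card + k)
    (hall : ∀ Y : Finset G, 2 ≤ Y.card → TwoOut (Y + S) → Y.card + k ≤ (Y + S).card) :
    kappa 2 S = k := by
  have hadm : Admissible 2 S X := admissible_two_iff.2 ⟨hX, hXo⟩
  rw [kappa, if_pos ⟨X, hadm⟩]
  have hbX := card_boundary (X := X) h0
  refine le_antisymm (Nat.sInf_le ⟨X, hadm, by omega⟩) ?_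
  refine le_csInf ⟨_, X, hadm, rfl⟩ ?_
  rintro m ⟨Y, hY, rfl⟩
  obtain ⟨h1, h2⟩ := admissible_two_iff.1 hY
  have := hall Y h1 h2
  have := card_boundary (X := Y) h0
  omega

end Kappa

/-! ### Fibres over the quotient -/

section Fibres

variable {G : Type*} [AddCommGroup G] [DecidableEq G] (H : AddSubgroup G)
  [DecidableEq (G ⧸ H)]

/-- The image of `X` in the quotient by `H`. -/
def img (X : Finset G) : Finset (G ⧸ H) := X.image (QuotientAddGroup.mk' H)

/-- The part of `X` inside the coset `c`. -/
def fib (X : Finset G) (c : G ⧸ H) : Finset G := X.filter fun x => (x : G ⧸ H) = c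

variable {H}

theorem mem_img {X : Finset G} {c : G ⧸ H} : c ∈ img H X ↔ ∃ x ∈ X, (x : G ⧸ H) = c := by
  simp [img]

theorem mem_fib {X : Finset G} {c : G ⧸ H} {x : G} : x ∈ fib H X c ↔ x ∈ X ∧ (x : G ⧸ H) = c := by
  simp [fib]

theorem fib_nonempty_iff {X : Finset G} {c : G ⧸ H} : (fib H X c).Nonempty ↔ c ∈ img H X := by
  rw [mem_img]
  constructor
  · rintro ⟨x, hx⟩
    exact ⟨x, mem_fib.1 hx⟩
  · rintro ⟨x, hx⟩
    exact ⟨x, mem_fib.2 hx⟩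

theorem card_fib_pos {X : Finset G} {c : G ⧸ H} : 0 < (fib H X c).card ↔ c ∈ img H X := by
  rw [Finset.card_pos, fib_nonempty_iff]

theorem img_add (X Y : Finset G) : img H (X + Y) = img H X + img H Y := Finset.image_add _

theorem fib_add_subset {X Y : Finset G} (a b : G ⧸ H) :
    fib H X a + fib H Y b ⊆ fib H (X + Y) (a + b) := by
  intro x hx
  obtain ⟨y, hy, z, hz, rfl⟩ := Finset.mem_add.1 hx
  rw [mem_fib] at hy hz ⊢
  refine ⟨Finset.add_mem_add hy.1 hz.1, ?_⟩
  rw [QuotientAddGroup.mk_add, hy.2, hz.2]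

theorem card_eq_sum_fib (X : Finset G) : X.card = ∑ c ∈ img H X, (fib H X c).card :=
  Finset.card_eq_sum_card_image _ _

theorem card_eq_sum_fib_univ [Fintype (G ⧸ H)] (X : Finset G) :
    X.card = ∑ c : G ⧸ H, (fib H X c).card :=
  Finset.card_eq_sum_card_fiberwise (fun _ _ => Finset.mem_coe.2 (Finset.mem_univ _))

theorem card_fib_add_ge_left {X Y : Finset G} {a b : G ⧸ H} (hb : b ∈ img H Y) :
    (fib H X a).card ≤ (fib H (X + Y) (a + b)).card :=
  (Finset.card_le_card_add_right (fib_nonempty_iff.2 hb)).trans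
    (Finset.card_le_card (fib_add_subset a b))

theorem card_fib_add_ge_right {X Y : Finset G} {a b : G ⧸ H} (ha : a ∈ img H X) :
    (fib H Y b).card ≤ (fib H (X + Y) (a + b)).card :=
  (Finset.card_le_card_add_left (fib_nonempty_iff.2 ha)).trans
    (Finset.card_le_card (fib_add_subset a b))

variable [Finite H]

theorem coset_finite (c : G ⧸ H) : {x : G | (x : G ⧸ H) = c}.Finite := by
  obtain ⟨g, rfl⟩ := QuotientAddGroup.mk_surjective c
  refine (Set.Finite.image (fun x => g + x) (Set.toFinite (H : Set G))).subset ?_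
  intro x hx
  refine ⟨-g + x, QuotientAddGroup.eq.1 (Eq.symm hx), by simp⟩

variable (H) in
/-- The coset `c` as a finset of `G`. -/
noncomputable def cos (c : G ⧸ H) : Finset G := (coset_finite c).toFinset

theorem mem_cos {c : G ⧸ H} {x : G} : x ∈ cos H c ↔ (x : G ⧸ H) = c := by simp [cos]

theorem card_cos (c : G ⧸ H) : (cos H c).card = Nat.card H := by
  obtain ⟨g, rfl⟩ := QuotientAddGroup.mk_surjective c
  have h1 : ((cos H (g : G ⧸ H) : Finset G) : Set G) = (fun x => g + x) '' (H : Set G) := by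
    ext x
    simp only [Finset.mem_coe, mem_cos, Set.mem_image, SetLike.mem_coe]
    constructor
    · intro h
      exact ⟨-g + x, QuotientAddGroup.eq.1 h.symm, by simp⟩
    · rintro ⟨y, hy, rfl⟩
      exact (QuotientAddGroup.eq.2 (by simpa using hy)).symm
  rw [← Set.ncard_coe_finset, h1, Set.ncard_image_of_injective _ (add_right_injective g)]
  rfl

theorem fib_subset_cos (X : Finset G) (c : G ⧸ H) : fib H X c ⊆ cos H c := fun _ hx =>
  mem_cos.2 (mem_fib.1 hx).2

theorem card_fib_le (X : Finset G) (c : G ⧸ H) : (fib H X c).card ≤ Nat.card H := by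
  rw [← card_cos c]
  exact Finset.card_le_card (fib_subset_cos X c)

theorem fib_eq_cos {X : Finset G} {c : G ⧸ H} (h : Nat.card H ≤ (fib H X c).card) :
    fib H X c = cos H c :=
  Finset.eq_of_subset_of_card_le (fib_subset_cos X c) (by rwa [card_cos])

/-- Two large pieces add up to a full coset. -/
theorem card_fib_add_eq {X Y : Finset G} {a b : G ⧸ H}
    (h : Nat.card H < (fib H X a).card + (fib H Y b).card) :
    (fib H (X + Y) (a + b)).card = Nat.card H := by
  refine le_antisymm (card_fib_le _ _) ?_
  rw [← card_cos (a + b)]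
  refine Finset.card_le_card fun z hz => fib_add_subset a b ?_
  rw [mem_cos] at hz
  have h1 : ¬ Disjoint (fib H X a) (z +ᵥ (-fib H Y b)) := by
    intro hd
    have h2 : fib H X a ∪ (z +ᵥ (-fib H Y b)) ⊆ cos H a := by
      refine Finset.union_subset (fib_subset_cos X a) fun x hx => ?_
      rw [mem_vadd_iff, Finset.mem_neg', mem_fib] at hx
      rw [mem_cos]
      have h3 := hx.2
      rw [neg_sub, QuotientAddGroup.mk_sub, hz] at h3
      have h4 : (x : G ⧸ H) = a + b - (a + b - x) := by abel
      rw [h4, h3]; abel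
    have h3 := Finset.card_le_card h2
    rw [Finset.card_union_of_disjoint hd, Finset.card_vadd_finset, Finset.card_neg, card_cos] at h3
    omega
  obtain ⟨x, hx, hx'⟩ := Finset.not_disjoint_iff.1 h1
  rw [mem_vadd_iff, Finset.mem_neg'] at hx'
  exact Finset.mem_add.2 ⟨x, hx, _, hx', by abel⟩

variable (H) in
/-- The preimage in `G` of a finite set of cosets. -/
noncomputable def pull (Y : Finset (G ⧸ H)) : Finset G := Y.biUnion (cos H)

theorem mem_pull {Y : Finset (G ⧸ H)} {x : G} : x ∈ pull H Y ↔ (x : G ⧸ H) ∈ Y := by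
  simp [pull, mem_cos]

theorem card_pull (Y : Finset (G ⧸ H)) : (pull H Y).card = Y.card * Nat.card H := by
  rw [pull, Finset.card_biUnion]
  · simp [card_cos]
  · intro a _ b _ hab
    rw [Function.onFun, Finset.disjoint_left]
    intro x hx hx'
    rw [mem_cos] at hx hx'
    exact hab (hx.symm.trans hx')

theorem pull_add (Y : Finset (G ⧸ H)) (S : Finset G) : pull H Y + S = pull H (Y + img H S) := by
  ext x
  rw [mem_pull, Finset.mem_add, Finset.mem_add]
  constructor
  · rintro ⟨y, hy, s, hs, rfl⟩
    exact ⟨_, mem_pull.1 hy, _, mem_img.2 ⟨s, hs, rfl⟩, by rw [QuotientAddGroup.mk_add]⟩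
  · rintro ⟨y, hy, z, hz, hyz⟩
    obtain ⟨s, hs, rfl⟩ := mem_img.1 hz
    refine ⟨x - s, mem_pull.2 ?_, s, hs, by abel⟩
    rw [QuotientAddGroup.mk_sub, ← hyz]
    simpa using hy

theorem twoOut_pull {Y : Finset (G ⧸ H)} (hH : 2 ≤ Nat.card H) {p : G ⧸ H} (hp : p ∉ Y) :
    TwoOut (pull H Y) := by
  rw [← card_cos p] at hH
  obtain ⟨a, ha, b, hb, hab⟩ := Finset.one_lt_card.1 hH
  rw [mem_cos] at ha hb
  exact ⟨a, b, hab, by rw [mem_pull, ha]; exact hp, by rw [mem_pull, hb]; exact hp⟩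

theorem card_le_card_img_mul (X : Finset G) : X.card ≤ (img H X).card * Nat.card H := by
  rw [← card_pull]
  exact Finset.card_le_card fun x hx => mem_pull.2 (mem_img.2 ⟨x, hx, rfl⟩)

end Fibres

/-! ### What a hyper-atom provides in the quotient -/

section HyperAtom

variable {G : Type*} [AddCommGroup G] [DecidableEq G]

/-- What is used about a hyper-atom `H` of the generating set `S`: the second connectivity
of `S` is `(u - 1) |H|` with `u` the number of cosets of `H` meeting `S`, and no larger finite
subgroup attains it. -/
structure HyperAtomData (S : Finset G) (H : AddSubgroup G) [DecidableEq (G ⧸ H)] : Prop where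
  zero_mem : (0 : G) ∈ S
  closure_eq : AddSubgroup.closure (S : Set G) = ⊤
  finite : Finite H
  two_le : 2 ≤ Nat.card H
  two_le_img : 2 ≤ (img H S).card
  exists_notMem : ∃ p, p ∉ img H S
  le_card_add : ∀ X : Finset G, 2 ≤ X.card → TwoOut (X + S) →
    X.card + ((img H S).card - 1) * Nat.card H ≤ (X + S).card
  cauchyDavenport : ∀ X : Finset (G ⧸ H), X.Nonempty → (∃ p, p ∉ X + img H S) →
    X.card + (img H S).card ≤ (X + img H S).card + 1
  coset_expansion : ∀ (K : AddSubgroup (G ⧸ H)) (N : Finset (G ⧸ H)), IsCoset K N → 2 ≤ N.card →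
    (∃ p, p ∉ N + img H S) → N.card + (img H S).card ≤ (N + img H S).card

/-- Since H + S is the union of the u cosets meeting S, κ₂(S) = (u-1)h. Preimages turn inequalities
for S into inequalities for its image, multiplied by h. -/
theorem IsHyperAtom.data {S : Finset G} {H : AddSubgroup G} [DecidableEq (G ⧸ H)]
    (h0 : (0 : G) ∈ S) (hgen : AddSubgroup.closure (S : Set G) = ⊤) (hH : IsHyperAtom S H) :
    HyperAtomData S H := by
  obtain ⟨⟨X, hXH, hXadm, hXk⟩, hmax⟩ := hH
  obtain ⟨hX2, hXo⟩ := admissible_two_iff.1 hXadm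
  have hmem : ∀ x, x ∈ X ↔ x ∈ H := fun x => by
    rw [← Finset.mem_coe, hXH]; rfl
  have hfin : Finite H := Set.Finite.to_subtype (by rw [← hXH]; exact X.finite_toSet)
  have hX0 : X = pull H {0} := by
    ext x
    rw [hmem, mem_pull, Finset.mem_singleton]
    exact (QuotientAddGroup.eq_zero_iff x).symm
  have hXc : X.card = Nat.card H := by rw [hX0, card_pull]; simp
  have hXS : X + S = pull H (img H S) := by rw [hX0, pull_add, Finset.singleton_zero, zero_add]
  have h0i : (0 : G ⧸ H) ∈ img H S := mem_img.2 ⟨0, h0, rfl⟩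
  have hk : Nat.card H + kappa 2 S = (img H S).card * Nat.card H := by
    rw [← card_pull, ← hXS, ← card_boundary h0, hXk, hXc]
  have hpos : 0 < (img H S).card := Finset.card_pos.2 ⟨0, h0i⟩
  have hk' : kappa 2 S = ((img H S).card - 1) * Nat.card H := by
    obtain ⟨m, hm⟩ : ∃ m, (img H S).card = m + 1 := ⟨(img H S).card - 1, by omega⟩
    rw [hm, add_mul, one_mul] at hk
    rw [hm, Nat.add_sub_cancel]
    omega
  have hout : ∃ p, p ∉ img H S := by
    obtain ⟨p, r, hpr, hp, hr⟩ := hXo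
    rw [hXS, mem_pull] at hp
    exact ⟨_, hp⟩
  have hle : ∀ X : Finset G, 2 ≤ X.card → TwoOut (X + S) →
      X.card + ((img H S).card - 1) * Nat.card H ≤ (X + S).card := fun Y h1 h2 => by
    rw [← hk']; exact card_add_kappa_le h0 h1 h2
  have hCD : ∀ X : Finset (G ⧸ H), X.Nonempty → (∃ p, p ∉ X + img H S) →
      X.card + (img H S).card ≤ (X + img H S).card + 1 := by
    rintro Y hY ⟨p, hp⟩
    have h1 := hle (pull H Y) (by
      rw [card_pull]
      have := Finset.card_pos.2 hY
      nlinarith) (by rw [pull_add]; exact twoOut_pull (by omega) hp)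
    rw [pull_add, card_pull, card_pull, ← add_mul] at h1
    have := Nat.le_of_mul_le_mul_right h1 (by omega)
    omega
  have hu2 : 2 ≤ (img H S).card := by
    by_contra hlt
    have h1 : (img H S).card = 1 := by omega
    obtain ⟨a, ha⟩ := Finset.card_eq_one.1 h1
    rw [ha, Finset.mem_singleton] at h0i
    subst h0i
    have hSH : ∀ s ∈ S, s ∈ H := by
      intro s hs
      have : (s : G ⧸ H) ∈ img H S := mem_img.2 ⟨s, hs, rfl⟩
      rw [ha, Finset.mem_singleton] at this
      exact (QuotientAddGroup.eq_zero_iff s).1 this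
    have hHtop : H = ⊤ := by
      rw [eq_top_iff, ← hgen, AddSubgroup.closure_le]
      exact hSH
    obtain ⟨p, r, hpr, hp, hr⟩ := hXo
    exact hp (Finset.mem_add.2 ⟨p, by rw [hmem, hHtop]; trivial, 0, h0, by simp⟩)
  refine ⟨h0, hgen, hfin, by omega, hu2, hout, hle, hCD, ?_⟩
  rintro K N ⟨n, hn, hK⟩ hN2 ⟨p, hp⟩
  by_contra hlt
  set N₀ : Finset (G ⧸ H) := -n +ᵥ N with hN₀
  have hN₀mem : ∀ x, x ∈ N₀ ↔ x ∈ K := fun x => by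
    rw [hN₀, mem_vadd_iff, hK]; simp
  have hN₀c : N₀.card = N.card := Finset.card_vadd_finset _ _
  have hsum : N₀ + img H S = -n +ᵥ (N + img H S) := vadd_add_assoc _ _ _
  have hp' : -n + p ∉ N₀ + img H S := by
    rw [hsum, mem_vadd_iff]; simpa using hp
  have h1 := hCD N₀ ⟨0, (hN₀mem 0).2 K.zero_mem⟩ ⟨_, hp'⟩
  have h2 : (N₀ + img H S).card = (N + img H S).card := by
    rw [hsum, Finset.card_vadd_finset]
  have h3 : (N₀ + img H S).card = N₀.card + ((img H S).card - 1) := by omega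
  -- A coset of K attaining Cauchy–Davenport equality would make the preimage of K a 2-fragment
  -- containing H; maximality then leaves only K trivial.
  have hfrag : IsSubgroupFragment S (K.comap (QuotientAddGroup.mk' H)) := by
    refine ⟨pull H N₀, ?_, admissible_two_iff.2 ⟨?_, ?_⟩, ?_⟩
    · ext x
      rw [Finset.mem_coe, mem_pull, hN₀mem]
      rfl
    · rw [card_pull]; nlinarith
    · rw [pull_add]; exact twoOut_pull (by omega) hp'
    · have h4 := card_boundary (X := pull H N₀) h0
      rw [pull_add, card_pull, card_pull, h3, add_mul, ← hk'] at h4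
      omega
  have hle' := hmax hfrag (by
    intro x hx
    rw [AddSubgroup.mem_comap]
    have : QuotientAddGroup.mk' H x = 0 := (QuotientAddGroup.eq_zero_iff x).2 hx
    rw [this]; exact K.zero_mem)
  have hN₀1 : N₀ ⊆ {0} := by
    intro c hc
    obtain ⟨x, rfl⟩ := QuotientAddGroup.mk_surjective c
    rw [Finset.mem_singleton]
    exact (QuotientAddGroup.eq_zero_iff x).2 (hle' ((hN₀mem _).1 hc))
  have := Finset.card_le_card hN₀1
  rw [Finset.card_singleton] at this
  omega

end HyperAtom

end SmallSum

namespace SmallSum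

/-! ### The configuration of the theorem and the matching of cosets -/

variable {G : Type*} [AddCommGroup G] [DecidableEq G]

theorem IsAperiodic.eq_zero {X : Finset G} (hX : IsAperiodic X) {g : G}
    (h : ∀ x ∈ X, g + x ∈ X) : g = 0 := by
  have h1 : g +ᵥ X = X := by
    refine Finset.eq_of_subset_of_card_le ?_ (Finset.card_vadd_finset _ _).ge
    intro x hx
    rw [mem_vadd_iff] at hx
    simpa using h _ hx
  have h2 : g ∈ AddAction.stabilizer G (X : Set G) := by
    rw [AddAction.mem_stabilizer_iff, ← Finset.coe_vadd_finset, h1]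
  rw [hX] at h2
  exact h2

/-- A pair `S, T` as in the theorem, with `H` a hyper-atom of `S`. -/
structure Config (S T : Finset G) (H : AddSubgroup G) [DecidableEq (G ⧸ H)] (μ : ℕ) : Prop where
  data : HyperAtomData S H
  mu_le : μ ≤ 1
  card_left : 3 ≤ S.card + μ
  card_right : 4 ≤ T.card + 2 * μ
  card_le : S.card ≤ T.card
  aper : IsAperiodic (S + T)
  card_add : (S + T).card + μ = S.card + T.card
  size : Finite G → 3 * (S + T).card ≤ 2 * Nat.card G + 2 * μ

namespace Config

variable {S T : Finset G} {H : AddSubgroup G} [DecidableEq (G ⧸ H)] {μ : ℕ}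

theorem nonempty_right (C : Config S T H μ) : T.Nonempty := by
  have := C.card_left
  have := C.card_le
  have := C.mu_le
  exact Finset.card_pos.1 (by omega)

theorem card_group (H : AddSubgroup G) :
    Nat.card G = Nat.card (G ⧸ H) * Nat.card H := AddSubgroup.card_eq_card_quotient_mul_card_addSubgroup H

theorem img_card_lt (C : Config S T H μ) [Finite G] : (img H S).card < Nat.card (G ⧸ H) := by
  obtain ⟨p, hp⟩ := C.data.exists_notMem
  have := Fintype.ofFinite (G ⧸ H)
  rw [Nat.card_eq_fintype_card]
  exact Finset.card_lt_univ_of_notMem hp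

/-- With at most one element missed, the size bound gives |G| ≤ 3 + 2μ ≤ 5, whereas q > u ≥ 2 and h
≥ 2 give |G| ≥ 6. -/
theorem twoOut (C : Config S T H μ) : TwoOut (T + S) := by
  by_contra hcon
  have hfin := finite_of_not_twoOut hcon
  have h1 : Nat.card G ≤ (T + S).card + 1 := by
    have := Fintype.ofFinite G
    rw [Nat.card_eq_fintype_card]
    exact card_le_of_not_twoOut hcon
  have h2 := C.size hfin
  have h3 := C.img_card_lt
  have h4 := C.data.two_le
  have h5 := C.data.two_le_img
  have h6 := C.mu_le
  rw [add_comm T S] at h1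
  have h7 : 3 * 2 ≤ Nat.card G := by
    rw [card_group H]; exact Nat.mul_le_mul (by omega) h4
  omega

/-- The total deficiency of `S` in its cosets is at most `|H| - μ`. -/
theorem card_left_ge (C : Config S T H μ) :
    (img H S).card * Nat.card H + μ ≤ S.card + Nat.card H := by
  have h1 := C.data.le_card_add T (by
    have := C.card_left
    have := C.card_le
    have := C.mu_le
    omega) C.twoOut
  have h2 := C.card_add
  rw [add_comm S T] at h2
  have h3 := C.data.two_le_img
  obtain ⟨m, hm⟩ : ∃ m, (img H S).card = m + 1 := ⟨(img H S).card - 1, by omega⟩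
  rw [hm, Nat.add_sub_cancel] at h1
  rw [hm, add_mul]
  omega

theorem card_sum_fib_le [Finite H] {X : Finset G} {P : Finset (G ⧸ H)} (hP : P ⊆ img H X) :
    X.card + P.card * Nat.card H ≤
      ∑ c ∈ P, (fib H X c).card + (img H X).card * Nat.card H := by
  have h1 := Finset.sum_sdiff hP (f := fun c => (fib H X c).card)
  have h2 : ∑ c ∈ img H X \ P, (fib H X c).card ≤ (img H X \ P).card * Nat.card H := by
    rw [← smul_eq_mul]
    exact Finset.sum_le_card_nsmul _ _ _ fun c _ => card_fib_le _ _
  have h3 := Finset.card_sdiff_add_card_eq_card hP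
  rw [← card_eq_sum_fib] at h1
  rw [← h3, add_mul]
  omega

/-- The defects of these two fibres alone cannot exceed the total defect, which is at most h - μ. -/
theorem card_fib_add_card_fib (C : Config S T H μ) {a a' : G ⧸ H} (ha : a ∈ img H S)
    (ha' : a' ∈ img H S) (hne : a ≠ a') :
    Nat.card H + μ ≤ (fib H S a).card + (fib H S a').card := by
  have := C.data.finite
  have h1 := card_sum_fib_le (H := H) (X := S) (P := {a, a'})
    (Finset.insert_subset ha (Finset.singleton_subset_iff.2 ha'))
  rw [Finset.sum_pair hne, Finset.card_pair hne] at h1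
  have := C.card_left_ge
  omega

/-- Cauchy-Davenport inequality in the quotient. -/
theorem card_img_add (C : Config S T H μ) {X : Finset (G ⧸ H)} (hX : X.Nonempty)
    (hp : ∃ p, p ∉ img H S + X) : X.card + (img H S).card ≤ (img H S + X).card + 1 := by
  rw [add_comm (img H S)] at hp ⊢
  exact C.data.cauchyDavenport X hX hp

theorem not_forall_full (C : Config S T H μ)
    (h : ∀ c ∈ img H T, Nat.card H ≤ (fib H T c).card) : False := by
  have hf := C.data.finite
  have h2 := C.data.two_le
  obtain ⟨⟨g, hg⟩, hg0⟩ : ∃ g : H, g ≠ 0 := by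
    by_contra hcon
    push Not at hcon
    have : Subsingleton H := ⟨fun a b => by rw [hcon a, hcon b]⟩
    have := Finite.card_le_one_iff_subsingleton (α := H) |>.2 this
    omega
  refine hg0 (Subtype.ext (C.aper.eq_zero (g := g) ?_))
  intro x hx
  obtain ⟨s, hs, t, ht, rfl⟩ := Finset.mem_add.1 hx
  refine Finset.mem_add.2 ⟨s, hs, g + t, ?_, by abel⟩
  have h3 := fib_eq_cos (h (t : G ⧸ H) (mem_img.2 ⟨t, ht, rfl⟩))
  have h4 : g + t ∈ fib H T (t : G ⧸ H) := by
    rw [h3, mem_cos, QuotientAddGroup.mk_add, (QuotientAddGroup.eq_zero_iff g).2 hg, zero_add]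
  exact (mem_fib.1 h4).1

/-- Hall's theorem. Its condition for a set X of cosets is the Cauchy–Davenport inequality for X ∪
{b₀}, or `hw` when the sum with X ∪ {b₀} is everything. -/
theorem exists_matching (C : Config S T H μ)
    (hw : (img H S).card + (img H T).card ≤ (img H S + img H T).card)
    {b₀ : G ⧸ H} (hb₀ : b₀ ∈ img H T) :
    ∃ M : G ⧸ H → G ⧸ H, Set.InjOn M ((img H T).erase b₀) ∧
      ∀ b ∈ (img H T).erase b₀, M b ∈ (img H S + {b}) \ (img H S + {b₀}) := by
  suffices hf : ∃ M : {b // b ∈ (img H T).erase b₀} → G ⧸ H, Function.Injective M ∧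
      ∀ b, M b ∈ (img H S + {b.1}) \ (img H S + {b₀}) by
    obtain ⟨f, hfi, hf⟩ := hf
    refine ⟨fun b => if h : b ∈ (img H T).erase b₀ then f ⟨b, h⟩ else 0, ?_, ?_⟩
    · intro b hb b' hb' h
      simp only [dif_pos (Finset.mem_coe.1 hb), dif_pos (Finset.mem_coe.1 hb')] at h
      exact (Subtype.mk.injEq _ _ _ _).mp (hfi h)
    · intro b hb
      have h := hf ⟨b, hb⟩
      simp only [dif_pos hb]
      exact h
  refine (Finset.all_card_le_biUnion_card_iff_exists_injective
    fun b : {b // b ∈ (img H T).erase b₀} =>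
      (img H S + {b.1}) \ (img H S + {b₀})).1 fun X => ?_
  set X' : Finset (G ⧸ H) := X.map (Function.Embedding.subtype _) with hX'
  have hX'c : X'.card = X.card := Finset.card_map _
  have hX'm : ∀ x ∈ X', x ∈ (img H T).erase b₀ := by
    intro x hx
    obtain ⟨y, hy, rfl⟩ := Finset.mem_map.1 hx
    exact y.2
  have hsub : (img H S + insert b₀ X') \ (img H S + {b₀}) ⊆
      X.biUnion fun b => (img H S + {b.1}) \ (img H S + {b₀}) := by
    intro c hc
    obtain ⟨hc, hc'⟩ := Finset.mem_sdiff.1 hc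
    obtain ⟨a, ha, b, hb, rfl⟩ := Finset.mem_add.1 hc
    rcases Finset.mem_insert.1 hb with rfl | hb
    · exact absurd (Finset.add_mem_add ha (Finset.mem_singleton_self _)) hc'
    · obtain ⟨y, hy, rfl⟩ := Finset.mem_map.1 hb
      exact Finset.mem_biUnion.2 ⟨y, hy, Finset.mem_sdiff.2
        ⟨Finset.add_mem_add ha (Finset.mem_singleton_self _), hc'⟩⟩
  refine le_trans ?_ (Finset.card_le_card hsub)
  have h1 : (img H S + {b₀}).card = (img H S).card := Finset.card_add_singleton _ _
  have h2 := Finset.card_sdiff_add_card_eq_card (s := img H S + {b₀})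
    (t := img H S + insert b₀ X') (Finset.add_subset_add_left (by simp))
  have h3 : (insert b₀ X').card = X'.card + 1 := Finset.card_insert_of_notMem fun h =>
    (Finset.mem_erase.1 (hX'm _ h)).1 rfl
  have h4 : (insert b₀ X') ⊆ img H T := Finset.insert_subset hb₀ fun x hx =>
    (Finset.mem_erase.1 (hX'm _ hx)).2
  have h5 := Finset.card_le_card h4
  by_cases hp : ∃ p, p ∉ img H S + insert b₀ X'
  · have := C.card_img_add (by simp) hp
    omega
  · push Not at hp
    have : (img H S + img H T).card ≤ (img H S + insert b₀ X').card :=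
      Finset.card_le_card fun c _ => hp c
    omega

/-- If `φ(S + T)` is large, then the fibres of `S + T` are as small as they can be. -/
theorem matching_eq (C : Config S T H μ)
    (hw : (img H S).card + (img H T).card ≤ (img H S + img H T).card)
    {b₀ : G ⧸ H} (hb₀ : b₀ ∈ img H T)
    (hmin : ∀ b ∈ img H T, (fib H T b₀).card ≤ (fib H T b).card) :
    μ = 0 ∧ (img H S + img H T).card = (img H S).card + (img H T).card ∧
    (∀ a ∈ img H S, (fib H (S + T) (a + b₀)).card = (fib H S a).card) ∧
    ∃ c₀ ∈ img H S + img H T, c₀ ∉ img H S + {b₀} ∧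
      (fib H (S + T) c₀).card = (fib H T b₀).card ∧
      ∀ b ∈ img H T, b ≠ b₀ → ∃ a ∈ img H S, a + b ≠ c₀ ∧
        (fib H (S + T) (a + b)).card = (fib H T b).card := by
  obtain ⟨M, hMi, hM⟩ := C.exists_matching hw hb₀
  set A := img H S with hA
  set B := img H T with hB
  set x : G ⧸ H → ℕ := fun c => (fib H (S + T) c).card with hx
  have hA0 : (A + {b₀}).card = A.card := Finset.card_add_singleton _ _
  have hsub0 : A + {b₀} ⊆ A + B := Finset.add_subset_add_left (by simpa using hb₀)
  set I : Finset (G ⧸ H) := (B.erase b₀).image M with hI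
  have hIc : I.card + 1 = B.card := by
    rw [hI, Finset.card_image_of_injOn hMi]
    exact Finset.card_erase_add_one hb₀
  have hIsub : I ⊆ (A + B) \ (A + {b₀}) := by
    intro c hc
    obtain ⟨b, hb, rfl⟩ := Finset.mem_image.1 hc
    have h1 := Finset.mem_sdiff.1 (hM b hb)
    refine Finset.mem_sdiff.2 ⟨Finset.add_subset_add_left ?_ h1.1, h1.2⟩
    exact Finset.singleton_subset_iff.2 (Finset.mem_erase.1 hb).2
  have hK := Finset.card_sdiff_add_card_eq_card hsub0
  have hR := Finset.card_sdiff_add_card_eq_card hIsub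
  set R := ((A + B) \ (A + {b₀})) \ I with hRdef
  have hRpos : 0 < R.card := by omega
  obtain ⟨c₀, hc₀⟩ := Finset.card_pos.1 hRpos
  have hmin' : ∀ c ∈ A + B, (fib H T b₀).card ≤ x c := by
    intro c hc
    obtain ⟨a, ha, b, hb, rfl⟩ := Finset.mem_add.1 hc
    exact (hmin b hb).trans (card_fib_add_ge_right ha)
  -- The fibres over A + b₀ account for |S|, those over the matched cosets I for T outside b₀, and
  -- each leftover coset in R for at least the smallest fibre of T. Since |S + T| ≤ |S| + |T|, all
  -- estimates are equalities and R has one element.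
  have hxs : ∑ c ∈ A + {b₀}, x c + (∑ c ∈ I, x c + ∑ c ∈ R, x c) = (S + T).card := by
    rw [card_eq_sum_fib (H := H) (S + T), img_add, ← hA, ← hB,
      ← Finset.sum_sdiff hsub0, ← Finset.sum_sdiff hIsub]
    ring
  have h1 : ∑ c ∈ A + {b₀}, x c = ∑ a ∈ A, x (a + b₀) := by
    have h0 : A + {b₀} = A.image fun a => a + b₀ := by
      ext; simp only [Finset.mem_add, Finset.mem_singleton, exists_eq_left, Finset.mem_image]
    rw [h0, Finset.sum_image]
    intro a _ a' _ h
    exact add_right_cancel h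
  have h1' : S.card ≤ ∑ a ∈ A, x (a + b₀) := by
    rw [card_eq_sum_fib (H := H) S]
    exact Finset.sum_le_sum fun a _ => card_fib_add_ge_left hb₀
  have h2 : ∑ c ∈ I, x c = ∑ b ∈ B.erase b₀, x (M b) := by
    rw [hI, Finset.sum_image hMi]
  have hT : T.card = ∑ b ∈ B.erase b₀, (fib H T b).card + (fib H T b₀).card := by
    rw [card_eq_sum_fib (H := H) T, ← Finset.sum_erase_add _ _ hb₀]
  have hMx : ∀ b ∈ B.erase b₀, (fib H T b).card ≤ x (M b) := by
    intro b hb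
    have h3 := (Finset.mem_sdiff.1 (hM b hb)).1
    obtain ⟨a, ha, b', hb', h4⟩ := Finset.mem_add.1 h3
    rw [Finset.mem_singleton] at hb'
    rw [← h4, hb']
    exact card_fib_add_ge_right ha
  have h2' : ∑ b ∈ B.erase b₀, (fib H T b).card ≤ ∑ b ∈ B.erase b₀, x (M b) :=
    Finset.sum_le_sum hMx
  have hRx : R.card * (fib H T b₀).card ≤ ∑ c ∈ R, x c := by
    rw [← smul_eq_mul]
    exact Finset.card_nsmul_le_sum _ _ _ fun c hc =>
      hmin' c (Finset.mem_sdiff.1 (Finset.mem_sdiff.1 hc).1).1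
  have htpos : 0 < (fib H T b₀).card := card_fib_pos.2 hb₀
  have hsum := C.card_add
  have hR1 : (fib H T b₀).card ≤ R.card * (fib H T b₀).card := Nat.le_mul_of_pos_left _ hRpos
  have hRc : R.card = 1 := by
    by_contra hne
    have : 2 * (fib H T b₀).card ≤ R.card * (fib H T b₀).card :=
      Nat.mul_le_mul_right _ (by omega)
    omega
  obtain ⟨c₁, hc₁⟩ := Finset.card_eq_one.1 hRc
  rw [hc₁, Finset.mem_singleton] at hc₀
  subst hc₀
  rw [hRc, hc₁, Finset.sum_singleton] at hRx
  rw [h1, h2, hc₁, Finset.sum_singleton] at hxs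
  have hc₀R : c₀ ∈ R := by rw [hc₁]; simp
  have hc₀' := Finset.mem_sdiff.1 hc₀R
  have hc₀'' := Finset.mem_sdiff.1 hc₀'.1
  refine ⟨by omega, by omega, ?_, c₀, hc₀''.1, hc₀''.2, by simp only [hx] at *; omega, ?_⟩
  · have h5 : ∑ a ∈ A, (fib H S a).card = ∑ a ∈ A, x (a + b₀) := by
      rw [← card_eq_sum_fib]; omega
    intro a ha
    exact ((Finset.sum_eq_sum_iff_of_le fun a _ => card_fib_add_ge_left hb₀).1 h5 a ha).symm
  · intro b hb hbne
    have h5 : ∑ b ∈ B.erase b₀, (fib H T b).card = ∑ b ∈ B.erase b₀, x (M b) := by omega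
    have h6 := (Finset.sum_eq_sum_iff_of_le hMx).1 h5 b (Finset.mem_erase.2 ⟨hbne, hb⟩)
    have h7 := (Finset.mem_sdiff.1 (hM b (Finset.mem_erase.2 ⟨hbne, hb⟩))).1
    obtain ⟨a, ha, b', hb', h8⟩ := Finset.mem_add.1 h7
    rw [Finset.mem_singleton] at hb'
    subst hb'
    refine ⟨a, ha, ?_, ?_⟩
    · rw [h8]
      rintro rfl
      exact hc₀'.2 (Finset.mem_image_of_mem _ (Finset.mem_erase.2 ⟨hbne, hb⟩))
    · rw [h8]; exact h6.symm

end Config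

end SmallSum

/-! ### The image of S + T is small -/

namespace SmallSum

/-- Both translates P + τ and P + τ' fill X, so they coincide. -/
theorem add_sub_mem_of_card_le {G : Type*} [AddCommGroup G] [DecidableEq G] {P X : Finset G}
    {τ τ' : G} (h : ∀ σ ∈ P, σ + τ ∈ X) (h' : ∀ σ ∈ P, σ + τ' ∈ X) (hc : X.card ≤ P.card) :
    ∀ σ ∈ P, σ + (τ - τ') ∈ P := by
  have h1 : P.image (fun σ => σ + τ') = X := by
    refine Finset.eq_of_subset_of_card_le ?_ ?_
    · intro x hx
      obtain ⟨σ, hσ, rfl⟩ := Finset.mem_image.1 hx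
      exact h' σ hσ
    · rwa [Finset.card_image_of_injective _ (add_left_injective τ')]
  intro σ hσ
  have h2 := h σ hσ
  rw [← h1] at h2
  obtain ⟨σ', hσ', h3⟩ := Finset.mem_image.1 h2
  have : σ + (τ - τ') = σ' := by rw [← add_sub_assoc, ← h3, add_sub_cancel_right]
  rwa [this]

namespace Config

variable {G : Type*} [AddCommGroup G] [DecidableEq G]
  {S T : Finset G} {H : AddSubgroup G} [DecidableEq (G ⧸ H)] {μ : ℕ}

/-- Otherwise the equalities of `matching_eq`, used at two smallest fibres of T, give two fibres of
S of the same size m. This forces h = 2m and fibres of S and T that are half or full. Counting the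
full cosets in S + T then gives a contradiction, or a period when all fibres are half. -/
theorem card_img_add_lt (C : Config S T H μ) :
    (img H S + img H T).card < (img H S).card + (img H T).card := by
  by_contra hlt
  have hw : (img H S).card + (img H T).card ≤ (img H S + img H T).card := by omega
  have hfin := C.data.finite
  have hBne : (img H T).Nonempty := by
    obtain ⟨t, ht⟩ := C.nonempty_right
    exact ⟨_, mem_img.2 ⟨t, ht, rfl⟩⟩
  obtain ⟨b₁, hb₁, hmin⟩ := Finset.exists_min_image _ (fun b => (fib H T b).card) hBne
  obtain ⟨hμ, hwe, hx1, c₀, hc₀, hc₀', hxc, hmatch⟩ := C.matching_eq hw hb₁ hmin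
  obtain ⟨a₀, ha₀, b₀, hb₀, rfl⟩ := Finset.mem_add.1 hc₀
  obtain ⟨m, hm⟩ : ∃ m, (fib H T b₁).card = m := ⟨_, rfl⟩
  rw [hm] at hxc
  simp only [hm] at hmin
  have hb₀m : (fib H T b₀).card = m := le_antisymm
    (hxc ▸ card_fib_add_ge_right ha₀) (hmin b₀ hb₀)
  have hne : b₀ ≠ b₁ := by
    rintro rfl
    exact hc₀' (Finset.add_mem_add ha₀ (Finset.mem_singleton_self _))
  obtain ⟨-, -, hx0, -⟩ := C.matching_eq hw hb₀ (by rw [hb₀m]; exact hmin)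
  obtain ⟨a, ha, hac, hxa⟩ := hmatch b₀ hb₀ hne
  have hane : a ≠ a₀ := fun h => hac (by rw [h])
  have hsa₀ : (fib H S a₀).card = m := by rw [← hx0 a₀ ha₀, hxc]
  have hsa : (fib H S a).card = m := by rw [← hx0 a ha, hxa, hb₀m]
  have h2m := C.card_fib_add_card_fib ha ha₀ hane
  rw [hsa, hsa₀, hμ] at h2m
  have hmh : m < Nat.card H := by
    by_contra hge
    exact C.not_forall_full fun c hc => (not_lt.1 hge).trans (hmin c hc)
  have h2m' : m + m ≤ Nat.card H := by
    by_contra hgt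
    have := card_fib_add_eq (X := S) (Y := T) (a := a₀) (b := b₀) (by omega)
    omega
  -- The two half fibres use up the whole admissible defect of S, so the other fibres of S are full.
  have hh : Nat.card H = 2 * m := by omega
  have hmpos : 0 < m := by have := C.data.two_le; omega
  have hSge := C.card_left_ge
  have hSle := card_sum_fib_le (H := H) (X := S) (P := {a, a₀})
    (Finset.insert_subset ha (Finset.singleton_subset_iff.2 ha₀))
  rw [Finset.sum_pair hane, Finset.card_pair hane, hsa, hsa₀] at hSle
  have hsfull : ∀ a' ∈ img H S, a' ≠ a → a' ≠ a₀ → Nat.card H ≤ (fib H S a').card := by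
    intro a' ha' h1 h2
    have h3 := card_sum_fib_le (H := H) (X := S) (P := {a', a, a₀})
      (Finset.insert_subset ha' (Finset.insert_subset ha (Finset.singleton_subset_iff.2 ha₀)))
    rw [Finset.sum_insert (by simp [h1, h2]), Finset.card_insert_of_notMem (by simp [h1, h2]),
      Finset.sum_pair hane, Finset.card_pair hane, hsa, hsa₀] at h3
    omega
  have hsge : ∀ a' ∈ img H S, m ≤ (fib H S a').card := by
    intro a' ha'
    by_cases h1 : a' = a
    · rw [h1, hsa]
    by_cases h2 : a' = a₀
    · rw [h2, hsa₀]
    have := hsfull a' ha' h1 h2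
    omega
  have ht : ∀ b ∈ img H T, (fib H T b).card = m + if Nat.card H ≤ (fib H T b).card then m else 0 := by
    intro b hb
    have hle := card_fib_le (H := H) T b
    have hge := hmin b hb
    split_ifs with hfull
    · omega
    by_cases hbb : b = b₁
    · rw [hbb, hm]; rfl
    obtain ⟨a', ha', -, hxx⟩ := hmatch b hb hbb
    have h1 := hsge a' ha'
    by_contra hne
    have := card_fib_add_eq (X := S) (Y := T) (a := a') (b := b) (by omega)
    omega
  set Bf := (img H T).filter fun b => Nat.card H ≤ (fib H T b).card with hBf
  set Xf := (img H S + img H T).filter fun c => Nat.card H ≤ (fib H (S + T) c).card with hXf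
  have hTsum : T.card = (img H T).card * m + Bf.card * m := by
    rw [card_eq_sum_fib (H := H) T, Finset.sum_congr rfl ht, Finset.sum_add_distrib,
      Finset.sum_const, smul_eq_mul, ← Finset.sum_filter, Finset.sum_const, smul_eq_mul]
  have hxge : ∀ c ∈ img H S + img H T, m ≤ (fib H (S + T) c).card := by
    intro c hc
    obtain ⟨a', ha', b, hb, rfl⟩ := Finset.mem_add.1 hc
    exact (hmin b hb).trans (card_fib_add_ge_right ha')
  have hXsum : (img H S + img H T).card * m + Xf.card * m ≤ (S + T).card := by
    rw [card_eq_sum_fib (H := H) (S + T), img_add, ← smul_eq_mul, ← smul_eq_mul,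
      ← Finset.sum_const, ← Finset.sum_const, hXf, Finset.sum_filter, ← Finset.sum_add_distrib]
    refine Finset.sum_le_sum fun c hc => ?_
    have := hxge c hc
    split_ifs <;> omega
  have hadd := C.card_add
  have hle := C.card_le
  obtain ⟨u, hu⟩ : ∃ u, (img H S).card = u + 2 :=
    ⟨(img H S).card - 2, by have := C.data.two_le_img; omega⟩
  have hS : S.card = (2 * u + 2) * m := by
    rw [hu, hh, hμ] at hSge
    rw [hu, hh] at hSle
    nlinarith
  -- From here on u is |A| - 2. Every fibre of S + T has at least m elements and full ones have m
  -- more, so the cardinality of S + T limits the number of full ones.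
  have hXf_le : Xf.card ≤ u + Bf.card := by
    rw [hwe, hu] at hXsum
    by_contra hgt
    have : (u + Bf.card + 1) * m ≤ Xf.card * m := Nat.mul_le_mul_right _ (by omega)
    nlinarith
  have hXf_ge : ∀ P ⊆ img H S + img H T, (∀ c ∈ P, Nat.card H ≤ (fib H (S + T) c).card) →
      P.card ≤ Xf.card := fun P hP hf =>
    Finset.card_le_card fun c hc => Finset.mem_filter.2 ⟨hP hc, hf c hc⟩
  have hBf_le : Bf.card ≤ (img H T).card := Finset.card_filter_le _ _
  rcases Bf.eq_empty_or_nonempty with hBf0 | hBf0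
  · have hBf0' : Bf.card = 0 := by rw [hBf0]; rfl
    have hv : 2 * u + 2 ≤ (img H T).card := by
      refine Nat.le_of_mul_le_mul_right (c := m) ?_ hmpos
      rw [hBf0'] at hTsum
      omega
    rcases Nat.eq_zero_or_pos u with rfl | hu0
    · have hA : img H S = {a, a₀} := (Finset.eq_of_subset_of_card_le
        (Finset.insert_subset ha (Finset.singleton_subset_iff.2 ha₀))
        (by rw [hu, Finset.card_pair hane])).symm
      have hsm : ∀ a' ∈ img H S, (fib H S a').card = m := by
        intro a' ha'
        rw [hA, Finset.mem_insert, Finset.mem_singleton] at ha'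
        rcases ha' with rfl | rfl <;> assumption
      have hxm : ∀ c ∈ img H S + img H T, m = (fib H (S + T) c).card := by
        have h1 : ∑ c ∈ img H S + img H T, (fib H (S + T) c).card = (S + T).card := by
          rw [card_eq_sum_fib (H := H) (S + T), img_add]
        have h2 : (img H S + img H T).card * m = (S + T).card := by
          rw [hBf0', zero_mul, add_zero] at hTsum
          rw [hwe, hu, add_mul, ← hTsum]
          omega
        refine (Finset.sum_eq_sum_iff_of_le hxge).1 ?_
        rw [h1, Finset.sum_const, smul_eq_mul, h2]
      -- Here |S| = 2m ≥ 3, so m ≥ 2 and the fibre of T over b₁ has two elements; their difference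
      -- is a period of S, hence of S + T.
      have hcl := C.card_left
      obtain ⟨τ, hτ, τ', hτ', hττ⟩ := Finset.one_lt_card.1
        (show 1 < (fib H T b₁).card by rw [hm]; omega)
      refine hττ (sub_eq_zero.1 (C.aper.eq_zero (g := τ - τ') ?_))
      intro x hx
      obtain ⟨s, hs, t, ht, rfl⟩ := Finset.mem_add.1 hx
      have hsA : (s : G ⧸ H) ∈ img H S := mem_img.2 ⟨s, hs, rfl⟩
      have h1 := add_sub_mem_of_card_le (P := fib H S (s : G ⧸ H))
        (X := fib H (S + T) ((s : G ⧸ H) + b₁)) (τ := τ) (τ' := τ')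
        (fun σ hσ => fib_add_subset _ _ (Finset.add_mem_add hσ hτ))
        (fun σ hσ => fib_add_subset _ _ (Finset.add_mem_add hσ hτ'))
        (by rw [hsm _ hsA, ← hxm _ (Finset.add_mem_add hsA hb₁)]) s (mem_fib.2 ⟨hs, rfl⟩)
      exact Finset.mem_add.2 ⟨_, (mem_fib.1 h1).1, t, ht, by abel⟩
    · obtain ⟨a', ha'⟩ : ∃ a', a' ∈ img H S \ {a, a₀} := by
        refine Finset.card_pos.1 ?_
        have := Finset.le_card_sdiff {a, a₀} (img H S)
        rw [Finset.card_pair hane, hu] at this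
        omega
      obtain ⟨ha', hane'⟩ := Finset.mem_sdiff.1 ha'
      simp only [Finset.mem_insert, Finset.mem_singleton, not_or] at hane'
      have h1 := hXf_ge ({a'} + img H T)
        (Finset.add_subset_add_right (Finset.singleton_subset_iff.2 ha')) (by
          intro c hc
          obtain ⟨a'', ha'', b, hb, rfl⟩ := Finset.mem_add.1 hc
          rw [Finset.mem_singleton] at ha''
          subst ha''
          exact (hsfull _ ha' hane'.1 hane'.2).trans (card_fib_add_ge_left hb))
      rw [Finset.card_singleton_add] at h1
      omega
  -- Every coset in A + Bf is full, and Cauchy–Davenport makes A + Bf too large.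
  · have h1 := hXf_ge (img H S + Bf) (Finset.add_subset_add_left (Finset.filter_subset _ _)) (by
      intro c hc
      obtain ⟨a', ha', b, hb, rfl⟩ := Finset.mem_add.1 hc
      exact (Finset.mem_filter.1 hb).2.trans (card_fib_add_ge_right ha'))
    by_cases hp : ∃ p, p ∉ img H S + Bf
    · have := C.card_img_add hBf0 hp
      omega
    · push Not at hp
      have : (img H S + img H T).card ≤ (img H S + Bf).card :=
        Finset.card_le_card fun c _ => hp c
      omega

end Config

end SmallSum

/-! ### Defects of fibres -/

namespace SmallSum

theorem sum_le_of_excess {ι : Type*} (P : Finset ι) (f : ι → ℕ) {z m k : ℕ}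
    (hf : ∀ i ∈ P, f i ≤ z + m) (hk : (P.filter fun i => z < f i).card ≤ k) :
    ∑ i ∈ P, f i ≤ P.card * z + k * m := by
  have h1 : ∑ i ∈ P, f i ≤ ∑ i ∈ P, (z + if z < f i then m else 0) := by
    refine Finset.sum_le_sum fun i hi => ?_
    have := hf i hi
    split_ifs <;> omega
  refine h1.trans ?_
  rw [Finset.sum_add_distrib, Finset.sum_const, smul_eq_mul, ← Finset.sum_filter,
    Finset.sum_const, smul_eq_mul]
  exact Nat.add_le_add_left (Nat.mul_le_mul_right _ hk) _

variable {G : Type*} [AddCommGroup G] [DecidableEq G]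

/-- The number of elements of the coset `c` of `H` missing from `X`. -/
noncomputable def defect (H : AddSubgroup G) [DecidableEq (G ⧸ H)] (X : Finset G)
    (c : G ⧸ H) : ℕ := Nat.card H - (fib H X c).card

theorem fib_add_defect {H : AddSubgroup G} [DecidableEq (G ⧸ H)] [Finite H] (X : Finset G)
    (c : G ⧸ H) : (fib H X c).card + defect H X c = Nat.card H := by
  have := card_fib_le (H := H) X c
  unfold defect
  omega

theorem sum_defect_univ {H : AddSubgroup G} [DecidableEq (G ⧸ H)] [Finite H] [Fintype (G ⧸ H)]
    (X : Finset G) : ∑ c, defect H X c + X.card = Nat.card (G ⧸ H) * Nat.card H := by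
  rw [card_eq_sum_fib_univ (H := H) X, ← Finset.sum_add_distrib,
    Finset.sum_congr rfl fun c _ => (add_comm _ _).trans (fib_add_defect X c), Finset.sum_const,
    smul_eq_mul, Finset.card_univ, Nat.card_eq_fintype_card (α := G ⧸ H)]

/-- The cosets of `H` contained in `X`. -/
noncomputable def full (H : AddSubgroup G) [DecidableEq (G ⧸ H)] (X : Finset G) :
    Finset (G ⧸ H) := (img H X).filter fun c => Nat.card H ≤ (fib H X c).card

theorem mem_full {H : AddSubgroup G} [DecidableEq (G ⧸ H)] [Finite H] {X : Finset G}
    {c : G ⧸ H} : c ∈ full H X ↔ Nat.card H ≤ (fib H X c).card := by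
  rw [full, Finset.mem_filter, and_iff_right_iff_imp]
  intro h
  exact card_fib_pos.1 (Nat.card_pos.trans_le h)

namespace Config

variable {S T : Finset G} {H : AddSubgroup G} [DecidableEq (G ⧸ H)] {μ : ℕ}

/-- z is the least defect of a fibre of S and m the excess of the total defect over uz. One fibre
can absorb at most all of m, and so can two together. -/
theorem exists_min_defect (C : Config S T H μ) : ∃ z m, ∃ a₀ ∈ img H S, defect H S a₀ = z ∧
    (∀ a ∈ img H S, defect H S a ≤ z + m) ∧
    (∀ a ∈ img H S, ∀ a' ∈ img H S, a ≠ a' → defect H S a + defect H S a' ≤ 2 * z + m) ∧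
    (∀ a ∈ img H S, z ≤ defect H S a) ∧
    (img H S).card * z + m + S.card = (img H S).card * Nat.card H ∧
    (img H S).card * z + m + μ ≤ Nat.card H := by
  have hfin := C.data.finite
  obtain ⟨a₀, ha₀, hmin⟩ := Finset.exists_min_image (img H S) (defect H S)
    (Finset.card_pos.1 (by have := C.data.two_le_img; omega))
  have hsum : ∑ a ∈ img H S, defect H S a + S.card = (img H S).card * Nat.card H := by
    rw [card_eq_sum_fib (H := H) S, ← Finset.sum_add_distrib,
      Finset.sum_congr rfl fun c _ => (add_comm _ _).trans (fib_add_defect S c), Finset.sum_const,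
      smul_eq_mul]
  have hP : ∀ P ⊆ img H S, ∑ a ∈ P, defect H S a + (img H S).card * defect H S a₀ ≤
      ∑ a ∈ img H S, defect H S a + P.card * defect H S a₀ := by
    intro P hP
    have h1 := Finset.sum_sdiff hP (f := defect H S)
    have h2 : (img H S \ P).card * defect H S a₀ ≤ ∑ a ∈ img H S \ P, defect H S a := by
      rw [← smul_eq_mul]
      exact Finset.card_nsmul_le_sum _ _ _ fun a ha => hmin a (Finset.mem_sdiff.1 ha).1
    rw [← Finset.card_sdiff_add_card_eq_card hP, add_mul]
    omega
  have h0 := hP ∅ (Finset.empty_subset _)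
  simp only [Finset.sum_empty, Finset.card_empty, zero_mul] at h0
  have hge := C.card_left_ge
  refine ⟨defect H S a₀, ∑ a ∈ img H S, defect H S a - (img H S).card * defect H S a₀, a₀, ha₀,
    rfl, ?_, ?_, hmin, by omega, by omega⟩
  · intro a ha
    have := hP {a} (Finset.singleton_subset_iff.2 ha)
    rw [Finset.sum_singleton, Finset.card_singleton] at this
    omega
  · intro a ha a' ha' hne
    have := hP {a, a'} (Finset.insert_subset ha (Finset.singleton_subset_iff.2 ha'))
    rw [Finset.sum_pair hne, Finset.card_pair hne] at this
    omega

/-- If the fibre of T over b exceeds the defect of S at a, pigeonhole fills the coset a + b. -/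
theorem card_filter_right (C : Config S T H μ) {a : G ⧸ H} (ha : a ∈ img H S) :
    ((img H T).filter fun b => defect H S a < (fib H T b).card).card ≤ (full H (S + T)).card := by
  have hfin := C.data.finite
  rw [← Finset.card_singleton_add a]
  refine Finset.card_le_card fun c hc => ?_
  obtain ⟨a', ha', b, hb, rfl⟩ := Finset.mem_add.1 hc
  rw [Finset.mem_singleton] at ha'
  subst ha'
  have h1 := (Finset.mem_filter.1 hb).2
  have h2 := fib_add_defect (H := H) S a'
  rw [mem_full, card_fib_add_eq (by omega)]

/-- Over a + B the defect of S + T is at most that of S at a, so the exceptional cosets lie outside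
a + B. -/
theorem card_filter_add [Fintype (G ⧸ H)] (C : Config S T H μ) {a : G ⧸ H} (ha : a ∈ img H S) :
    (Finset.univ.filter fun c => defect H S a < defect H (S + T) c).card + (img H T).card ≤
      Nat.card (G ⧸ H) := by
  have hfin := C.data.finite
  rw [← Finset.card_singleton_add a (img H T), Nat.card_eq_fintype_card, ← Finset.card_univ,
    ← Finset.card_union_of_disjoint]
  · exact Finset.card_le_card (Finset.subset_univ _)
  · rw [Finset.disjoint_left]
    intro c hc hc'
    obtain ⟨a', ha', b, hb, rfl⟩ := Finset.mem_add.1 hc'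
    rw [Finset.mem_singleton] at ha'
    subst ha'
    have h1 := (Finset.mem_filter.1 hc).2
    have h2 := fib_add_defect (H := H) S a'
    have h3 := fib_add_defect (H := H) (S + T) (a' + b)
    have h4 := card_fib_add_ge_left (X := S) (a := a') hb
    omega

/-- If b had no such a, all u cosets of A + b would be full in S + T. -/
theorem exists_le_defect (C : Config S T H μ) (hf : (full H (S + T)).card < (img H S).card)
    (b : G ⧸ H) : ∃ a ∈ img H S, (fib H T b).card ≤ defect H S a := by
  have hfin := C.data.finite
  by_contra hcon
  push Not at hcon
  have h1 : (img H S + {b}).card ≤ (full H (S + T)).card := by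
    refine Finset.card_le_card fun c hc => ?_
    obtain ⟨a, ha, b', hb', rfl⟩ := Finset.mem_add.1 hc
    rw [Finset.mem_singleton] at hb'
    subst hb'
    have h1 := hcon a ha
    have h2 := fib_add_defect (H := H) S a
    rw [mem_full, card_fib_add_eq (by omega)]
  rw [Finset.card_add_singleton] at h1
  omega

theorem defect_add_le (C : Config S T H μ) {a c : G ⧸ H} (hb : c - a ∈ img H T) :
    defect H (S + T) c ≤ defect H S a := by
  have hfin := C.data.finite
  have h2 := fib_add_defect (H := H) S a
  have h3 := fib_add_defect (H := H) (S + T) c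
  have h4 := card_fib_add_ge_left (X := S) (a := a) hb
  rw [add_sub_cancel] at h4
  omega

theorem defect_lt {X : Finset G} [Finite H] {a : G ⧸ H} (ha : a ∈ img H X) :
    defect H X a + 1 ≤ Nat.card H := by
  have := card_fib_pos.2 ha
  have := fib_add_defect (H := H) X a
  omega

theorem exists_sub_mem [Fintype (G ⧸ H)]
    (hq : Nat.card (G ⧸ H) < (img H S).card + (img H T).card) (c : G ⧸ H) :
    ∃ a ∈ img H S, c - a ∈ img H T := by
  by_contra hcon
  push Not at hcon
  have h1 : Disjoint (img H S) (c +ᵥ (-img H T)) := by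
    rw [Finset.disjoint_left]
    intro a ha ha'
    rw [mem_vadd_iff, Finset.mem_neg', neg_sub] at ha'
    exact hcon a ha ha'
  have h2 := Finset.card_le_univ (img H S ∪ (c +ᵥ (-img H T)))
  rw [Finset.card_union_of_disjoint h1, Finset.card_vadd_finset, Finset.card_neg,
    ← Nat.card_eq_fintype_card] at h2
  omega

theorem finite_group (C : Config S T H μ) [Finite (G ⧸ H)] : Finite G := by
  have := C.data.finite
  refine Nat.finite_of_card_ne_zero ?_
  rw [card_group H]
  exact (Nat.mul_pos Nat.card_pos Nat.card_pos).ne'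

theorem three_mul_sum_defect [Fintype (G ⧸ H)] (C : Config S T H μ) :
    Nat.card (G ⧸ H) * Nat.card H ≤ 3 * ∑ c, defect H (S + T) c + 2 * μ := by
  have := C.data.finite
  have h1 := C.size C.finite_group
  rw [card_group H] at h1
  have h2 := sum_defect_univ (H := H) (S + T)
  omega

/-- Since |T| ≥ |S| ≥ (u-1)h + μ, the size bound yields 3(u-1) ≤ q. -/
theorem three_mul_le [Finite (G ⧸ H)] (C : Config S T H μ) :
    3 * (img H S).card ≤ Nat.card (G ⧸ H) + 3 := by
  have h1 := C.size C.finite_group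
  rw [card_group H] at h1
  have h2 := C.card_add
  have h3 := C.card_le
  have h4 := C.card_left_ge
  have h5 := C.mu_le
  have h6 := C.data.two_le
  by_contra hlt
  have h7 : (Nat.card (G ⧸ H) + 4) * Nat.card H ≤ (3 * (img H S).card) * Nat.card H :=
    Nat.mul_le_mul_right _ (by omega)
  nlinarith

theorem sum_defect_eq [Fintype (G ⧸ H)] [Finite H] (X : Finset G) :
    ∑ c ∈ Finset.univ \ full H X, defect H X c = ∑ c, defect H X c := by
  rw [← Finset.sum_sdiff (Finset.subset_univ (full H X))]
  refine (add_eq_left.2 (Finset.sum_eq_zero fun c hc => ?_)).symm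
  rw [mem_full] at hc
  have := fib_add_defect (H := H) X c
  omega

theorem card_compl_full [Fintype (G ⧸ H)] (X : Finset G) :
    (Finset.univ \ full H X).card + (full H X).card = Nat.card (G ⧸ H) := by
  rw [Finset.card_sdiff_add_card_eq_card (Finset.subset_univ _), Finset.card_univ,
    Nat.card_eq_fintype_card]

/-- If two fibres of `S` are as large as all fibres of `S + T`, then `S + T` is periodic. -/
theorem false_of_fib_le (C : Config S T H μ) (hB : ∀ b, b ∈ img H T) {a a' : G ⧸ H}
    (hne : a ≠ a') (h : ∀ c, (fib H (S + T) c).card ≤ (fib H S a).card)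
    (h' : ∀ c, (fib H (S + T) c).card ≤ (fib H S a').card) : False := by
  -- The fibre of S + T over a + τ is exactly a translate by τ of the fibre of S at a.
  have key : ∀ a : G ⧸ H, (∀ c, (fib H (S + T) c).card ≤ (fib H S a).card) →
      ∀ τ ∈ T, ∀ x ∈ S + T, (x : G ⧸ H) = a + (τ : G ⧸ H) → x - τ ∈ fib H S a := by
    intro a h τ hτ x hx hxa
    have h1 : (fib H S a).image (fun σ => σ + τ) = fib H (S + T) (a + τ) := by
      refine Finset.eq_of_subset_of_card_le ?_ ?_
      · intro x hx
        obtain ⟨σ, hσ, rfl⟩ := Finset.mem_image.1 hx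
        exact fib_add_subset _ _ (Finset.add_mem_add hσ (mem_fib.2 ⟨hτ, rfl⟩))
      · rw [Finset.card_image_of_injective _ (add_left_injective τ)]
        exact h _
    have h2 : x ∈ fib H (S + T) (a + τ) := mem_fib.2 ⟨hx, hxa⟩
    rw [← h1] at h2
    obtain ⟨σ, hσ, rfl⟩ := Finset.mem_image.1 h2
    simpa using hσ
  have hT : ∀ b : G ⧸ H, ∃ τ ∈ T, (τ : G ⧸ H) = b := fun b => mem_img.1 (hB b)
  obtain ⟨τ', hτ', -⟩ := hT 0
  obtain ⟨τ, hτ, hτb⟩ := hT (a' + τ' - a)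
  -- Writing x = σ + ρ with σ over a, the element σ + τ lies over a' + τ', hence is σ' + τ' with σ'
  -- over a'. So x + τ - τ' = σ' + ρ stays in S + T.
  have hg : τ - τ' = 0 := by
    refine C.aper.eq_zero fun x hx => ?_
    obtain ⟨ρ, hρ, hρb⟩ := hT (x - a)
    have h1 := key a h ρ hρ x hx (by rw [hρb]; abel)
    rw [mem_fib] at h1
    have h2 := key a' h' τ' hτ' (x - ρ + τ) (Finset.add_mem_add h1.1 hτ) (by
      rw [QuotientAddGroup.mk_add, h1.2, hτb]; abel)
    have h3 := Finset.add_mem_add (mem_fib.1 h2).1 hρ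
    have h4 : x - ρ + τ - τ' + ρ = τ - τ' + x := by abel
    rwa [h4] at h3
  rw [sub_eq_zero] at hg
  rw [hg] at hτb
  refine hne ?_
  have h5 : a = a' + (τ' : G ⧸ H) - (a' + (τ' : G ⧸ H) - a) := by abel
  rw [h5, ← hτb]
  abel

end Config

end SmallSum

/-! ### At least three cosets: counting defects -/

namespace SmallSum

/-- In these numerical lemmas f is the number of full cosets of S + T, n stands for q - v, and Y for
the total defect of S + T. After each inequality is replaced by a slack variable, a combination of
the hypotheses is a polynomial with nonnegative coefficients that is at most 0, so all its terms
vanish. This one serves u + v > q and f < u, and finds the only extremal case. -/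
theorem eq_three_of_card_bounds {u q f n z m h s T Y μ : ℕ} (hu : 3 ≤ u) (hq : 3 * u ≤ q + 3)
    (hf : f + 1 ≤ u) (hn : n + 1 ≤ u) (hz : 1 ≤ z) (h1 : u * z + m + s = u * h)
    (h2 : u * z + m + μ ≤ h) (h3 : T + n * z ≤ q * z + f * m)
    (h4 : Y + f * z ≤ q * z + n * m) (h5 : Y + s + T = q * h + μ) :
    n = 0 ∧ f = 0 ∧ m = 0 ∧ h = 3 * z ∧ u = 3 ∧ q = 6 := by
  obtain ⟨u, rfl⟩ := Nat.exists_eq_add_of_le' hu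
  obtain ⟨q, rfl⟩ : ∃ q', q = 3 * u + 6 + q' := ⟨q - (3 * u + 6), by omega⟩
  obtain ⟨z, rfl⟩ := Nat.exists_eq_add_of_le' hz
  obtain ⟨k, rfl⟩ := Nat.exists_eq_add_of_le h2
  obtain ⟨f', hf'⟩ : ∃ f', f + f' = u + 2 := ⟨u + 2 - f, by omega⟩
  obtain ⟨n', hn'⟩ : ∃ f', n + f' = u + 2 := ⟨u + 2 - n, by omega⟩
  have key : (z + 1) * (2 * u * u + 4 * u + q * (u + 1) + n + f) + m * (q + f' + n') +
      (2 * u + q + 4) * μ + (2 * u + q + 3) * k ≤ 0 := by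
    zify at *
    have e1 : (f' : ℤ) = u + 2 - f := by linarith
    have e2 : (n' : ℤ) = u + 2 - n := by linarith
    rw [e1, e2]
    nlinarith
  simp only [Nat.le_zero, Nat.add_eq_zero_iff, mul_eq_zero] at key
  have hu0 : u = 0 := by omega
  have hm0 : m = 0 := by omega
  have hk0 : k = 0 := by omega
  have hμ0 : μ = 0 := by omega
  subst hu0 hm0 hk0 hμ0
  omega

/-- For u + v > q and f ≥ u, where the size hypothesis enters through `h5`. -/
theorem eq_zero_of_card_bounds {u q n z m h Y μ : ℕ} (hu : 3 ≤ u) (hq : 3 * u ≤ q + 3)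
    (hn : n + 1 ≤ u) (h2 : u * z + m + μ ≤ h) (h4 : Y + u * z ≤ q * z + n * m)
    (h5 : q * h ≤ 3 * Y + 2 * μ) : z = 0 := by
  obtain ⟨u, rfl⟩ := Nat.exists_eq_add_of_le' hu
  obtain ⟨q, rfl⟩ : ∃ q', q = 3 * u + 6 + q' := ⟨q - (3 * u + 6), by omega⟩
  obtain ⟨k, rfl⟩ := Nat.exists_eq_add_of_le h2
  obtain ⟨n', hn'⟩ : ∃ f', n + f' = u + 2 := ⟨u + 2 - n, by omega⟩
  have key : z * ((3 * u + 6 + q) * u + 3 * (u + 3)) + m * (q + 3 * n') ≤ 0 := by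
    zify at *
    have e2 : (n' : ℤ) = u + 2 - n := by linarith
    rw [e2]
    nlinarith
  simp only [Nat.le_zero, Nat.add_eq_zero_iff, mul_eq_zero] at key
  omega

/-- For u + v = q with exactly one coset missed and f < u; the missed coset contributes h to Y. -/
theorem false_of_card_bounds {u q f z m h s T Y μ : ℕ} (hu : 3 ≤ u)
    (hq : 3 * u ≤ q + 3) (hf : f + 1 ≤ u) (hz : 1 ≤ z) (h1 : u * z + m + s = u * h)
    (h2 : u * z + m + μ ≤ h) (h3 : T + u * z ≤ q * z + f * m)
    (h4 : Y + f * z + z + m ≤ h + q * z + u * m) (h5 : Y + s + T = q * h + μ) (h6 : s ≤ T) :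
    False := by
  obtain ⟨u, rfl⟩ := Nat.exists_eq_add_of_le' hu
  obtain ⟨z, rfl⟩ := Nat.exists_eq_add_of_le' hz
  obtain ⟨k, rfl⟩ := Nat.exists_eq_add_of_le h2
  obtain ⟨f', hf'⟩ : ∃ f', f + f' = u + 2 := ⟨u + 2 - f, by omega⟩
  -- |S| ≤ |T| alone bounds the original u² by q; this feeds the final combination.
  have hq' : (u + 3) * (u + 3) ≤ q := by
    by_contra hlt
    obtain ⟨r, hr⟩ := Nat.exists_eq_add_of_lt (not_le.1 hlt)
    have key : (z + 1) * (r + 1) + m * f' + (u + 2) * (k + μ) ≤ 0 := by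
      zify at *
      have e1 : (f' : ℤ) = u + 2 - f := by linarith
      rw [e1]
      nlinarith
    simp at key
  obtain ⟨q, rfl⟩ := Nat.exists_eq_add_of_le hq'
  have key : (z + 1) * (u * u * u + 6 * u * u + 10 * u + 4 + q * (u + 1) + f) +
      m * (u * u + 4 * u + 1 + q + f') + (u * u + 5 * u + 5 + q) * (k + μ) ≤ 0 := by
    zify at *
    have e1 : (f' : ℤ) = u + 2 - f := by linarith
    rw [e1]
    nlinarith
  simp at key

/-- For one missed coset and f ≥ u, where two representations of every other coset give the bound 2z
+ m for twice its defect. -/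
theorem eq_of_card_bounds {u q z m h Y μ : ℕ} (hu : 3 ≤ u) (hq : 3 * u ≤ q + 3) (hh : 2 ≤ h)
    (h2 : u * z + m + μ ≤ h) (h4 : 2 * Y + 2 * (u * z) + 2 * z + m ≤ 2 * h + 2 * (q * z) + u * m)
    (h5 : q * h ≤ 3 * Y + 2 * μ) : u = 3 ∧ q = 6 := by
  obtain ⟨u, rfl⟩ := Nat.exists_eq_add_of_le' hu
  obtain ⟨q, rfl⟩ : ∃ q', q = 3 * u + 6 + q' := ⟨q - (3 * u + 6), by omega⟩
  obtain ⟨k, rfl⟩ := Nat.exists_eq_add_of_le h2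
  have key : z * ((6 * u + 12 + 2 * q) * u + 6) + m * (3 * u + 2 * q) + (6 * u + 2 + 2 * q) * μ +
      (6 * u + 6 + 2 * q) * k ≤ 0 := by
    zify at *
    nlinarith
  simp only [Nat.le_zero, Nat.add_eq_zero_iff, mul_eq_zero] at key
  obtain ⟨⟨⟨h6, h7⟩, h8⟩, h9⟩ := key
  have hz : z = 0 := by omega
  have hk : k = 0 := by omega
  have hμ : μ = 0 := by omega
  subst hz hk hμ
  omega

namespace Config

variable {G : Type*} [AddCommGroup G] [DecidableEq G]
  {S T : Finset G} {H : AddSubgroup G} [DecidableEq (G ⧸ H)] {μ : ℕ}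

theorem closure_img (C : Config S T H μ) :
    AddSubgroup.closure (img H S : Set (G ⧸ H)) = ⊤ := by
  have h1 : ((img H S : Finset (G ⧸ H)) : Set (G ⧸ H)) = QuotientAddGroup.mk' H '' (S : Set G) := by
    simp [img]
  rw [h1, ← AddMonoidHom.map_closure, C.data.closure_eq, ← AddMonoidHom.range_eq_map,
    AddMonoidHom.range_eq_top]
  exact QuotientAddGroup.mk'_surjective H

theorem exists_isProgression_img (C : Config S T H μ) {X : Finset (G ⧸ H)} (hX2 : 2 ≤ X.card)
    (hXo : TwoOut (img H S + X)) (hXle : (img H S + X).card + 1 ≤ X.card + (img H S).card) :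
    ∃ d, AddSubgroup.zmultiples d = ⊤ ∧ IsProgression d (img H S : Set (G ⧸ H)) := by
  rw [add_comm (img H S) X] at hXo hXle
  exact isProgression_of_fragment (mem_img.2 ⟨0, C.data.zero_mem, rfl⟩) C.closure_img
    C.data.two_le_img C.data.cauchyDavenport C.data.coset_expansion
    (fun hfin => C.three_mul_le) hX2 hXo hXle

theorem isProgression_img_right (C : Config S T H μ) {d : G ⧸ H}
    (hd : AddSubgroup.zmultiples d = ⊤) (hA : IsProgression d (img H S : Set (G ⧸ H)))
    (hp : ∃ p, p ∉ img H S + img H T) : IsProgression d (img H T : Set (G ⧸ H)) := by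
  obtain ⟨a, ha⟩ := exists_prog_of_isProgression hA
  have h1 := C.card_img_add_lt
  rw [add_comm (img H S) (img H T), ha] at hp
  refine isProgression_of_card_add_prog C.data.two_le_img hd ?_ hp ?_
  · obtain ⟨t, ht⟩ := C.nonempty_right
    exact ⟨_, mem_img.2 ⟨t, ht, rfl⟩⟩
  · rw [← ha, add_comm (img H T)]
    omega

/-- Every fibre of T is at most some defect of S, hence at most z + m, and at most f of them exceed
z. -/
theorem card_right_le (C : Config S T H μ) (hf : (full H (S + T)).card < (img H S).card)
    {z m : ℕ} {a₀ : G ⧸ H} (ha₀ : a₀ ∈ img H S) (hz : defect H S a₀ = z)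
    (hm : ∀ a ∈ img H S, defect H S a ≤ z + m) :
    T.card ≤ (img H T).card * z + (full H (S + T)).card * m := by
  rw [card_eq_sum_fib (H := H) T]
  refine sum_le_of_excess _ _ (fun b _ => ?_) (hz ▸ C.card_filter_right ha₀)
  obtain ⟨a, ha, h⟩ := C.exists_le_defect hf b
  exact h.trans (hm a ha)

/-- With z = 0, T would have at most f nonempty fibres, none full, so |T| ≤ (u-1)(h-1) < (u-1)h ≤
|S|. -/
theorem min_defect_pos (C : Config S T H μ) (hu : 3 ≤ (img H S).card)
    (hf : (full H (S + T)).card < (img H S).card)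
    {a₀ : G ⧸ H} (ha₀ : a₀ ∈ img H S) : 1 ≤ defect H S a₀ := by
  have hfin := C.data.finite
  by_contra hz
  have h1 := C.card_right_le hf (z := 0) (m := Nat.card H - 1) ha₀ (by omega) (by
    intro a ha
    have := defect_lt ha
    omega)
  rw [mul_zero, zero_add] at h1
  have h2 := C.card_left_ge
  have h3 := C.card_le
  have h4 := C.data.two_le
  obtain ⟨u, hu'⟩ : ∃ u, (img H S).card = u + 1 := ⟨(img H S).card - 1, by omega⟩
  have h5 : (full H (S + T)).card * (Nat.card H - 1) ≤ u * (Nat.card H - 1) :=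
    Nat.mul_le_mul_right _ (by omega)
  have h6 : u * (Nat.card H - 1) + u = u * Nat.card H := by
    rw [← Nat.mul_succ]; congr 1; omega
  rw [hu', add_mul] at h2
  omega

theorem card_img_right_ge (C : Config S T H μ) (hu : 3 ≤ (img H S).card) :
    2 ≤ (img H T).card := by
  have hfin := C.data.finite
  by_contra hlt
  have h1 := card_le_card_img_mul (H := H) T
  have h2 : (img H T).card * Nat.card H ≤ 1 * Nat.card H := Nat.mul_le_mul_right _ (by omega)
  have h3 : 3 * Nat.card H ≤ (img H S).card * Nat.card H := Nat.mul_le_mul_right _ hu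
  have h4 := C.card_left_ge
  have h5 := C.card_le
  have h6 := C.data.two_le
  omega

/-- If u + v > q, every coset is some a + b, so its defect in S + T is at most a defect of S, and at
most q - v < u cosets have defect above z. The total defect of S + T is then too small. -/
theorem card_add_le_card_quotient [Fintype (G ⧸ H)] (C : Config S T H μ)
    (hu : 3 ≤ (img H S).card) : (img H S).card + (img H T).card ≤ Nat.card (G ⧸ H) := by
  by_contra hlt
  have hfin := C.data.finite
  obtain ⟨z, m, a₀, ha₀, hz, hm, -, -, h1, h2⟩ := C.exists_min_defect
  have hv : (img H T).card ≤ Nat.card (G ⧸ H) := by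
    rw [Nat.card_eq_fintype_card]; exact Finset.card_le_univ _
  obtain ⟨n, hn⟩ := Nat.exists_eq_add_of_le hv
  have hy : ∀ c, ∃ a ∈ img H S, defect H (S + T) c ≤ defect H S a := fun c => by
    obtain ⟨a, ha, hb⟩ := exists_sub_mem (S := S) (T := T) (not_le.1 hlt) c
    exact ⟨a, ha, C.defect_add_le hb⟩
  have hcount := C.card_filter_add ha₀
  have hY : ∀ z' m', defect H S a₀ = z' → (∀ a ∈ img H S, defect H S a ≤ z' + m') →
      ∑ c, defect H (S + T) c ≤ (Finset.univ \ full H (S + T)).card * z' + n * m' := by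
    intro z' m' hz' hm'
    rw [← sum_defect_eq]
    refine sum_le_of_excess _ _ (fun c _ => ?_) ?_
    · obtain ⟨a, ha, h⟩ := hy c
      exact h.trans (hm' a ha)
    · rw [← hz']
      refine (Finset.card_le_card (Finset.filter_subset_filter _ (Finset.subset_univ _))).trans ?_
      omega
  have hYT := sum_defect_univ (H := H) (S + T)
  have hadd := C.card_add
  have hq := C.three_mul_le
  have hcf := card_compl_full (H := H) (S + T)
  have h4 := hY z m hz hm
  have hn' : n + 1 ≤ (img H S).card := by omega
  have h4' : ∑ c, defect H (S + T) c + (full H (S + T)).card * z ≤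
      Nat.card (G ⧸ H) * z + n * m := by
    rw [← hcf, add_mul]; omega
  rcases Nat.lt_or_ge (full H (S + T)).card (img H S).card with hf | hf
  · have hz1 := C.min_defect_pos hu hf ha₀
    have h3 := C.card_right_le hf ha₀ hz hm
    have h3' : T.card + n * z ≤ Nat.card (G ⧸ H) * z + (full H (S + T)).card * m := by
      rw [hn, add_mul]; omega
    -- In the extremal case all defects equal z, so no fibre of S + T is larger than one of S, and S
    -- + T is periodic.
    obtain ⟨e1, e2, e3, e4, e5, e6⟩ := eq_three_of_card_bounds hu hq hf hn' (hz ▸ hz1) h1 h2 h3' h4'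
      (by omega)
    have hBall : img H T = Finset.univ := by
      rw [← Finset.card_eq_iff_eq_univ, ← Nat.card_eq_fintype_card]; omega
    obtain ⟨a, ha, a', ha', hne⟩ := Finset.one_lt_card.1 (show 1 < (img H S).card by omega)
    subst e1 e3
    rw [e2, e6] at h3'
    rw [e5] at h1
    rw [e6] at hYT
    have hyz : ∀ c ∈ Finset.univ, defect H (S + T) c = z := by
      refine (Finset.sum_eq_sum_iff_of_le fun c _ => ?_).1 (le_antisymm
        (Finset.sum_le_sum fun c _ => ?_) ?_)
      all_goals try
        obtain ⟨a, ha, h⟩ := hy c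
        exact h.trans (hm a ha)
      rw [Finset.sum_const, Finset.card_univ, ← Nat.card_eq_fintype_card, e6, smul_eq_mul]
      omega
    have hxs : ∀ a ∈ img H S, ∀ c, (fib H (S + T) c).card ≤ (fib H S a).card := by
      intro a ha c
      have h6 := hm a ha
      have h7 := fib_add_defect (H := H) S a
      have h8 := fib_add_defect (H := H) (S + T) c
      have h9 := hyz c (Finset.mem_univ _)
      omega
    exact C.false_of_fib_le (fun b => by rw [hBall]; exact Finset.mem_univ _) hne (hxs a ha)
      (hxs a' ha')
  · have h5 := C.three_mul_sum_defect
    have hz0 : z = 0 := eq_zero_of_card_bounds hu hq hn' h2 (by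
      have : (img H S).card * z ≤ (full H (S + T)).card * z := Nat.mul_le_mul_right _ hf
      omega) h5
    have h6 := hY 0 (Nat.card H - 1) (by omega) (fun a ha => by have := defect_lt ha; omega)
    rw [mul_zero, zero_add] at h6
    have h7 := C.data.two_le
    have h8 := C.mu_le
    obtain ⟨u, hu'⟩ : ∃ u, (img H S).card = u + 1 := ⟨(img H S).card - 1, by omega⟩
    have h9 : n * (Nat.card H - 1) ≤ u * (Nat.card H - 1) := Nat.mul_le_mul_right _ (by omega)
    have h10 : u * (Nat.card H - 1) + u = u * Nat.card H := by
      rw [← Nat.mul_succ]; congr 1; omega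
    have h11 : (3 * u) * Nat.card H ≤ Nat.card (G ⧸ H) * Nat.card H :=
      Nat.mul_le_mul_right _ (by omega)
    rw [mul_assoc] at h11
    omega

end Config

end SmallSum

namespace SmallSum

namespace Config

variable {G : Type*} [AddCommGroup G] [DecidableEq G]
  {S T : Finset G} {H : AddSubgroup G} [DecidableEq (G ⧸ H)] {μ : ℕ}

/-- If c had at most one representation, removing its B-part from B would leave a set X with |A + X|
≤ q - 2 = |X| + |A| - 1 and c, c' outside A + X. The inverse theorem would make A a progression. -/
theorem exists_two_representations [Fintype (G ⧸ H)] (C : Config S T H μ)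
    (hv : 3 ≤ (img H T).card)
    (huv : (img H S).card + (img H T).card = Nat.card (G ⧸ H))
    (hA : ¬ ∃ d, AddSubgroup.zmultiples d = ⊤ ∧ IsProgression d (img H S : Set (G ⧸ H)))
    {c' c : G ⧸ H} (hc' : c' ∉ img H S + img H T) (hc : c ≠ c') :
    1 < ((img H S).filter fun a => c - a ∈ img H T).card := by
  by_contra hlt
  obtain ⟨a, hac⟩ : ∃ a, ((img H S).filter fun a => c - a ∈ img H T) ⊆ {a} := by
    rcases Finset.card_le_one_iff_subset_singleton.1 (not_lt.1 hlt) with ⟨a, ha⟩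
    exact ⟨a, ha⟩
  set X := (img H T).erase (c - a) with hX
  have hXc : (img H T).card ≤ X.card + 1 := by
    have : (img H T).card - 1 ≤ X.card := Finset.pred_card_le_card_erase
    omega
  have hc'X : c' ∉ img H S + X := fun h =>
    hc' (Finset.add_subset_add_left (Finset.erase_subset _ _) h)
  have hcX : c ∉ img H S + X := by
    intro h
    obtain ⟨a', ha', b, hb, hab⟩ := Finset.mem_add.1 h
    have hb' := Finset.mem_erase.1 hb
    have hba : b = c - a' := by rw [← hab]; abel
    have : a' = a := Finset.mem_singleton.1
      (hac (Finset.mem_filter.2 ⟨ha', by rw [← hba]; exact hb'.2⟩))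
    exact hb'.1 (by rw [hba, this])
  have hout : TwoOut (img H S + X) := ⟨c, c', hc, hcX, hc'X⟩
  have h1 := card_add_two_le_of_twoOut hout
  rw [← Nat.card_eq_fintype_card] at h1
  exact hA (C.exists_isProgression_img (by omega) hout (by omega))

theorem sum_card_filter_sub [Fintype (G ⧸ H)] :
    ∑ c, ((img H S).filter fun a => c - a ∈ img H T).card =
      (img H S).card * (img H T).card := by
  simp_rw [Finset.card_filter]
  rw [Finset.sum_comm]
  have : ∀ a ∈ img H S, (∑ c, if c - a ∈ img H T then 1 else 0) = (img H T).card := by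
    intro a _
    rw [← Finset.card_filter, ← Finset.card_vadd_finset a (img H T)]
    congr 1
    ext c
    rw [Finset.mem_filter, mem_vadd_iff]
    simp
  rw [Finset.sum_congr rfl this, Finset.sum_const, smul_eq_mul]

theorem exists_isProgression_of_card_add_eq [Fintype (G ⧸ H)] (C : Config S T H μ)
    (hu : 3 ≤ (img H S).card)
    (huv : (img H S).card + (img H T).card = Nat.card (G ⧸ H)) {c' : G ⧸ H}
    (hc' : c' ∉ img H S + img H T) (hcc : ∀ c, c ∉ img H S + img H T → c = c') :
    ∃ d, AddSubgroup.zmultiples d = ⊤ ∧ IsProgression d (img H S : Set (G ⧸ H)) := by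
  by_contra hA
  have hfin := C.data.finite
  obtain ⟨z, m, a₀, ha₀, hz, hm, hm2, -, h1, h2⟩ := C.exists_min_defect
  have hq := C.three_mul_le
  have hh := C.data.two_le
  have hcount := C.card_filter_add ha₀
  have hYT := sum_defect_univ (H := H) (S + T)
  have hadd := C.card_add
  have hcf := card_compl_full (H := H) (S + T)
  have hyc' : defect H (S + T) c' = Nat.card H := by
    have := fib_add_defect (H := H) (S + T) c'
    have : ¬ 0 < (fib H (S + T) c').card := by rwa [card_fib_pos, img_add]
    omega
  have hzh : z < Nat.card H := by
    have : 3 * z ≤ (img H S).card * z := Nat.mul_le_mul_right _ hu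
    omega
  have hc'P : c' ∈ Finset.univ \ full H (S + T) := by
    rw [Finset.mem_sdiff, mem_full]
    have := fib_add_defect (H := H) (S + T) c'
    exact ⟨Finset.mem_univ _, by omega⟩
  set P := (Finset.univ \ full H (S + T)).erase c' with hP
  have hPc : P.card + 1 = (Finset.univ \ full H (S + T)).card := Finset.card_erase_add_one hc'P
  have hPsum : ∑ c, defect H (S + T) c = ∑ c ∈ P, defect H (S + T) c + Nat.card H := by
    rw [← sum_defect_eq, ← Finset.sum_erase_add _ _ hc'P, hyc']
  have hfilter : (P.filter fun c => z < defect H (S + T) c).card + 1 ≤ (img H S).card := by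
    have h3 : (P.filter fun c => z < defect H (S + T) c) ⊆
        (Finset.univ.filter fun c => defect H S a₀ < defect H (S + T) c).erase c' := by
      intro c hc
      obtain ⟨hcP, hcz⟩ := Finset.mem_filter.1 hc
      exact Finset.mem_erase.2 ⟨(Finset.mem_erase.1 hcP).1, Finset.mem_filter.2
        ⟨Finset.mem_univ _, by omega⟩⟩
    have h4 := Finset.card_le_card h3
    have h5 := Finset.card_erase_add_one
      (s := Finset.univ.filter fun c => defect H S a₀ < defect H (S + T) c) (a := c')
      (Finset.mem_filter.2 ⟨Finset.mem_univ _, by omega⟩)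
    omega
  obtain ⟨u, hu'⟩ : ∃ u, (img H S).card = u + 1 := ⟨(img H S).card - 1, by omega⟩
  rcases Nat.lt_or_ge (full H (S + T)).card (img H S).card with hf | hf
  · have hz1 := C.min_defect_pos hu hf ha₀
    have h3 := C.card_right_le hf ha₀ hz hm
    have h4 : ∑ c ∈ P, defect H (S + T) c ≤ P.card * z + u * m := by
      refine sum_le_of_excess _ _ (fun c hc => ?_) (by omega)
      have hcAB : c ∈ img H S + img H T := by
        by_contra h
        exact (Finset.mem_erase.1 hc).1 (hcc c h)
      obtain ⟨a, ha, b, hb, rfl⟩ := Finset.mem_add.1 hcAB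
      exact (C.defect_add_le (by simpa using hb)).trans (hm a ha)
    refine false_of_card_bounds (f := (full H (S + T)).card) (q := Nat.card (G ⧸ H))
      (Y := ∑ c, defect H (S + T) c) hu hq hf (hz ▸ hz1) h1 h2 ?_ ?_ (by omega) C.card_le
    · rw [← huv, add_mul]; omega
    · rw [← hcf, ← hPc, hu', hPsum, add_mul, add_mul, add_mul]; omega
  · have hr : ∀ c, c ≠ c' → 1 < ((img H S).filter fun a => c - a ∈ img H T).card := fun c hc =>
      C.exists_two_representations (by omega) huv hA hc' hc
    have h4 : ∑ c ∈ P, 2 * defect H (S + T) c ≤ P.card * (2 * z) + u * m := by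
      refine sum_le_of_excess _ _ (fun c hc => ?_) ?_
      · obtain ⟨a, ha, a', ha', hne⟩ := Finset.one_lt_card.1 (hr c (Finset.mem_erase.1 hc).1)
        rw [Finset.mem_filter] at ha ha'
        have h5 := C.defect_add_le ha.2
        have h6 := C.defect_add_le ha'.2
        have h7 := hm2 a ha.1 a' ha'.1 hne
        omega
      · have : (P.filter fun c => 2 * z < 2 * defect H (S + T) c) =
            P.filter fun c => z < defect H (S + T) c := by
          refine Finset.filter_congr fun c _ => ?_
          omega
        rw [this]
        omega
    rw [← Finset.mul_sum] at h4
    obtain ⟨h5, h6⟩ := eq_of_card_bounds (Y := ∑ c, defect H (S + T) c) (z := z) (m := m) hu hq hh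
      h2 (by
        have h7 : (img H S).card * z ≤ (full H (S + T)).card * z := Nat.mul_le_mul_right _ hf
        rw [← hcf, ← hPc, add_mul, add_mul, hPsum]
        rw [hu', add_mul] at h7 ⊢
        rw [add_mul]
        have h8 : P.card * (2 * z) = 2 * (P.card * z) := by ring
        omega) C.three_mul_sum_defect
    -- With u = v = 3 and q = 6 there are 9 pairs (a, b), but five cosets with two representations
    -- each need 10.
    have h7 := sum_card_filter_sub (S := S) (T := T) (H := H)
    have h8 : (Finset.univ.erase c').card * 2 ≤
        ∑ c, ((img H S).filter fun a => c - a ∈ img H T).card := by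
      rw [← smul_eq_mul]
      refine (Finset.card_nsmul_le_sum _ _ _ fun c hc => hr c (Finset.mem_erase.1 hc).1).trans ?_
      exact Finset.sum_le_sum_of_subset (Finset.subset_univ _)
    have h9 := Finset.card_erase_add_one (Finset.mem_univ c')
    rw [Finset.card_univ, ← Nat.card_eq_fintype_card] at h9
    have h10 : (img H T).card = 3 := by omega
    rw [h7, h5, h10] at h8
    omega

/-- The theorem when `S` meets at least three cosets of `H`. -/
theorem exists_isProgression_of_three_le (C : Config S T H μ) (hu : 3 ≤ (img H S).card) :
    (img H S + img H T).card + 1 = (img H S).card + (img H T).card ∧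
      ∃ d, IsProgression d (img H S : Set (G ⧸ H)) ∧ IsProgression d (img H T : Set (G ⧸ H)) := by
  have hlt := C.card_img_add_lt
  have hv := C.card_img_right_ge hu
  by_cases hp : ∃ p, p ∉ img H S + img H T
  · have hcd := C.card_img_add (Finset.card_pos.1 (by omega)) hp
    have key : ∃ d, AddSubgroup.zmultiples d = ⊤ ∧
        IsProgression d (img H S : Set (G ⧸ H)) := by
      by_cases hout : TwoOut (img H S + img H T)
      · exact C.exists_isProgression_img hv hout (by omega)
      · have hfin := finite_of_not_twoOut hout
        have := Fintype.ofFinite (G ⧸ H)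
        obtain ⟨c', hc'⟩ := hp
        have h1 := C.card_add_le_card_quotient hu
        have h2 := card_le_of_not_twoOut hout
        rw [← Nat.card_eq_fintype_card] at h2
        refine C.exists_isProgression_of_card_add_eq hu (by omega) hc' fun c hc => ?_
        by_contra hne
        exact hout ⟨c, c', hne, hc, hc'⟩
    obtain ⟨d, hd, hA⟩ := key
    exact ⟨by omega, d, hA, C.isProgression_img_right hd hA hp⟩
  · exfalso
    have hout : ¬ TwoOut (img H S + img H T) := fun ⟨p, _, _, h, _⟩ => hp ⟨p, h⟩
    have hfin := finite_of_not_twoOut hout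
    have := Fintype.ofFinite (G ⧸ H)
    have h1 := C.card_add_le_card_quotient hu
    push Not at hp
    have h2 : img H S + img H T = Finset.univ := Finset.eq_univ_iff_forall.2 hp
    have h3 : (img H S + img H T).card = Nat.card (G ⧸ H) := by
      rw [h2, Finset.card_univ, Nat.card_eq_fintype_card]
    omega

end Config

end SmallSum

/-! ### S meets two cosets and T meets all of them -/

namespace SmallSum

variable {G : Type*} [AddCommGroup G] [DecidableEq G]

/-- A pair `S, T` such that `S` meets exactly two cosets of `H` and `T` meets all of them. -/
structure PairConfig (S T : Finset G) (H : AddSubgroup G) [DecidableEq (G ⧸ H)] (μ : ℕ)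
    (d : G ⧸ H) : Prop extends Config S T H μ where
  img_left : img H S = {0, d}
  ne_zero : d ≠ 0
  zmultiples_eq : AddSubgroup.zmultiples d = ⊤
  mem_img_right : ∀ b, b ∈ img H T

namespace PairConfig

variable {S T : Finset G} {H : AddSubgroup G} [DecidableEq (G ⧸ H)] {μ : ℕ} {d : G ⧸ H}

theorem finite (D : PairConfig S T H μ d) : Finite H := D.data.finite

theorem eq_union (D : PairConfig S T H μ d) : S = fib H S 0 ∪ fib H S d := by
  ext x
  rw [Finset.mem_union, mem_fib, mem_fib, ← and_or_left]
  refine ⟨fun hx => ⟨hx, ?_⟩, fun hx => hx.1⟩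
  have : (x : G ⧸ H) ∈ img H S := mem_img.2 ⟨x, hx, rfl⟩
  rw [D.img_left] at this
  simpa using this

theorem card_fib_add_card_fib' (D : PairConfig S T H μ d) :
    (fib H S 0).card + (fib H S d).card = S.card := by
  rw [card_eq_sum_fib (H := H) S, D.img_left, Finset.sum_pair D.ne_zero.symm]

theorem card_img_left (D : PairConfig S T H μ d) : (img H S).card = 2 := by
  rw [D.img_left, Finset.card_pair D.ne_zero.symm]

theorem le_card_left (D : PairConfig S T H μ d) : Nat.card H + μ ≤ S.card := by
  have := D.card_left_ge
  rw [D.card_img_left] at this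
  omega

theorem three_le [Fintype (G ⧸ H)] (D : PairConfig S T H μ d) : 3 ≤ Nat.card (G ⧸ H) := by
  obtain ⟨p, hp⟩ := D.data.exists_notMem
  have := Finset.card_lt_univ_of_notMem hp
  rw [D.card_img_left, ← Nat.card_eq_fintype_card] at this
  omega

theorem sum_shift [Fintype (G ⧸ H)] (d : G ⧸ H) (f : G ⧸ H → ℕ) : ∑ c, f (d + c) = ∑ c, f c :=
  Equiv.sum_comp (Equiv.addLeft d) f

/-- The defining inequality of the hyper-atom for a set contained in a coset. -/
theorem card_add_le (D : PairConfig S T H μ d) {P : Finset G} {c : G ⧸ H}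
    (hP : ∀ x ∈ P, (x : G ⧸ H) = c) (hP2 : 2 ≤ P.card) :
    Nat.card H + P.card ≤ (fib H S 0 + P).card + (fib H S d + P).card := by
  have hfin := D.finite
  have h1 : P + S = (fib H S 0 + P) ∪ (fib H S d + P) := by
    rw [← Finset.union_add, ← D.eq_union, add_comm]
  have hPi : img H P ⊆ {c} := by
    intro x hx
    obtain ⟨y, hy, rfl⟩ := mem_img.1 hx
    rw [hP y hy]; simp
  obtain ⟨p, hp⟩ := D.data.exists_notMem
  have hout : TwoOut (P + S) := by
    refine TwoOut.mono (twoOut_pull (Y := {c} + img H S) (p := c + p) D.data.two_le ?_) ?_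
    rotate_left
    · intro x hx
      rw [mem_pull]
      refine Finset.add_subset_add_right hPi ?_
      rw [← img_add]
      exact mem_img.2 ⟨x, hx, rfl⟩
    · rw [Finset.mem_add]
      rintro ⟨c', hc', a, ha, h⟩
      rw [Finset.mem_singleton] at hc'
      subst hc'
      rw [add_left_cancel h] at ha
      exact hp ha
  have h2 := D.data.le_card_add P hP2 hout
  rw [D.card_img_left, h1] at h2
  have := Finset.card_union_le (fib H S 0 + P) (fib H S d + P)
  omega

theorem card_add_le' (D : PairConfig S T H μ d) {P : Finset G} {c : G ⧸ H}
    (hP : ∀ x ∈ P, (x : G ⧸ H) = c) (hP0 : P.Nonempty) :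
    Nat.card H + P.card ≤
      (fib H S 0 + P).card + (fib H S d + P).card + if P.card = 1 then 1 else 0 := by
  have h1 := Finset.card_pos.2 hP0
  split_ifs with h
  · have h2 := Finset.card_le_card_add_right (s := fib H S 0) hP0
    have h3 := Finset.card_le_card_add_right (s := fib H S d) hP0
    have h4 := D.card_fib_add_card_fib'
    have h5 := D.le_card_left
    omega
  · exact D.card_add_le hP (by omega)

theorem zero_add_subset (W : Finset G) (c : G ⧸ H) :
    fib H S 0 + fib H W c ⊆ fib H (S + W) c := by
  have := fib_add_subset (H := H) (X := S) (Y := W) 0 c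
  rwa [zero_add] at this

theorem card_zero_le (W : Finset G) {c : G ⧸ H} (hc : c ∈ img H W) :
    (fib H S 0).card ≤ (fib H (S + W) c).card :=
  (Finset.card_le_card_add_right (fib_nonempty_iff.2 hc)).trans
    (Finset.card_le_card (zero_add_subset W c))

theorem card_le_of_sub_mem (W : Finset G) {c : G ⧸ H} (hc : c - d ∈ img H W) :
    (fib H S d).card ≤ (fib H (S + W) c).card := by
  have := card_fib_add_ge_left (X := S) (a := d) hc
  rwa [add_sub_cancel] at this

theorem pair_le (D : PairConfig S T H μ d) (W : Finset G) {c : G ⧸ H} (hc : c ∈ img H W) :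
    Nat.card H + (fib H W c).card ≤ (fib H (S + W) c).card + (fib H (S + W) (d + c)).card +
      if (fib H W c).card = 1 then 1 else 0 := by
  have h1 := D.card_add_le' (P := fib H W c) (c := c) (fun x hx => (mem_fib.1 hx).2)
    (fib_nonempty_iff.2 hc)
  have h2 := Finset.card_le_card (zero_add_subset (S := S) W c)
  have h3 := Finset.card_le_card (fib_add_subset (H := H) (X := S) (Y := W) d c)
  omega

/-- Let Y be the part of the coset c outside S + T. For a = 0 and a = d the fibre of T over c - a
avoids Y minus the fibre of S at a. Apply the hyper-atom inequality to -Y, or |S| > h if Y is a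
single point. -/
theorem dual_le (D : PairConfig S T H μ d) {c : G ⧸ H}
    (hy : 1 ≤ defect H (S + T) c) (h : 2 ≤ defect H (S + T) c ∨ Nat.card H < S.card) :
    (fib H T c).card + (fib H T (c - d)).card + defect H (S + T) c ≤ Nat.card H := by
  have hfin := D.finite
  set Y := cos H c \ fib H (S + T) c with hY
  have hYc : Y.card = defect H (S + T) c := by
    have h1 := Finset.card_sdiff_add_card_eq_card (fib_subset_cos (H := H) (S + T) c)
    rw [card_cos] at h1
    rw [hY, defect]
    omega
  have hYm : ∀ x ∈ Y, (x : G ⧸ H) = c := fun x hx => mem_cos.1 (Finset.mem_sdiff.1 hx).1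
  have hkey : ∀ a : G ⧸ H,
      (fib H T (c - a)).card + (fib H S a + -Y).card ≤ Nat.card H := by
    intro a
    rw [← card_cos (c - a), ← Finset.card_neg (fib H S a + -Y), ← Finset.card_union_of_disjoint]
    · refine Finset.card_le_card (Finset.union_subset (fib_subset_cos _ _) fun x hx => ?_)
      rw [Finset.mem_neg'] at hx
      obtain ⟨s, hs, y, hy, hsy⟩ := Finset.mem_add.1 hx
      rw [Finset.mem_neg'] at hy
      rw [mem_cos]
      have h2 : x = -y - s := by rw [← neg_neg x, ← hsy]; abel
      rw [h2, QuotientAddGroup.mk_sub, hYm _ hy, (mem_fib.1 hs).2]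
    · rw [Finset.disjoint_left]
      intro x hx hx'
      rw [Finset.mem_neg'] at hx'
      obtain ⟨s, hs, y, hy, hsy⟩ := Finset.mem_add.1 hx'
      rw [Finset.mem_neg'] at hy
      refine (Finset.mem_sdiff.1 hy).2 ?_
      have h2 : -y = s + x := by rw [← neg_neg x, ← hsy]; abel
      rw [h2]
      have := fib_add_subset (H := H) _ _ (Finset.add_mem_add hs hx)
      rwa [add_sub_cancel] at this
  have h1 := hkey 0
  have h2 := hkey d
  rw [sub_zero] at h1
  have hYn : (-Y).card = Y.card := Finset.card_neg _
  rcases Nat.lt_or_ge Y.card 2 with hlt | hge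
  · have h3 : (-Y).Nonempty := Finset.card_pos.1 (by omega)
    have h4 := Finset.card_le_card_add_right (s := fib H S 0) h3
    have h5 := Finset.card_le_card_add_right (s := fib H S d) h3
    have h6 := D.card_fib_add_card_fib'
    omega
  · have h3 := D.card_add_le (P := -Y) (c := -c) (fun x hx => by
      rw [Finset.mem_neg'] at hx
      rw [← hYm _ hx, QuotientAddGroup.mk_neg, neg_neg]) (by omega)
    omega

variable [Fintype (G ⧸ H)]

theorem sum_pair_eq (d : G ⧸ H) (W : Finset G) :
    ∑ c : G ⧸ H, ((fib H W c).card + (fib H W (d + c)).card) = 2 * W.card := by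
  rw [Finset.sum_add_distrib, sum_shift d fun c => (fib H W c).card, ← card_eq_sum_fib_univ]
  ring

theorem size' (D : PairConfig S T H μ d) :
    3 * (S + T).card ≤ 2 * (Nat.card (G ⧸ H) * Nat.card H) + 2 * μ := by
  rw [← Config.card_group H]
  exact D.size D.toConfig.finite_group

/-- The consequences of a regular behaviour of all the fibres of `T`. -/
theorem regular (D : PairConfig S T H μ d)
    (hreg : ∀ c, Nat.card H + (fib H T c).card ≤
      (fib H (S + T) c).card + (fib H (S + T) (d + c)).card) :
    2 * S.card + T.card = Nat.card (G ⧸ H) * Nat.card H + 2 * μ ∧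
    ∀ c, (fib H T c).card + defect H (S + T) c + defect H (S + T) (d + c) = Nat.card H := by
  have hfin := D.finite
  have h1 : ∑ c : G ⧸ H, (Nat.card H + (fib H T c).card) =
      Nat.card (G ⧸ H) * Nat.card H + T.card := by
    rw [Finset.sum_add_distrib, ← card_eq_sum_fib_univ, Finset.sum_const, Finset.card_univ,
      ← Nat.card_eq_fintype_card, smul_eq_mul]
  have h2 := sum_pair_eq d (S + T)
  have h3 := Finset.sum_le_sum fun c (_ : c ∈ Finset.univ) => hreg c
  have h4 := D.size'
  have h5 := D.card_add
  have h6 := D.card_le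
  have h7 := D.mu_le
  rw [h1, h2] at h3
  -- Summing gives 2|S| + |T| ≥ qh + 2μ, while |S| ≤ |T| and the size bound give the reverse, so all
  -- inequalities in the sum are equalities.
  refine ⟨by omega, fun c => ?_⟩
  have h8 := (Finset.sum_eq_sum_iff_of_le fun c (_ : c ∈ Finset.univ) => hreg c).1
    (by rw [h1, h2]; omega) c (Finset.mem_univ _)
  have h9 := fib_add_defect (H := H) (S + T) c
  have h10 := fib_add_defect (H := H) (S + T) (d + c)
  omega

theorem forall_of_step (D : PairConfig S T H μ d) {p : G ⧸ H → Prop} {c : G ⧸ H} (hc : p c)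
    (hstep : ∀ c, p c → p (d + c)) : ∀ c, p c := by
  have h1 : ∀ n : ℕ, p (n • d + c) := by
    intro n
    induction n with
    | zero => simpa using hc
    | succ n ih =>
      have := hstep _ ih
      rwa [← add_assoc, add_comm d, ← succ_nsmul] at this
  intro x
  have hx : x - c ∈ AddSubgroup.zmultiples d := by rw [D.zmultiples_eq]; trivial
  rw [← mem_multiples_iff_mem_zmultiples] at hx
  obtain ⟨n, hn⟩ := AddSubmonoid.mem_multiples_iff _ _ |>.1 hx
  have := h1 n
  rwa [hn, sub_add_cancel] at this

/-- The case `|S| > |H|` does not occur. -/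
theorem card_left_eq (D : PairConfig S T H μ d) : S.card = Nat.card H := by
  by_contra hne
  have hfin := D.finite
  have hS : Nat.card H < S.card := by
    have := D.le_card_left
    omega
  have hs01 := D.card_fib_add_card_fib'
  have hreg : ∀ c, Nat.card H + (fib H T c).card ≤
      (fib H (S + T) c).card + (fib H (S + T) (d + c)).card := by
    intro c
    have h1 := D.pair_le T (D.mem_img_right c)
    have h2 := card_zero_le (S := S) T (D.mem_img_right c)
    have h3 := card_le_of_sub_mem (S := S) (d := d) (c := d + c) T (D.mem_img_right _)
    split_ifs at h1 <;> omega
  obtain ⟨hsum, ht⟩ := D.regular hreg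
  have hYX := sum_defect_univ (H := H) (S + T)
  have hadd := D.card_add
  have hle := D.card_le
  have hμ := D.mu_le
  set y := defect H (S + T) with hy
  have htpos : ∀ c, 0 < (fib H T c).card := fun c => card_fib_pos.2 (D.mem_img_right c)
  -- Duality at c combined with the equalities of `regular` at c and c - d.
  have hthree : ∀ c, 1 ≤ y c → Nat.card H ≤ y (c - d) + y c + y (d + c) := by
    intro c hc
    have h1 := D.dual_le hc (Or.inr hS)
    have h2 := ht c
    have h3 := ht (c - d)
    rw [add_sub_cancel] at h3
    simp only [← hy] at h1
    omega
  obtain ⟨c₀, hc₀⟩ : ∃ c, 1 ≤ y c := by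
    by_contra hcon
    push Not at hcon
    have : ∑ c, y c = 0 := Finset.sum_eq_zero fun c _ => by have := hcon c; omega
    have := D.size'
    have := D.card_left
    omega
  -- Since T meets the coset c - d, y (c - d) + y c < h, so positivity passes from c to d + c.
  have hypos : ∀ c, 1 ≤ y c := by
    refine D.forall_of_step hc₀ fun c hc => ?_
    have h1 := hthree c hc
    have h2 := ht (c - d)
    rw [add_sub_cancel] at h2
    have h3 := htpos (c - d)
    omega
  have hsum3 : ∑ c, (y (c - d) + y c + y (d + c)) = 3 * ∑ c, y c := by
    have h1 : ∑ c, y (c - d) = ∑ c, y c := Equiv.sum_comp (Equiv.subRight d) y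
    rw [Finset.sum_add_distrib, Finset.sum_add_distrib, sum_shift d y, h1]
    ring
  have hsumh : ∑ _c : G ⧸ H, Nat.card H = Nat.card (G ⧸ H) * Nat.card H := by
    rw [Finset.sum_const, Finset.card_univ, ← Nat.card_eq_fintype_card, smul_eq_mul]
  have hge := Finset.sum_le_sum fun c (_ : c ∈ Finset.univ) => hthree c (hypos c)
  rw [hsumh, hsum3] at hge
  have hμ0 : μ = 0 := by omega
  have heq : ∀ c, Nat.card H = y (c - d) + y c + y (d + c) := fun c =>
    (Finset.sum_eq_sum_iff_of_le fun c (_ : c ∈ Finset.univ) => hthree c (hypos c)).1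
      (by rw [hsumh, hsum3]; omega) c (Finset.mem_univ _)
  have hx0 : ∀ c, (fib H S 0).card + y c ≤ Nat.card H := fun c => by
    have h2 := card_zero_le (S := S) T (D.mem_img_right c)
    have := fib_add_defect (H := H) (S + T) c
    simp only [hy]; omega
  have hx1 : ∀ c, (fib H S d).card + y c ≤ Nat.card H := fun c => by
    have h2 := card_le_of_sub_mem (S := S) (d := d) (c := c) T (D.mem_img_right _)
    have := fib_add_defect (H := H) (S + T) c
    simp only [hy]; omega
  have h3S : 3 * S.card = Nat.card (G ⧸ H) * Nat.card H := by omega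
  have hq3 := D.three_le
  -- Adding the fibre bounds over three consecutive cosets gives 3|S| ≤ 4h, and q = 3 would mean |S|
  -- = h.
  have hq : Nat.card (G ⧸ H) = 4 := by
    have e1 := hx0 (0 - d)
    have e2 := hx1 (0 - d)
    have e3 := hx0 0
    have e4 := hx1 0
    have e5 := hx0 (d + 0)
    have e6 := hx1 (d + 0)
    have e7 := heq 0
    have h4 : Nat.card (G ⧸ H) * Nat.card H ≤ 4 * Nat.card H := by omega
    have h5 := Nat.le_of_mul_le_mul_right h4 Nat.card_pos
    have h6 : Nat.card (G ⧸ H) ≠ 3 := by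
      intro h; rw [h] at h3S; omega
    omega
  rw [hq] at h3S
  have hy3 : ∀ c, 3 * y c = Nat.card H := by
    intro c
    have e1 := hx0 (c - d)
    have e2 := hx1 (c - d)
    have e3 := hx0 c
    have e4 := hx1 c
    have e5 := hx0 (d + c)
    have e6 := hx1 (d + c)
    have e7 := heq c
    omega
  refine D.toConfig.false_of_fib_le D.mem_img_right D.ne_zero (fun c => ?_) (fun c => ?_)
  all_goals
    have e1 := hx0 c
    have e2 := hx1 c
    have e3 := hy3 c
    have e4 := fib_add_defect (H := H) (S + T) c
    simp only [hy] at e1 e2 e3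
    omega

theorem mu_eq_zero (D : PairConfig S T H μ d) : μ = 0 := by
  have := D.card_left_eq
  have := D.le_card_left
  omega

end PairConfig

end SmallSum

/-! ### An irregular fibre of T leads to the exceptional case -/

namespace SmallSum

variable {G : Type*} [AddCommGroup G] [DecidableEq G]

/-- If translating by the elements of `P` moves `R` little, then `R` is a coset of a subgroup, so
that sums with `R` have few possible sizes. -/
theorem card_add_le_or_ge {R P Z : Finset G} (h1 : (R + P).card ≤ R.card)
    (h2 : R.card ≤ P.card + 1) (h3 : 3 ≤ R.card) (hZ : Z.Nonempty) :
    (R + Z).card ≤ R.card ∨ 2 * R.card ≤ (R + Z).card := by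
  have hstab : ∀ p ∈ P, ∀ p' ∈ P, ∀ σ ∈ R, σ + (p - p') ∈ R := fun p hp p' hp' =>
    add_sub_mem_of_card_le (fun σ hσ => Finset.add_mem_add hσ hp)
      (fun σ hσ => Finset.add_mem_add hσ hp') h1
  obtain ⟨p₀, hp₀⟩ : P.Nonempty := Finset.card_pos.1 (by omega)
  -- R contains translates of P at ρ and at ρ'; since 2|P| > |R| they meet, so ρ - ρ' is a
  -- difference of P.
  have hdiff : ∀ ρ ∈ R, ∀ ρ' ∈ R, ∃ p ∈ P, ∃ p' ∈ P, ρ - ρ' = p - p' := by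
    intro ρ hρ ρ' hρ'
    by_contra hcon
    push Not at hcon
    have hd : Disjoint (P.image fun p => ρ + (p - p₀)) (P.image fun p => ρ' + (p - p₀)) := by
      rw [Finset.disjoint_left]
      intro x hx hx'
      obtain ⟨p, hp, rfl⟩ := Finset.mem_image.1 hx
      obtain ⟨p', hp', h⟩ := Finset.mem_image.1 hx'
      refine hcon p' hp' p hp ?_
      rw [sub_eq_sub_iff_add_eq_add]
      have h4 : ρ + p = ρ + (p - p₀) + p₀ := by abel
      rw [h4, ← h]
      abel
    have hsub : (P.image fun p => ρ + (p - p₀)) ∪ (P.image fun p => ρ' + (p - p₀)) ⊆ R := by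
      refine Finset.union_subset ?_ ?_
      · intro x hx
        obtain ⟨p, hp, rfl⟩ := Finset.mem_image.1 hx
        exact hstab p hp p₀ hp₀ ρ hρ
      · intro x hx
        obtain ⟨p, hp, rfl⟩ := Finset.mem_image.1 hx
        exact hstab p hp p₀ hp₀ ρ' hρ'
    have h4 := Finset.card_le_card hsub
    rw [Finset.card_union_of_disjoint hd,
      Finset.card_image_of_injective _ fun a b h => by simpa using h,
      Finset.card_image_of_injective _ fun a b h => by simpa using h] at h4
    omega
  have hR : ∀ ρ ∈ R, ∀ ρ' ∈ R, ∀ σ ∈ R, σ + (ρ - ρ') ∈ R := by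
    intro ρ hρ ρ' hρ' σ hσ
    obtain ⟨p, hp, p', hp', h⟩ := hdiff ρ hρ ρ' hρ'
    rw [h]
    exact hstab p hp p' hp' σ hσ
  obtain ⟨z₀, hz₀⟩ := hZ
  have hsub : ∀ z ∈ Z, z +ᵥ R ⊆ R + Z := by
    intro z hz x hx
    rw [mem_vadd_iff] at hx
    exact Finset.mem_add.2 ⟨_, hx, z, hz, by abel⟩
  by_cases hd : ∃ z ∈ Z, Disjoint (z₀ +ᵥ R) (z +ᵥ R)
  · right
    obtain ⟨z, hz, hd⟩ := hd
    have := Finset.card_le_card (Finset.union_subset (hsub z₀ hz₀) (hsub z hz))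
    rw [Finset.card_union_of_disjoint hd, Finset.card_vadd_finset, Finset.card_vadd_finset] at this
    omega
  · left
    push Not at hd
    rw [← Finset.card_vadd_finset z₀ R]
    refine Finset.card_le_card fun x hx => ?_
    obtain ⟨ρ, hρ, z, hz, rfl⟩ := Finset.mem_add.1 hx
    obtain ⟨w, hw, hw'⟩ := Finset.not_disjoint_iff.1 (hd z hz)
    rw [mem_vadd_iff] at hw hw' ⊢
    have := hR _ hw _ hw' _ hρ
    have h4 : ρ + (w - z₀ - (w - z)) = ρ + z - z₀ := by abel
    rwa [h4] at this

namespace PairConfig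

variable {S T : Finset G} {H : AddSubgroup G} [DecidableEq (G ⧸ H)] {μ : ℕ} {d : G ⧸ H}

/-- Both fibres of S + W have at least as many elements as each fibre of S, so all four sizes are
h/2. The fibre of S + W over j is then a translate of both fibres of S. -/
theorem exists_translate (D : PairConfig S T H μ d) (hS : S.card = Nat.card H) {W : Finset G}
    (hW : ∀ c, c ∈ img H W) {j : G ⧸ H} (hj : (fib H W j).card = 1)
    (hle : (fib H (S + W) j).card + (fib H (S + W) (d + j)).card ≤ Nat.card H) :
    2 * (fib H S 0).card = Nat.card H ∧
      ∃ e : G, (e : G ⧸ H) = d ∧ ∀ x, x ∈ fib H S d ↔ x - e ∈ fib H S 0 := by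
  have h1 := card_zero_le (S := S) W (hW j)
  have h2 := card_zero_le (S := S) W (hW (d + j))
  have h3 := card_le_of_sub_mem (S := S) (d := d) (c := j) W (hW _)
  have h4 := card_le_of_sub_mem (S := S) (d := d) (c := d + j) W (hW _)
  have h5 := D.card_fib_add_card_fib'
  refine ⟨by omega, ?_⟩
  obtain ⟨p, hp⟩ := Finset.card_pos.1 (hj ▸ Nat.one_pos)
  obtain ⟨p', hp'⟩ := fib_nonempty_iff.2 (hW (j - d))
  have h6 : (fib H S 0).image (fun x => x + p) = fib H (S + W) j := by
    refine Finset.eq_of_subset_of_card_le ?_ ?_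
    · intro x hx
      obtain ⟨s, hs, rfl⟩ := Finset.mem_image.1 hx
      exact zero_add_subset W j (Finset.add_mem_add hs hp)
    · rw [Finset.card_image_of_injective _ (add_left_injective p)]
      omega
  have h7 : (fib H S d).image (fun x => x + p') = fib H (S + W) j := by
    refine Finset.eq_of_subset_of_card_le ?_ ?_
    · intro x hx
      obtain ⟨s, hs, rfl⟩ := Finset.mem_image.1 hx
      have := fib_add_subset (H := H) d (j - d) (Finset.add_mem_add hs hp')
      rwa [add_sub_cancel] at this
    · rw [Finset.card_image_of_injective _ (add_left_injective p')]
      omega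
  refine ⟨p - p', ?_, fun x => ⟨fun hx => ?_, fun hx => ?_⟩⟩
  · rw [QuotientAddGroup.mk_sub, (mem_fib.1 hp).2, (mem_fib.1 hp').2]
    abel
  · have h8 := Finset.mem_image_of_mem (fun x => x + p') hx
    rw [h7, ← h6] at h8
    obtain ⟨s, hs, h9⟩ := Finset.mem_image.1 h8
    have : x - (p - p') = s := by
      rw [sub_sub_eq_add_sub, ← h9, add_sub_cancel_right]
    rwa [this]
  · have h8 := Finset.mem_image_of_mem (fun x => x + p) hx
    rw [h6, ← h7] at h8
    obtain ⟨s, hs, h9⟩ := Finset.mem_image.1 h8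
    have : x = s := by
      have h10 : x = x - (p - p') + p - p' := by abel
      rw [h10, ← h9, add_sub_cancel_right]
    rwa [this]

variable [Fintype (G ⧸ H)]

/-- Since S is S₀ + {0, e} with S₀ its fibre in H, S + T = S₀ + F for F = T ∪ (e + T). The two
fibres of S have equally large sums, so the pair inequality for a fibre of F bounds twice one fibre
of S + T. F is larger than T because S + T has no period e. -/
theorem exists_superset (D : PairConfig S T H μ d) {e : G} (he : (e : G ⧸ H) = d)
    (hS : ∀ x, x ∈ fib H S d ↔ x - e ∈ fib H S 0) :
    ∃ F : Finset G, T ⊆ F ∧ (∀ t ∈ T, e + t ∈ F) ∧ T.card + 1 ≤ F.card ∧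
      Nat.card (G ⧸ H) * Nat.card H + F.card ≤
        2 * (S + T).card + (Finset.univ.filter fun c => (fib H F c).card = 1).card := by
  have hfin := D.finite
  refine ⟨T ∪ (e +ᵥ T), Finset.subset_union_left, fun t ht => ?_, ?_, ?_⟩
  · exact Finset.mem_union_right _ (by rw [mem_vadd_iff]; simpa using ht)
  · by_contra hlt
    have h1 : T = T ∪ (e +ᵥ T) := Finset.eq_of_subset_of_card_le Finset.subset_union_left (by omega)
    have h2 : e = 0 := by
      refine D.aper.eq_zero fun x hx => ?_
      obtain ⟨s, hs, t, ht, rfl⟩ := Finset.mem_add.1 hx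
      refine Finset.mem_add.2 ⟨s, hs, e + t, ?_, by abel⟩
      rw [h1]
      exact Finset.mem_union_right _ (by rw [mem_vadd_iff]; simpa using ht)
    refine D.ne_zero ?_
    rw [← he, h2]; rfl
  · set F := T ∪ (e +ᵥ T) with hF
    have hS1 : ∀ P : Finset G, (fib H S d + P).card ≤ (fib H S 0 + P).card := by
      intro P
      rw [← Finset.card_vadd_finset e (fib H S 0 + P)]
      refine Finset.card_le_card fun x hx => ?_
      obtain ⟨s, hs, p, hp, rfl⟩ := Finset.mem_add.1 hx
      rw [mem_vadd_iff]
      exact Finset.mem_add.2 ⟨s - e, (hS s).1 hs, p, hp, by abel⟩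
    have hsub : ∀ c, fib H S 0 + fib H F c ⊆ fib H (S + T) c := by
      intro c x hx
      obtain ⟨s, hs, f, hf, rfl⟩ := Finset.mem_add.1 hx
      obtain ⟨hfF, hfc⟩ := mem_fib.1 hf
      have hs' := mem_fib.1 hs
      refine mem_fib.2 ⟨?_, by rw [QuotientAddGroup.mk_add, hs'.2, hfc, zero_add]⟩
      rcases Finset.mem_union.1 hfF with h | h
      · exact Finset.add_mem_add hs'.1 h
      · rw [mem_vadd_iff] at h
        have h1 : s + e ∈ fib H S d := (hS _).2 (by simpa using hs)
        exact Finset.mem_add.2 ⟨s + e, (mem_fib.1 h1).1, f - e, h, by abel⟩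
    have hc : ∀ c : G ⧸ H, Nat.card H + (fib H F c).card ≤
        2 * (fib H (S + T) c).card + if (fib H F c).card = 1 then 1 else 0 := by
      intro c
      have h1 := D.card_add_le' (P := fib H F c) (c := c) (fun x hx => (mem_fib.1 hx).2) (by
        obtain ⟨t, ht⟩ := fib_nonempty_iff.2 (D.mem_img_right c)
        rw [mem_fib] at ht
        exact ⟨t, mem_fib.2 ⟨Finset.mem_union_left _ ht.1, ht.2⟩⟩)
      have h2 := hS1 (fib H F c)
      have h3 := Finset.card_le_card (hsub c)
      omega
    have h4 := Finset.sum_le_sum fun c (_ : c ∈ Finset.univ) => hc c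
    rw [Finset.sum_add_distrib, Finset.sum_add_distrib, ← card_eq_sum_fib_univ, ← Finset.mul_sum,
      ← card_eq_sum_fib_univ, Finset.sum_const, Finset.card_univ, ← Nat.card_eq_fintype_card,
      smul_eq_mul, ← Finset.card_filter] at h4
    exact h4

theorem univ_eq (D : PairConfig S T H μ d) (hq : Nat.card (G ⧸ H) = 3) (b : G ⧸ H) :
    (Finset.univ : Finset (G ⧸ H)) = {b, d + b, d + (d + b)} ∧ b ≠ d + b ∧ b ≠ d + (d + b) ∧
      d + (d + (d + b)) = b := by
  have ho : addOrderOf d = 3 := by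
    rw [← Nat.card_zmultiples, D.zmultiples_eq, ← hq]
    exact Nat.card_congr AddSubgroup.topEquiv.toEquiv
  have h2 : d + d ≠ 0 := by
    intro h
    have : addOrderOf d ∣ 2 := addOrderOf_dvd_of_nsmul_eq_zero (by rw [two_nsmul, h])
    rw [ho] at this
    omega
  have h3 : d + (d + d) = 0 := by
    have := addOrderOf_nsmul_eq_zero d
    rwa [ho, succ_nsmul, two_nsmul, add_assoc] at this
  have e1 : b ≠ d + b := fun h => D.ne_zero (by simpa using h)
  have e2 : b ≠ d + (d + b) := fun h => h2 (by
    rw [← add_assoc] at h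
    simpa using h)
  have e3 : d + b ≠ d + (d + b) := fun h => D.ne_zero (by simpa using h)
  have e4 : b ∉ ({d + b, d + (d + b)} : Finset (G ⧸ H)) := by
    rw [Finset.mem_insert, Finset.mem_singleton, not_or]
    exact ⟨e1, e2⟩
  refine ⟨(Finset.eq_of_subset_of_card_le (Finset.subset_univ _) ?_).symm, e1, e2, ?_⟩
  · rw [Finset.card_univ, ← Nat.card_eq_fintype_card, hq, Finset.card_insert_of_notMem e4,
      Finset.card_pair e3]
  · rw [← add_assoc d d b, ← add_assoc, h3, zero_add]

theorem sum_univ (D : PairConfig S T H μ d) (hq : Nat.card (G ⧸ H) = 3) (b : G ⧸ H)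
    (f : G ⧸ H → ℕ) : ∑ c, f c = f b + f (d + b) + f (d + (d + b)) := by
  obtain ⟨h1, h2, h3, -⟩ := D.univ_eq hq b
  have h4 : b ∉ ({d + b, d + (d + b)} : Finset (G ⧸ H)) := by
    rw [Finset.mem_insert, Finset.mem_singleton, not_or]
    exact ⟨h2, h3⟩
  rw [h1, Finset.sum_insert h4, Finset.sum_pair fun h => D.ne_zero (by simpa using h), add_assoc]

/-- The shape of `T` in the exceptional case. -/
def Exceptional (T : Finset G) (H : AddSubgroup G) [DecidableEq (G ⧸ H)] (d : G ⧸ H) : Prop :=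
  Nat.card (G ⧸ H) = 3 ∧ Nat.card H = 4 ∧ ∃ b : G ⧸ H, (fib H T b).card = 2 ∧
    (fib H T (d + b)).card = 1 ∧ (fib H T (d + (d + b))).card = 1

/-- The offending fibre of T is a single point, so S splits as in `exists_translate`. Comparing the
bound from F with the size hypothesis leaves little room: many fibres of F must be singletons, yet T
is not made of singletons only. -/
theorem exceptional_of_irregular (D : PairConfig S T H μ d) {b : G ⧸ H}
    (hb : (fib H (S + T) b).card + (fib H (S + T) (d + b)).card < Nat.card H + (fib H T b).card) :
    Exceptional T H d := by
  have hfin := D.finite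
  have hS := D.card_left_eq
  have hμ := D.mu_eq_zero
  have hq3 := D.three_le
  have htb : (fib H T b).card = 1 := by
    have := D.pair_le T (D.mem_img_right b)
    split_ifs at this <;> omega
  obtain ⟨hs0, e, he, hS1⟩ := D.exists_translate hS D.mem_img_right htb (by omega)
  obtain ⟨F, hTF, heF, hFT, hF⟩ := D.exists_superset he hS1
  have hcl := D.card_left
  have hle := D.card_le
  have hadd := D.card_add
  have hsize := D.size'
  have htpos : ∀ c, 0 < (fib H T c).card := fun c => card_fib_pos.2 (D.mem_img_right c)
  have ht0 : ∀ c, (fib H T c).card ≤ (fib H F c).card := fun c =>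
    Finset.card_le_card fun x hx => mem_fib.2 ⟨hTF (mem_fib.1 hx).1, (mem_fib.1 hx).2⟩
  have ht1 : ∀ c, (fib H T c).card ≤ (fib H F (d + c)).card := by
    intro c
    rw [← Finset.card_vadd_finset e (fib H T c)]
    refine Finset.card_le_card fun x hx => ?_
    rw [mem_vadd_iff, mem_fib] at hx
    refine mem_fib.2 ⟨by simpa using heF _ hx.1, ?_⟩
    have h1 : x = e + (x - e) := by abel
    rw [h1, QuotientAddGroup.mk_add, hx.2, he]
  have hTs := card_eq_sum_fib_univ (H := H) T
  have hFs := card_eq_sum_fib_univ (H := H) F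
  set N := Finset.univ.filter fun c => (fib H F c).card = 1 with hN
  have hNm : ∀ c, c ∈ N ↔ (fib H F c).card = 1 := fun c => by simp [hN]
  have hcompl := Finset.card_compl_add_card N
  rw [← Nat.card_eq_fintype_card] at hcompl
  have hTone : ¬ ∀ c, (fib H T c).card = 1 := by
    intro h
    have hT : T.card = Nat.card (G ⧸ H) := by
      rw [hTs, Finset.sum_congr rfl fun c _ => h c, Finset.sum_const, Finset.card_univ,
        Nat.card_eq_fintype_card, smul_eq_mul, mul_one]
    obtain ⟨q, hq⟩ := Nat.exists_eq_add_of_le hq3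
    obtain ⟨k, hk⟩ : ∃ k, Nat.card H = 4 + k := ⟨Nat.card H - 4, by omega⟩
    have hNc : N.card + 1 ≤ Nat.card (G ⧸ H) := by
      by_contra hlt
      have hNe : N = Finset.univ := by
        rw [← Finset.card_eq_iff_eq_univ, ← Nat.card_eq_fintype_card]; omega
      have : F.card = Nat.card (G ⧸ H) := by
        rw [hFs, Finset.sum_congr rfl fun c _ => (hNm c).1 (hNe ▸ Finset.mem_univ c),
          Finset.sum_const, Finset.card_univ, Nat.card_eq_fintype_card, smul_eq_mul, mul_one]
      omega
    have h1 : Nat.card (G ⧸ H) * Nat.card H = 12 + 3 * k + 4 * q + q * k := by rw [hq, hk]; ring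
    rw [h1] at hF hsize
    omega
  -- F contains T and e + T, so a singleton fibre of F at c or at d + c makes the fibre of T at c a
  -- singleton.
  have hNle : N.card + 2 ≤ Nat.card (G ⧸ H) := by
    by_contra hlt
    refine hTone fun c => ?_
    by_cases hc : c ∈ N
    · have := ht0 c
      have := htpos c
      rw [hNm] at hc
      omega
    · have hc1 : d + c ∈ N := by
        by_contra hc'
        have h1 : ({c, d + c} : Finset (G ⧸ H)) ⊆ Nᶜ := by
          intro x hx
          rw [Finset.mem_insert, Finset.mem_singleton] at hx
          rcases hx with rfl | rfl <;> rw [Finset.mem_compl] <;> assumption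
        have h2 := Finset.card_le_card h1
        rw [Finset.card_pair fun h => D.ne_zero (by simpa using h)] at h2
        omega
      have := ht1 c
      have := htpos c
      rw [hNm] at hc1
      omega
  have hq : Nat.card (G ⧸ H) = 3 := by
    by_contra hne
    obtain ⟨q, hq⟩ : ∃ q, Nat.card (G ⧸ H) = 4 + q := ⟨Nat.card (G ⧸ H) - 4, by omega⟩
    obtain ⟨k, hk⟩ : ∃ k, Nat.card H = 4 + k := ⟨Nat.card H - 4, by omega⟩
    have h1 : Nat.card (G ⧸ H) * Nat.card H = 16 + 4 * k + 4 * q + q * k := by rw [hq, hk]; ring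
    rw [h1] at hF hsize
    omega
  rw [hq] at hF hsize hNle
  obtain ⟨c, hc⟩ : N.Nonempty := Finset.card_pos.1 (by omega)
  rw [hNm] at hc
  obtain ⟨-, -, -, hd3⟩ := D.univ_eq hq c
  have hT3 := D.sum_univ hq c fun c => (fib H T c).card
  have hF3 := D.sum_univ hq c fun c => (fib H F c).card
  have e1 := ht0 c
  have e2 := ht1 (d + (d + c))
  have e3 := ht0 (d + c)
  have e4 := ht1 (d + c)
  rw [hd3] at e2
  have e5 := htpos c
  have e6 := htpos (d + (d + c))
  refine ⟨hq, by omega, d + c, by omega, by omega, by rw [hd3]; omega⟩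

end PairConfig

end SmallSum

/-! ### The regular case -/

namespace SmallSum

namespace PairConfig

variable {G : Type*} [AddCommGroup G] [DecidableEq G]
  {S T : Finset G} {H : AddSubgroup G} [DecidableEq (G ⧸ H)] {μ : ℕ} {d : G ⧸ H}
  [Fintype (G ⧸ H)]

/-- Numerical description of the regular case. -/
structure Regular (S T : Finset G) (H : AddSubgroup G) [DecidableEq (G ⧸ H)] (d : G ⧸ H) :
    Prop where
  card_quotient : Nat.card (G ⧸ H) = 3
  card_left : S.card = Nat.card H
  card_right : T.card = Nat.card H
  card_add : (S + T).card = 2 * Nat.card H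
  card_fib_eq : ∀ c, (fib H T c).card = defect H (S + T) (d + (d + c))
  card_zero_le : ∀ c, (fib H S 0).card + defect H (S + T) c ≤ Nat.card H
  card_le : ∀ c, (fib H S d).card + defect H (S + T) c ≤ Nat.card H
  card_fib_add : ∀ c, (fib H T c).card + defect H (S + T) c + defect H (S + T) (d + c) = Nat.card H
  zero_add : ∀ c, 2 ≤ (fib H T c).card →
    (fib H S 0 + fib H T c).card = (fib H (S + T) c).card
  add : ∀ c, 2 ≤ (fib H T c).card →
    (fib H S d + fib H T c).card = (fib H (S + T) (d + c)).card

theorem regular' (D : PairConfig S T H μ d)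
    (hreg : ∀ c, Nat.card H + (fib H T c).card ≤
      (fib H (S + T) c).card + (fib H (S + T) (d + c)).card) : Regular S T H d := by
  have hfin := D.finite
  obtain ⟨hsum, ht⟩ := D.regular hreg
  have hS := D.card_left_eq
  have hμ := D.mu_eq_zero
  have hsize := D.size'
  have hadd := D.card_add
  have hcl := D.card_left
  have hq : Nat.card (G ⧸ H) = 3 := by
    obtain ⟨r, hr⟩ := Nat.exists_eq_add_of_le D.three_le
    have h1 : Nat.card (G ⧸ H) * Nat.card H = 3 * Nat.card H + r * Nat.card H := by
      rw [hr, add_mul]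
    rw [h1] at hsum hsize
    have h2 : r * Nat.card H = 0 := by omega
    rcases Nat.mul_eq_zero.1 h2 with h | h <;> omega
  rw [hq] at hsum
  have hY := sum_defect_univ (H := H) (S + T)
  rw [hq] at hY
  have hx0 := fun c => card_zero_le (S := S) T (D.mem_img_right c)
  have hx1 := fun c => card_le_of_sub_mem (S := S) (d := d) (c := c) T (D.mem_img_right _)
  have hfd := fib_add_defect (H := H) (S + T)
  have hexact : ∀ c, 2 ≤ (fib H T c).card →
      (fib H S 0 + fib H T c).card = (fib H (S + T) c).card ∧
      (fib H S d + fib H T c).card = (fib H (S + T) (d + c)).card := by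
    intro c hc
    have h1 := D.card_add_le (P := fib H T c) (fun x hx => (mem_fib.1 hx).2) hc
    have h2 := Finset.card_le_card (zero_add_subset (S := S) T c)
    have h3 := Finset.card_le_card (fib_add_subset (H := H) (X := S) (Y := T) d c)
    have h4 := ht c
    have h5 := hfd c
    have h6 := hfd (d + c)
    omega
  refine ⟨hq, hS, by omega, by omega, fun c => ?_, fun c => ?_, fun c => ?_, ht,
    fun c hc => (hexact c hc).1, fun c hc => (hexact c hc).2⟩
  · have h1 := D.sum_univ hq c (defect H (S + T))
    have h2 := ht c
    omega
  · have h1 := hfd c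
    have h2 := hx0 c
    omega
  · have h1 := hfd c
    have h2 := hx1 c
    omega

/-- For h ≥ 5 one fibre of S is a coset of a subgroup by `card_add_le_or_ge`, while its sum with
another fibre of T has size strictly between once and twice its own. -/
theorem Regular.exceptional (R : Regular S T H d) (D : PairConfig S T H μ d) {b : G ⧸ H}
    (hb : (fib H T b).card = 1) : Exceptional T H d := by
  have hfin := D.finite
  have h4 := D.card_right
  have hμ := D.mu_eq_zero
  have hTh := R.card_right
  obtain ⟨-, -, -, hd3⟩ := D.univ_eq R.card_quotient b
  have ht0 := R.card_fib_eq b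
  have ht1 := R.card_fib_eq (d + b)
  have ht2 := R.card_fib_eq (d + (d + b))
  rw [hd3] at ht1 ht2
  have hsum := R.card_fib_add b
  have hy0 := R.card_zero_le b
  have hy0' := R.card_le b
  have hy1 := R.card_zero_le (d + b)
  have hy1' := R.card_le (d + b)
  have hs := D.card_fib_add_card_fib'
  rw [R.card_left] at hs
  by_cases hh : Nat.card H = 4
  · by_cases h2 : (fib H T (d + b)).card = 2
    · exact ⟨R.card_quotient, hh, d + b, h2, by omega, by rw [hd3]; exact hb⟩
    · refine ⟨R.card_quotient, hh, d + (d + b), by omega, by rw [hd3]; exact hb, ?_⟩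
      rw [hd3]
      omega
  exfalso
  have hx := fib_add_defect (H := H) (S + T)
  have hx0 := hx b
  have hx1 := hx (d + b)
  have hx2 := hx (d + (d + b))
  have e1 := R.zero_add (d + (d + b)) (by omega)
  have e2 := R.add (d + (d + b)) (by omega)
  have e3 := R.zero_add (d + b) (by omega)
  have e4 := R.add (d + b) (by omega)
  rw [hd3] at e2
  have n1 : (fib H T (d + b)).Nonempty := fib_nonempty_iff.2 (D.mem_img_right _)
  have n2 : (fib H T (d + (d + b))).Nonempty := fib_nonempty_iff.2 (D.mem_img_right _)
  have hcase : ((fib H S 0 + fib H T (d + b)).card ≤ (fib H S 0).card ∧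
      (fib H S 0).card ≤ (fib H T (d + b)).card + 1 ∧ 3 ≤ (fib H S 0).card ∧
      (fib H S 0).card < (fib H S 0 + fib H T (d + (d + b))).card ∧
      (fib H S 0 + fib H T (d + (d + b))).card < 2 * (fib H S 0).card) ∨
      ((fib H S d + fib H T (d + (d + b))).card ≤ (fib H S d).card ∧
      (fib H S d).card ≤ (fib H T (d + (d + b))).card + 1 ∧ 3 ≤ (fib H S d).card ∧
      (fib H S d).card < (fib H S d + fib H T (d + b)).card ∧
      (fib H S d + fib H T (d + b)).card < 2 * (fib H S d).card) := by
    omega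
  rcases hcase with ⟨c1, c2, c3, c4, c5⟩ | ⟨c1, c2, c3, c4, c5⟩
  · have := card_add_le_or_ge c1 c2 c3 n2
    omega
  · have := card_add_le_or_ge c1 c2 c3 n1
    omega

/-- A bound for the sum of `S` with the intersection of `T` and a translate of `T`. -/
theorem Regular.card_add_inter_le (R : Regular S T H d) (D : PairConfig S T H μ d) {g : G}
    {W : Finset G} (hW : W = T ∩ (g +ᵥ T)) (hne : W.Nonempty) :
    (S + W).card ≤ Nat.card H + W.card := by
  have hfin := D.finite
  have hG := D.toConfig.finite_group
  have hFG := Fintype.ofFinite G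
  have h1 := Finset.card_union_add_card_inter T (g +ᵥ T)
  rw [Finset.card_vadd_finset, ← hW] at h1
  have h2 := Finset.card_union_add_card_inter (S + T) (g +ᵥ (S + T))
  rw [Finset.card_vadd_finset] at h2
  have h3 : S + W ⊆ (S + T) ∩ (g +ᵥ (S + T)) := by
    intro x hx
    obtain ⟨s, hs, w, hw, rfl⟩ := Finset.mem_add.1 hx
    rw [hW, Finset.mem_inter, mem_vadd_iff] at hw
    rw [Finset.mem_inter, mem_vadd_iff]
    exact ⟨Finset.add_mem_add hs hw.1, Finset.mem_add.2 ⟨s, hs, _, hw.2, by abel⟩⟩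
  have h4 : (T ∪ (g +ᵥ T)) + S ⊆ (S + T) ∪ (g +ᵥ (S + T)) := by
    intro x hx
    obtain ⟨f, hf, s, hs, rfl⟩ := Finset.mem_add.1 hx
    rcases Finset.mem_union.1 hf with h | h
    · exact Finset.mem_union_left _ (Finset.mem_add.2 ⟨s, hs, f, h, add_comm _ _⟩)
    · rw [mem_vadd_iff] at h
      refine Finset.mem_union_right _ ?_
      rw [mem_vadd_iff]
      exact Finset.mem_add.2 ⟨s, hs, _, h, by abel⟩
  have h5 := Finset.card_le_card h3
  have h6 := Finset.card_le_card h4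
  have h7 := R.card_right
  have h8 := R.card_add
  have h9 := Finset.card_pos.2 hne
  have h10 := Finset.card_le_card (Finset.subset_union_left (s₁ := T) (s₂ := g +ᵥ T))
  have h11 := D.data.two_le
  -- If the sum misses at most one element, it has at least 3h - 1 ≥ |T ∪ (g + T)| + h elements
  -- anyway, because W is nonempty.
  by_cases hout : TwoOut ((T ∪ (g +ᵥ T)) + S)
  · have h12 := D.data.le_card_add (T ∪ (g +ᵥ T)) (by omega) hout
    rw [D.card_img_left] at h12
    omega
  · have h12 := card_le_of_not_twoOut hout
    rw [← Nat.card_eq_fintype_card, Config.card_group H, R.card_quotient] at h12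
    omega

/-- The hyper-atom inequality on one fibre of W already accounts for nearly all of S + W, so an
outer fibre of the sum has no more elements than the other fibre of W. This conflicts with the sizes
of the fibres of T. -/
theorem Regular.false_of_two_cosets (R : Regular S T H d) (D : PairConfig S T H μ d)
    (h2 : ∀ c, 2 ≤ (fib H T c).card) {W : Finset G} (hWT : W ⊆ T)
    (hle : (S + W).card ≤ Nat.card H + W.card) {j : G ⧸ H} (hj : j ∈ img H W)
    (hj' : d + j ∈ img H W) (hj'' : d + (d + j) ∉ img H W) : False := by
  have hfin := D.finite
  have hW3 := D.sum_univ R.card_quotient j fun c => (fib H W c).card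
  rw [← card_eq_sum_fib_univ] at hW3
  have hX3 := D.sum_univ R.card_quotient j fun c => (fib H (S + W) c).card
  rw [← card_eq_sum_fib_univ] at hX3
  have hT3 := D.sum_univ R.card_quotient j fun c => (fib H T c).card
  rw [← card_eq_sum_fib_univ] at hT3
  rw [← card_fib_pos, Nat.pos_iff_ne_zero, not_not] at hj''
  have hTh := R.card_right
  have a0 := h2 j
  have a1 := h2 (d + j)
  have a2 := h2 (d + (d + j))
  obtain ⟨-, -, -, hd3⟩ := D.univ_eq R.card_quotient j
  have p0 := card_fib_pos.2 hj
  have p1 := card_fib_pos.2 hj'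
  have b0 := Finset.card_le_card (zero_add_subset (S := S) W j)
  have b1 := Finset.card_le_card (fib_add_subset (H := H) (X := S) (Y := W) d j)
  have b2 := Finset.card_le_card (zero_add_subset (S := S) W (d + j))
  have b3 := Finset.card_le_card (fib_add_subset (H := H) (X := S) (Y := W) d (d + j))
  have s0 := Finset.card_le_card_add_right (s := fib H S 0) (fib_nonempty_iff.2 hj)
  have s1 := Finset.card_le_card_add_right (s := fib H S d) (fib_nonempty_iff.2 hj)
  have s2 := Finset.card_le_card_add_right (s := fib H S 0) (fib_nonempty_iff.2 hj')
  have s3 := Finset.card_le_card_add_right (s := fib H S d) (fib_nonempty_iff.2 hj')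
  have hs := D.card_fib_add_card_fib'
  rw [R.card_left] at hs
  have ht0 := R.card_fib_eq j
  have ht1 := R.card_fib_eq (d + j)
  rw [hd3] at ht1
  have hy0 := R.card_zero_le j
  have hy0' := R.card_le j
  have hy2 := R.card_zero_le (d + (d + j))
  have hy2' := R.card_le (d + (d + j))
  have hsub : fib H W (d + j) ⊆ fib H T (d + j) := fun x hx =>
    mem_fib.2 ⟨hWT (mem_fib.1 hx).1, (mem_fib.1 hx).2⟩
  have hWt := Finset.card_le_card hsub
  rcases Nat.lt_or_ge (fib H W j).card 2 with h | h
  · rcases Nat.lt_or_ge (fib H W (d + j)).card 2 with h' | h'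
    · omega
    · have := D.card_add_le (P := fib H W (d + j)) (fun x hx => (mem_fib.1 hx).2) h'
      omega
  · have e1 := D.card_add_le (P := fib H W j) (fun x hx => (mem_fib.1 hx).2) h
    have e2 : fib H W (d + j) = fib H T (d + j) :=
      Finset.eq_of_subset_of_card_le hsub (by omega)
    have e3 := R.add (d + j) a1
    rw [← e2] at e3
    have e4 := fib_add_defect (H := H) (S + T) (d + (d + j))
    have e5 : (fib H W (d + j)).card = (fib H T (d + j)).card := by rw [e2]
    omega

/-- Summing the pair inequality over the three cosets forces equality everywhere. A singleton fibre
of W then contradicts `exists_superset`; without one, W = T and g is a period. -/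
theorem Regular.false_of_all_cosets (R : Regular S T H d) (D : PairConfig S T H μ d)
    (h2 : ∀ c, 2 ≤ (fib H T c).card) {g : G} (hg : (g : G ⧸ H) = d)
    {W : Finset G} (hW : W = T ∩ (g +ᵥ T))
    (hle : (S + W).card ≤ Nat.card H + W.card) (hall : ∀ c, c ∈ img H W) : False := by
  have hfin := D.finite
  have hWT : W ⊆ T := by rw [hW]; exact Finset.inter_subset_left
  have hwt : ∀ c, (fib H W c).card + (if (fib H W c).card = 1 then 1 else 0) ≤
      (fib H T c).card := by
    intro c
    have h1 : (fib H W c).card ≤ (fib H T c).card := Finset.card_le_card fun x hx =>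
      mem_fib.2 ⟨hWT (mem_fib.1 hx).1, (mem_fib.1 hx).2⟩
    have := h2 c
    split_ifs <;> omega
  have hpair := fun c => D.pair_le W (hall c)
  have s1 := Finset.sum_le_sum fun c (_ : c ∈ Finset.univ) => hwt c
  have s2 := Finset.sum_le_sum fun c (_ : c ∈ Finset.univ) => hpair c
  have e1 : ∑ c : G ⧸ H, (Nat.card H + (fib H W c).card) = 3 * Nat.card H + W.card := by
    rw [Finset.sum_add_distrib, ← card_eq_sum_fib_univ, Finset.sum_const, Finset.card_univ,
      ← Nat.card_eq_fintype_card, R.card_quotient, smul_eq_mul]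
  rw [Finset.sum_add_distrib, ← card_eq_sum_fib_univ, ← card_eq_sum_fib_univ] at s1
  rw [e1, Finset.sum_add_distrib, sum_pair_eq] at s2
  have hTh := R.card_right
  by_cases hone : ∃ j, (fib H W j).card = 1
  · obtain ⟨j, hj⟩ := hone
    have h3 := (Finset.sum_eq_sum_iff_of_le fun c (_ : c ∈ Finset.univ) => hpair c).1
      (by rw [e1, Finset.sum_add_distrib, sum_pair_eq]; omega) j (Finset.mem_univ _)
    rw [if_pos hj] at h3
    obtain ⟨-, e, he, hS1⟩ := D.exists_translate R.card_left hall hj (by omega)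
    obtain ⟨F, hTF, -, hFT, hF⟩ := D.exists_superset he hS1
    have h4 : (Finset.univ.filter fun c => (fib H F c).card = 1) = ∅ := by
      refine Finset.filter_eq_empty_iff.2 fun c _ h => ?_
      have h5 : (fib H T c).card ≤ (fib H F c).card := Finset.card_le_card fun x hx =>
        mem_fib.2 ⟨hTF (mem_fib.1 hx).1, (mem_fib.1 hx).2⟩
      have := h2 c
      omega
    rw [h4, Finset.card_empty, R.card_quotient, R.card_add] at hF
    omega
  · push Not at hone
    have h3 : ∑ c : G ⧸ H, (if (fib H W c).card = 1 then 1 else 0) = 0 :=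
      Finset.sum_eq_zero fun c _ => if_neg (hone c)
    have h4 : W = T := Finset.eq_of_subset_of_card_le hWT (by omega)
    have h5 : -g = 0 := by
      refine D.aper.eq_zero fun x hx => ?_
      obtain ⟨s, hs, t, ht, rfl⟩ := Finset.mem_add.1 hx
      rw [← h4, hW, Finset.mem_inter, mem_vadd_iff] at ht
      exact Finset.mem_add.2 ⟨s, hs, _, ht.2, by abel⟩
    refine D.ne_zero ?_
    rw [← hg, neg_eq_zero.1 h5]; rfl

/-- A difference g shared by two pairs of consecutive fibres would make T ∩ (g + T) meet at least
two cosets. -/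
theorem Regular.sub_ne_sub (R : Regular S T H d) (D : PairConfig S T H μ d)
    (h2 : ∀ c, 2 ≤ (fib H T c).card) {j k : G ⧸ H} (hjk : j ≠ k) {g : G} (hg : (g : G ⧸ H) = d)
    {τ τ' : G} (hτ : τ ∈ fib H T (d + j)) (hτg : τ - g ∈ T) (hτ' : τ' ∈ fib H T (d + k))
    (hτg' : τ' - g ∈ T) : False := by
  obtain ⟨W, hW⟩ : ∃ W, W = T ∩ (g +ᵥ T) := ⟨_, rfl⟩
  have hWT : W ⊆ T := by rw [hW]; exact Finset.inter_subset_left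
  have hWm : ∀ x, x ∈ T → x - g ∈ T → x ∈ W := by
    intro x hx hx'
    rw [hW, Finset.mem_inter, mem_vadd_iff]
    exact ⟨hx, hx'⟩
  have hj : d + j ∈ img H W :=
    mem_img.2 ⟨τ, hWm _ (mem_fib.1 hτ).1 hτg, (mem_fib.1 hτ).2⟩
  have hk : d + k ∈ img H W :=
    mem_img.2 ⟨τ', hWm _ (mem_fib.1 hτ').1 hτg', (mem_fib.1 hτ').2⟩
  have hle := R.card_add_inter_le D hW ⟨τ, hWm _ (mem_fib.1 hτ).1 hτg⟩
  by_cases hall : ∀ c, c ∈ img H W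
  · exact R.false_of_all_cosets D h2 hg hW hle hall
  · push Not at hall
    obtain ⟨c, hc⟩ := hall
    obtain ⟨hu, -, -, hd3⟩ := D.univ_eq R.card_quotient c
    have h1 : ∀ x ∈ img H W, x = d + c ∨ x = d + (d + c) := by
      intro x hx
      have h3 := Finset.mem_univ x
      rw [hu, Finset.mem_insert, Finset.mem_insert, Finset.mem_singleton] at h3
      rcases h3 with rfl | h | h
      · exact absurd hx hc
      · exact Or.inl h
      · exact Or.inr h
    have hdd : ∀ x y : G ⧸ H, x ∈ img H W → y ∈ img H W → x = d + c → y = d + (d + c) → False := by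
      rintro x y hx hy rfl rfl
      exact R.false_of_two_cosets D h2 hWT hle hx hy (by rwa [hd3])
    have hne : d + j ≠ d + k := fun h => hjk (add_left_cancel h)
    rcases h1 _ hj with h | h <;> rcases h1 _ hk with h' | h'
    · exact hne (h.trans h'.symm)
    · exact hdd _ _ hj hk h h'
    · exact hdd _ _ hk hj h' h
    · exact hne (h.trans h'.symm)

/-- The difference sets E c of consecutive fibres are disjoint inside one coset, so their sizes add
up to at most h = |T|. Hence each E c is only as large as the fibre over d + c, which is stable
under differences of the fibre over c. A nonzero difference then travels around G/H and becomes a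
period. -/
theorem Regular.false_of_two_le (R : Regular S T H d) (D : PairConfig S T H μ d)
    (h2 : ∀ c, 2 ≤ (fib H T c).card) : False := by
  have hfin := D.finite
  set E : G ⧸ H → Finset G := fun c => fib H T (d + c) + -fib H T c with hE
  have hEd : ∀ c, ∀ x ∈ E c, ∃ σ ∈ fib H T (d + c), ∃ τ ∈ fib H T c, x = σ - τ := by
    intro c x hx
    obtain ⟨σ, hσ, τ, hτ, rfl⟩ := Finset.mem_add.1 hx
    rw [Finset.mem_neg'] at hτ
    exact ⟨σ, hσ, -τ, hτ, by abel⟩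
  have hEcos : ∀ c, E c ⊆ cos H d := by
    intro c x hx
    obtain ⟨σ, hσ, τ, hτ, rfl⟩ := hEd c x hx
    rw [mem_cos, QuotientAddGroup.mk_sub, (mem_fib.1 hσ).2, (mem_fib.1 hτ).2,
      add_sub_cancel_right]
  have hEdisj : (Finset.univ.biUnion E).card = ∑ c, (E c).card := by
    refine Finset.card_biUnion fun j _ k _ hjk => ?_
    rw [Function.onFun, Finset.disjoint_left]
    intro x hx hx'
    obtain ⟨σ, hσ, τ, hτ, h⟩ := hEd j x hx
    obtain ⟨σ', hσ', τ', hτ', h'⟩ := hEd k x hx'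
    refine R.sub_ne_sub D h2 hjk (mem_cos.1 (hEcos j hx)) hσ ?_ hσ' ?_
    · rw [h, sub_sub_cancel]; exact (mem_fib.1 hτ).1
    · rw [h', sub_sub_cancel]; exact (mem_fib.1 hτ').1
  have hEsum : ∑ c, (E c).card ≤ Nat.card H := by
    rw [← hEdisj, ← card_cos d]
    exact Finset.card_le_card (Finset.biUnion_subset.2 fun c _ => hEcos c)
  have hge : ∀ c, (fib H T (d + c)).card ≤ (E c).card := fun c =>
    Finset.card_le_card_add_right (Finset.Nonempty.neg
      (fib_nonempty_iff.2 (D.mem_img_right c)))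
  have hTsum : ∑ c, (fib H T (d + c)).card = Nat.card H := by
    rw [sum_shift d fun c => (fib H T c).card, ← card_eq_sum_fib_univ, R.card_right]
  have heq : ∀ c, (fib H T (d + c)).card = (E c).card := fun c =>
    (Finset.sum_eq_sum_iff_of_le fun c (_ : c ∈ Finset.univ) => hge c).1
      (le_antisymm (Finset.sum_le_sum fun c _ => hge c) (by rw [hTsum]; exact hEsum)) c
      (Finset.mem_univ _)
  have hstab : ∀ c, ∀ τ ∈ fib H T c, ∀ τ' ∈ fib H T c, ∀ σ ∈ fib H T (d + c),
      σ + (τ - τ') ∈ fib H T (d + c) := by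
    intro c τ hτ τ' hτ' σ hσ
    have h1 := add_sub_mem_of_card_le (P := fib H T (d + c)) (X := E c) (τ := -τ') (τ' := -τ)
      (fun σ hσ => Finset.add_mem_add hσ (by rwa [Finset.mem_neg', neg_neg]))
      (fun σ hσ => Finset.add_mem_add hσ (by rwa [Finset.mem_neg', neg_neg])) (heq c).ge σ hσ
    rwa [neg_sub_neg] at h1
  obtain ⟨τ, hτ, τ', hτ', hne⟩ := Finset.one_lt_card.1 (h2 0)
  have hall : ∀ c, ∃ σ ∈ fib H T c, ∃ σ' ∈ fib H T c, σ - σ' = τ - τ' := by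
    refine D.forall_of_step (c := 0) ⟨τ, hτ, τ', hτ', rfl⟩ fun c => ?_
    rintro ⟨σ, hσ, σ', hσ', h⟩
    obtain ⟨ρ, hρ⟩ := fib_nonempty_iff.2 (D.mem_img_right (d + c))
    refine ⟨_, hstab c σ hσ σ' hσ' ρ hρ, ρ, hρ, ?_⟩
    rw [add_sub_cancel_left, h]
  refine hne (sub_eq_zero.1 (D.aper.eq_zero fun x hx => ?_))
  obtain ⟨s, hs, t, ht, rfl⟩ := Finset.mem_add.1 hx
  obtain ⟨σ, hσ, σ', hσ', h⟩ := hall ((t : G ⧸ H) - d)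
  have h1 := hstab _ σ hσ σ' hσ' t (mem_fib.2 ⟨ht, (add_sub_cancel d _).symm⟩)
  rw [h] at h1
  exact Finset.mem_add.2 ⟨s, hs, _, (mem_fib.1 h1).1, by abel⟩

theorem exceptional (D : PairConfig S T H μ d) : Exceptional T H d := by
  by_cases hirr : ∃ b, (fib H (S + T) b).card + (fib H (S + T) (d + b)).card <
      Nat.card H + (fib H T b).card
  · obtain ⟨b, hb⟩ := hirr
    exact D.exceptional_of_irregular hb
  · push Not at hirr
    have R := D.regular' hirr
    by_cases hone : ∃ b, (fib H T b).card = 1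
    · obtain ⟨b, hb⟩ := hone
      exact R.exceptional D hb
    · push Not at hone
      refine (R.false_of_two_le D fun c => ?_).elim
      have := card_fib_pos.2 (D.mem_img_right c)
      have := hone c
      omega

end PairConfig

end SmallSum

/-! ### The exceptional group of order 12 -/

namespace SmallSum

section Progression

variable {G : Type*} [AddCommGroup G] [DecidableEq G]

/-- Each of the last n - 1 terms adds an element to any admissible sum, and X = {0, e} attains this
bound; |G| ≥ n + 3 makes it admissible. -/
theorem kappa_two_prog [Fintype G] {a e : G} {n : ℕ} (hn : 2 ≤ n) (h0 : (0 : G) ∈ prog a e n)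
    (he : AddSubgroup.zmultiples e = ⊤) (hG : n + 3 ≤ Fintype.card G) :
    kappa 2 (prog a e n) = n - 1 := by
  have he0 : e ≠ 0 := by
    rintro rfl
    rw [AddSubgroup.zmultiples_zero_eq_bot] at he
    have : Fintype.card G ≤ 1 := by
      rw [Fintype.card_le_one_iff]
      intro x y
      have hx : x ∈ (⊤ : AddSubgroup G) := trivial
      have hy : y ∈ (⊤ : AddSubgroup G) := trivial
      rw [← he, AddSubgroup.mem_bot] at hx hy
      rw [hx, hy]
    omega
  have hall : ∀ Y : Finset G, 2 ≤ Y.card → TwoOut (Y + prog a e n) →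
      Y.card + (n - 1) ≤ (Y + prog a e n).card := by
    intro Y hY hout
    obtain ⟨p, -, -, hp, -⟩ := hout
    have := card_add_prog_ge (B := Y) (a := a) le_rfl (by omega) (Finset.card_pos.1 (by omega)) he
      ⟨p, hp⟩
    rwa [add_prog_one, Finset.card_vadd_finset] at this
  have hle : (({0, e} : Finset G) + prog a e n).card ≤ n + 1 := by
    refine (Finset.card_le_card (t := prog a e (n + 1)) fun x hx => ?_).trans (card_prog_le _ _ _)
    obtain ⟨y, hy, z, hz, rfl⟩ := Finset.mem_add.1 hx
    obtain ⟨i, hi, rfl⟩ := mem_prog.1 hz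
    rw [Finset.mem_insert, Finset.mem_singleton] at hy
    rcases hy with rfl | rfl
    · exact mem_prog.2 ⟨i, by omega, by rw [zero_add]⟩
    · exact mem_prog.2 ⟨i + 1, by omega, by rw [succ_nsmul]; abel⟩
  have hc2 : ({0, e} : Finset G).card = 2 := Finset.card_pair he0.symm
  have hout : TwoOut (({0, e} : Finset G) + prog a e n) := twoOut_of_card (by omega)
  refine kappa_eq_of_forall h0 hc2.ge hout ?_ hall
  have := hall _ hc2.ge hout
  omega

end Progression

namespace PairConfig

variable {G : Type*} [AddCommGroup G] [DecidableEq G]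
  {S T : Finset G} {H : AddSubgroup G} [DecidableEq (G ⧸ H)] {μ : ℕ} {d : G ⧸ H}
  [Fintype (G ⧸ H)]

theorem exceptional_shift (D : PairConfig S T H μ d) {b : G ⧸ H} (hq : Nat.card (G ⧸ H) = 3)
    (hh : Nat.card H = 4)
    (hb : (fib H T b).card = 2) (hb1 : (fib H T (d + b)).card = 1)
    (hb2 : (fib H T (d + (d + b))).card = 1) :
    T.card = 4 ∧ (fib H S 0).card = 2 ∧ (fib H S 0 + fib H T b).card = 3 ∧
    (fib H (S + T) b).card = 3 ∧ (fib H (S + T) (d + b)).card = 3 ∧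
    ∃ p e : G, fib H T (d + b) = {p} ∧ fib H T (d + (d + b)) = {p + e} ∧
      ∀ x, x ∈ fib H S d ↔ x - e ∈ fib H S 0 := by
  have hfin := D.finite
  obtain ⟨-, -, -, hd3⟩ := D.univ_eq hq b
  have hT := D.sum_univ hq b fun c => (fib H T c).card
  have hX := D.sum_univ hq b fun c => (fib H (S + T) c).card
  rw [← card_eq_sum_fib_univ] at hT hX
  have hS := D.card_left_eq
  have hμ := D.mu_eq_zero
  have hadd := D.card_add
  have hs := D.card_fib_add_card_fib'
  have h1 := D.card_add_le (P := fib H T b) (fun x hx => (mem_fib.1 hx).2) (by omega)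
  have h2 := Finset.card_le_card (zero_add_subset (S := S) T b)
  have h3 := Finset.card_le_card (fib_add_subset (H := H) (X := S) (Y := T) d b)
  have h4 := card_zero_le (S := S) T (D.mem_img_right (d + (d + b)))
  have h5 := card_le_of_sub_mem (S := S) (d := d) (c := d + (d + b)) T (D.mem_img_right _)
  obtain ⟨p, hp⟩ := Finset.card_eq_one.1 hb1
  obtain ⟨p', hp'⟩ := Finset.card_eq_one.1 hb2
  have hpm : p ∈ fib H T (d + b) := by rw [hp]; simp
  have hpm' : p' ∈ fib H T (d + (d + b)) := by rw [hp']; simp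
  have h6 : (fib H S 0).image (fun x => x + p') = fib H (S + T) (d + (d + b)) := by
    refine Finset.eq_of_subset_of_card_le ?_ ?_
    · intro x hx
      obtain ⟨s, hs, rfl⟩ := Finset.mem_image.1 hx
      exact zero_add_subset T _ (Finset.add_mem_add hs hpm')
    · rw [Finset.card_image_of_injective _ (add_left_injective p')]
      omega
  have h7 : (fib H S d).image (fun x => x + p) = fib H (S + T) (d + (d + b)) := by
    refine Finset.eq_of_subset_of_card_le ?_ ?_
    · intro x hx
      obtain ⟨s, hs, rfl⟩ := Finset.mem_image.1 hx
      exact fib_add_subset (H := H) d (d + b) (Finset.add_mem_add hs hpm)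
    · rw [Finset.card_image_of_injective _ (add_left_injective p)]
      omega
  have hiff : ∀ x, x ∈ fib H S d ↔ x - (p' - p) ∈ fib H S 0 := by
    refine fun x => ⟨fun hx => ?_, fun hx => ?_⟩
    · have h8 := Finset.mem_image_of_mem (fun x => x + p) hx
      rw [h7, ← h6] at h8
      obtain ⟨s, hs, h9⟩ := Finset.mem_image.1 h8
      have : x - (p' - p) = s := by
        rw [sub_sub_eq_add_sub, ← h9, add_sub_cancel_right]
      rwa [this]
    · have h8 := Finset.mem_image_of_mem (fun x => x + p') hx
      rw [h6, ← h7] at h8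
      obtain ⟨s, hs, h9⟩ := Finset.mem_image.1 h8
      have : x = s := by
        have h10 : x = x - (p' - p) + p' - p := by abel
        rw [h10, ← h9, add_sub_cancel_right]
      rwa [this]
  have h8 : (fib H S d + fib H T b).card = (fib H S 0 + fib H T b).card := by
    have : fib H S d + fib H T b = (p' - p) +ᵥ (fib H S 0 + fib H T b) := by
      ext x
      rw [mem_vadd_iff, Finset.mem_add, Finset.mem_add]
      constructor
      · rintro ⟨s, hs, t, ht, rfl⟩
        exact ⟨_, (hiff s).1 hs, t, ht, by abel⟩
      · rintro ⟨s, hs, t, ht, h⟩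
        refine ⟨s + (p' - p), (hiff _).2 (by simpa using hs), t, ht, ?_⟩
        have : s + (p' - p) + t = (s + t) + (p' - p) := by abel
        rw [this, h, sub_add_cancel]
    rw [this, Finset.card_vadd_finset]
  exact ⟨by omega, by omega, by omega, by omega, by omega, p, p' - p, hp,
    by rw [hp', add_sub_cancel], hiff⟩

/-- Four sums with only three values produce a coincidence, so both pairs have a common difference
g; 2g = 0 would leave only two values. -/
theorem exists_pair {R P : Finset G} (hR : R.card = 2) (hP : P.card = 2)
    (hRP : (R + P).card = 3) :
    ∃ s a g, g ≠ 0 ∧ g + g ≠ 0 ∧ R = {s, s + g} ∧ P = {a, a + g} := by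
  obtain ⟨s, s', hs, rfl⟩ := Finset.card_eq_two.1 hR
  obtain ⟨a, a', ha, rfl⟩ := Finset.card_eq_two.1 hP
  have key : ∀ s a g : G, ({s, s + g} : Finset G).card = 2 →
      (({s, s + g} : Finset G) + {a, a + g}).card = 3 → g ≠ 0 ∧ g + g ≠ 0 := by
    intro s a g h1 h2
    refine ⟨?_, fun h => ?_⟩
    · rintro rfl
      rw [add_zero] at h1
      simp at h1
    · have h3 : ({s, s + g} : Finset G) + {a, a + g} ⊆ {s + a, s + a + g} := by
        intro x hx
        obtain ⟨y, hy, z, hz, rfl⟩ := Finset.mem_add.1 hx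
        simp only [Finset.mem_insert, Finset.mem_singleton] at hy hz ⊢
        rcases hy with rfl | rfl <;> rcases hz with rfl | rfl
        · left; rfl
        · right; abel
        · right; abel
        · left
          have : s + g + (a + g) = s + a + (g + g) := by abel
          rw [this, h, add_zero]
      have h4 := (Finset.card_le_card h3).trans Finset.card_le_two
      omega
  have hex : s + a = s' + a' ∨ s + a' = s' + a := by
    by_contra hcon
    push Not at hcon
    obtain ⟨h1, h2⟩ := hcon
    have h3 : ({s + a, s + a', s' + a, s' + a'} : Finset G) ⊆ {s, s'} + {a, a'} := by
      intro x hx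
      simp only [Finset.mem_insert, Finset.mem_singleton] at hx
      rcases hx with rfl | rfl | rfl | rfl <;> apply Finset.add_mem_add <;> simp
    have h4 := Finset.card_le_card h3
    rw [Finset.card_insert_of_notMem (by simp [h1, ha, hs]),
      Finset.card_insert_of_notMem (by simp [h2, hs]),
      Finset.card_pair (by simpa using ha)] at h4
    omega
  rcases hex with h | h
  · have hg : s = s' + (a' - a) := by
      have : s = s + a - a := by abel
      rw [this, h]; abel
    have hR' : ({s, s'} : Finset G) = {s', s' + (a' - a)} := by rw [← hg, Finset.pair_comm]
    have hP' : ({a, a'} : Finset G) = {a, a + (a' - a)} := by rw [add_sub_cancel]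
    rw [hR', hP'] at hRP
    rw [hR'] at hR
    obtain ⟨h1, h2⟩ := key _ _ _ hR hRP
    exact ⟨s', a, a' - a, h1, h2, hR', hP'⟩
  · have hg : s' = s + (a' - a) := by
      have : s' = s' + a - a := by abel
      rw [this, ← h]; abel
    have hR' : ({s, s'} : Finset G) = {s, s + (a' - a)} := by rw [← hg]
    have hP' : ({a, a'} : Finset G) = {a, a + (a' - a)} := by rw [add_sub_cancel]
    rw [hR', hP'] at hRP
    rw [hR'] at hR
    obtain ⟨h1, h2⟩ := key _ _ _ hR hRP
    exact ⟨s, a, a' - a, h1, h2, hR', hP'⟩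

end PairConfig

end SmallSum

namespace SmallSum

namespace PairConfig

variable {G : Type*} [AddCommGroup G] [DecidableEq G]
  {S T : Finset G} {H : AddSubgroup G} [DecidableEq (G ⧸ H)] {μ : ℕ} {d : G ⧸ H}
  [Fintype (G ⧸ H)]

theorem eq_of_add_mem {x g z : G} (hg : g ≠ 0) (hg2 : g + g ≠ 0) (hg4 : g + g + g + g = 0)
    (h1 : z ∈ ({x, x + g, x + g + g} : Finset G)) (h2 : z + g ∈ ({x, x + g, x + g + g} : Finset G)) :
    z = x ∨ z = x + g := by
  simp only [Finset.mem_insert, Finset.mem_singleton] at h1 h2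
  rcases h1 with h | h | h
  · exact Or.inl h
  · exact Or.inr h
  · exfalso
    have e : x + g + g + g = x + (g + g + g) := by abel
    rw [h, e] at h2
    rcases h2 with h2 | h2 | h2
    · rw [add_eq_left] at h2
      rw [h2, zero_add] at hg4
      exact hg hg4
    · have := add_left_cancel h2
      rw [add_eq_right] at this
      exact hg2 this
    · rw [add_assoc x] at h2
      have := add_left_cancel h2
      rw [add_eq_left] at this
      exact hg this

theorem eq_union_three (D : PairConfig S T H μ d) (hq : Nat.card (G ⧸ H) = 3) (b : G ⧸ H) {x : G} :
    x ∈ T ↔ x ∈ fib H T b ∨ x ∈ fib H T (d + b) ∨ x ∈ fib H T (d + (d + b)) := by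
  obtain ⟨h, -⟩ := D.univ_eq hq b
  simp only [mem_fib]
  rw [← and_or_left, ← and_or_left]
  refine ⟨fun hx => ⟨hx, ?_⟩, fun hx => hx.1⟩
  have h1 := Finset.mem_univ (x : G ⧸ H)
  rw [h] at h1
  simpa only [Finset.mem_insert, Finset.mem_singleton] using h1

/-- The shift e between the two singleton fibres of T also carries one fibre of S to the other.
Comparing fibres of S + T shows that p + 2e and p - e both lie in {a, a + g}, so 3e is 0, g or -g;
the last two make T a progression with difference e. -/
theorem Exceptional.eq_prog (D : PairConfig S T H μ d) (hex : Exceptional T H d) :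
    T.card = 4 ∧ ∃ a e, T = prog a e 4 ∧ AddSubgroup.zmultiples e = ⊤ := by
  have hfin := D.finite
  have hG := D.toConfig.finite_group
  have hFG := Fintype.ofFinite G
  obtain ⟨hq, hh, b, hb, hb1, hb2⟩ := hex
  obtain ⟨hT, hs0, hsb, hxb, hxb1, p, e, hp, hp', hiff⟩ := D.exceptional_shift hq hh hb hb1 hb2
  obtain ⟨-, -, -, hd3⟩ := D.univ_eq hq b
  obtain ⟨s, a, g, hg0, hg2, hS0, hTb⟩ := exists_pair hs0 hb hsb
  refine ⟨hT, ?_⟩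
  have hpm : p ∈ fib H T (d + b) := by rw [hp]; simp
  have hpm' : p + e ∈ fib H T (d + (d + b)) := by rw [hp']; simp
  have he : (e : G ⧸ H) = d := by
    have h1 := (mem_fib.1 hpm').2
    rw [QuotientAddGroup.mk_add, (mem_fib.1 hpm).2, add_comm] at h1
    exact add_right_cancel h1
  have hgH : g ∈ H := by
    have h1 : s ∈ fib H S 0 := by rw [hS0]; simp
    have h2 : s + g ∈ fib H S 0 := by rw [hS0]; simp
    have h3 := (mem_fib.1 h2).2
    rw [QuotientAddGroup.mk_add, (mem_fib.1 h1).2, zero_add] at h3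
    exact (QuotientAddGroup.eq_zero_iff g).1 h3
  have hg4 : g + g + g + g = 0 := by
    have h1 : (4 : ℕ) • (⟨g, hgH⟩ : H) = 0 := by rw [← hh]; exact card_nsmul_eq_zero'
    have h2 := congrArg Subtype.val h1
    have h3 : (4 : ℕ) • g = 0 := h2
    rw [← h3]; abel
  have hsum : fib H S 0 + fib H T b = {s + a, s + a + g, s + a + g + g} := by
    rw [hS0, hTb]
    ext x
    simp only [Finset.mem_add, Finset.mem_insert, Finset.mem_singleton, exists_eq_or_imp,
      exists_eq_left]
    have e1 : s + (a + g) = s + a + g := by abel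
    have e2 : s + g + a = s + a + g := by abel
    have e3 : s + g + (a + g) = s + a + g + g := by abel
    rw [e1, e2, e3]
    constructor
    · rintro ((rfl | rfl) | rfl | rfl) <;> simp
    · rintro (rfl | rfl | rfl) <;> simp
  have hXb : fib H (S + T) b = {s + a, s + a + g, s + a + g + g} := by
    rw [← hsum]
    exact (Finset.eq_of_subset_of_card_le (zero_add_subset T b) (by omega)).symm
  have hX1 : ∀ x, x ∈ fib H (S + T) (d + b) → x - e ∈ fib H (S + T) b := by
    have h1 : (fib H (S + T) b).image (fun x => x + e) = fib H (S + T) (d + b) := by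
      refine Finset.eq_of_subset_of_card_le ?_ ?_
      · intro x hx
        obtain ⟨y, hy, rfl⟩ := Finset.mem_image.1 hx
        rw [hXb, ← hsum] at hy
        obtain ⟨σ, hσ, t, ht, rfl⟩ := Finset.mem_add.1 hy
        have h2 := fib_add_subset (H := H) d b (Finset.add_mem_add
          ((hiff (σ + e)).2 (by rwa [add_sub_cancel_right])) ht)
        have h3 : σ + t + e = σ + e + t := by abel
        rw [h3]
        exact h2
      · rw [Finset.card_image_of_injective _ (add_left_injective e)]
        omega
    intro x hx
    rw [← h1] at hx
    obtain ⟨y, hy, rfl⟩ := Finset.mem_image.1 hx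
    rwa [add_sub_cancel_right]
  have hmS : s ∈ fib H S 0 := by rw [hS0]; simp
  have hmS' : s + g ∈ fib H S 0 := by rw [hS0]; simp
  have k1 : s + (e + (p + e)) = s + a ∨ s + (e + (p + e)) = s + a + g := by
    have h1 := fib_add_subset (H := H) d _ (Finset.add_mem_add
      ((hiff (s + e)).2 (by rwa [add_sub_cancel_right])) hpm')
    have h2 := fib_add_subset (H := H) d _ (Finset.add_mem_add
      ((hiff (s + g + e)).2 (by rwa [add_sub_cancel_right])) hpm')
    rw [hd3, hXb] at h1 h2
    refine eq_of_add_mem hg0 hg2 hg4 ?_ ?_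
    · convert h1 using 1; abel
    · convert h2 using 1; abel
  have k2 : s + (p - e) = s + a ∨ s + (p - e) = s + a + g := by
    have h1 := hX1 _ (zero_add_subset T _ (Finset.add_mem_add hmS hpm))
    have h2 := hX1 _ (zero_add_subset T _ (Finset.add_mem_add hmS' hpm))
    rw [hXb] at h1 h2
    refine eq_of_add_mem hg0 hg2 hg4 ?_ ?_
    · convert h1 using 1; abel
    · convert h2 using 1; abel
  rw [add_assoc s a g] at k1 k2
  simp only [add_right_inj] at k1 k2
  -- If 3e = 0, then {0, e, 2e} absorbs the shift between the fibres of S, and its sum with S has at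
  -- most 6 elements, whereas κ₂(S) = 4 requires 7.
  have h3e : e + e + e ≠ 0 := by
    intro h
    have hd2 : d + d ≠ 0 := by
      intro h2
      have h1 : (e + e + e : G) = ((0 : G) : G ⧸ H) := by
        rw [← h]
      have h3 : d + d + d = 0 := by
        rw [← he]; exact h1
      rw [h2, zero_add] at h3
      exact D.ne_zero h3
    have hc : ({0, e, e + e} : Finset G).card = 3 := by
      rw [Finset.card_insert_of_notMem, Finset.card_pair]
      · intro h1
        rw [left_eq_add] at h1
        exact D.ne_zero (by rw [← he, h1]; rfl)
      · rw [Finset.mem_insert, Finset.mem_singleton, not_or]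
        refine ⟨fun h1 => D.ne_zero (by rw [← he, ← h1]; rfl), fun h1 => hd2 ?_⟩
        rw [← he, ← QuotientAddGroup.mk_add, ← h1]; rfl
    have hsub : ({0, e, e + e} : Finset G) + S ⊆ ({0, e, e + e} : Finset G) + fib H S 0 := by
      intro x hx
      obtain ⟨y, hy, σ, hσ, rfl⟩ := Finset.mem_add.1 hx
      rw [D.eq_union, Finset.mem_union] at hσ
      rcases hσ with hσ | hσ
      · exact Finset.add_mem_add hy hσ
      · refine Finset.mem_add.2 ⟨y + e, ?_, σ - e, (hiff σ).1 hσ, by abel⟩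
        simp only [Finset.mem_insert, Finset.mem_singleton] at hy ⊢
        rcases hy with rfl | rfl | rfl
        · right; left; rw [zero_add]
        · right; right; rfl
        · left; exact h
    have hle := (Finset.card_le_card hsub).trans Finset.card_add_le
    rw [hc, hs0] at hle
    have h12 := Config.card_group H
    rw [hq, hh, Nat.card_eq_fintype_card] at h12
    have := D.data.le_card_add ({0, e, e + e}) (by omega) (twoOut_of_card (by omega))
    rw [D.card_img_left, hc] at this
    omega
  have key : (e + e + e = g ∨ e + e + e = -g) ∧ ∃ a₀, T = prog a₀ e 4 := by
    have hTm := fun x => D.eq_union_three hq b (x := x)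
    rw [hTb, hp, hp'] at hTm
    simp only [Finset.mem_insert, Finset.mem_singleton] at hTm
    have hprog : ∀ a₀ x, x ∈ prog a₀ e 4 ↔
        x = a₀ ∨ x = a₀ + e ∨ x = a₀ + e + e ∨ x = a₀ + e + e + e := by
      intro a₀ x
      rw [mem_prog]
      have e2 : a₀ + (2 : ℕ) • e = a₀ + e + e := by rw [two_nsmul]; abel
      have e3 : a₀ + (3 : ℕ) • e = a₀ + e + e + e := by rw [succ_nsmul, two_nsmul]; abel
      constructor
      · rintro ⟨i, hi, rfl⟩
        interval_cases i
        · left; simp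
        · right; left; simp
        · right; right; left; exact e2
        · right; right; right; exact e3
      · rintro (rfl | rfl | rfl | rfl)
        · exact ⟨0, by omega, by simp⟩
        · exact ⟨1, by omega, by simp⟩
        · exact ⟨2, by omega, e2.symm⟩
        · exact ⟨3, by omega, e3.symm⟩
    rcases k1 with k1 | k1 <;> rcases k2 with k2 | k2
    · exfalso
      refine h3e ?_
      have : e + e + e = e + (p + e) - (p - e) := by abel
      rw [this, k1, k2, sub_self]
    · have hge : e + e + e = -g := by
        have : e + e + e = e + (p + e) - (p - e) := by abel
        rw [this, k1, k2]; abel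
      refine ⟨Or.inr hge, a + g, ?_⟩
      have hpe : p = a + g + e := by rw [← k2]; abel
      have hae : a = a + g + e + e + e := by
        have : a + g + e + e + e = a + g + (e + e + e) := by abel
        rw [this, hge]; abel
      ext x
      rw [hTm, hprog, ← hae, hpe]
      tauto
    · have hge : e + e + e = g := by
        have : e + e + e = e + (p + e) - (p - e) := by abel
        rw [this, k1, k2]; abel
      refine ⟨Or.inl hge, a, ?_⟩
      have hpe : p = a + e := by rw [← k2]; abel
      have hae : a + g = a + e + e + e := by rw [← hge]; abel
      ext x
      rw [hTm, hprog, ← hpe, hae, hpe]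
      tauto
    · exfalso
      refine h3e ?_
      have : e + e + e = e + (p + e) - (p - e) := by abel
      rw [this, k1, k2, sub_self]
  obtain ⟨hge, a₀, ha₀⟩ := key
  refine ⟨a₀, e, ha₀, ?_⟩
  have hem : e ∈ AddSubgroup.zmultiples e := AddSubgroup.mem_zmultiples e
  have h3m : e + e + e ∈ AddSubgroup.zmultiples e := add_mem (add_mem hem hem) hem
  have hgm : g ∈ AddSubgroup.zmultiples e := by
    rcases hge with h | h
    · rwa [← h]
    · rw [← neg_neg g, ← h]; exact neg_mem h3m
  have h0 : (0 : G) ∈ fib H S 0 := mem_fib.2 ⟨D.data.zero_mem, rfl⟩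
  have hsm : s ∈ AddSubgroup.zmultiples e := by
    rw [hS0, Finset.mem_insert, Finset.mem_singleton] at h0
    rcases h0 with h | h
    · rw [← h]; exact zero_mem _
    · rw [eq_neg_of_add_eq_zero_left h.symm]; exact neg_mem hgm
  have hS0m : ∀ x ∈ fib H S 0, x ∈ AddSubgroup.zmultiples e := by
    intro x hx
    rw [hS0, Finset.mem_insert, Finset.mem_singleton] at hx
    rcases hx with rfl | rfl
    · exact hsm
    · exact add_mem hsm hgm
  rw [eq_top_iff, ← D.data.closure_eq, AddSubgroup.closure_le]
  intro x hx
  rw [Finset.mem_coe, D.eq_union, Finset.mem_union] at hx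
  rcases hx with hx | hx
  · exact hS0m x hx
  · have := add_mem (hS0m _ ((hiff x).1 hx)) hem
    rwa [sub_add_cancel] at this

theorem Exceptional.kappa_eq (D : PairConfig S T H μ d) (hex : Exceptional T H d) {t : G}
    (ht : t ∈ T) : kappa 2 (translate T t) = 3 := by
  have hG := D.toConfig.finite_group
  have hFG := Fintype.ofFinite G
  obtain ⟨hT, a, e, hTe, he⟩ := Exceptional.eq_prog D hex
  have h12 := Config.card_group H
  rw [hex.1, hex.2.1, Nat.card_eq_fintype_card] at h12
  have h1 : translate T t = prog (a - t) e 4 := by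
    ext x
    rw [translate, Finset.mem_image, hTe, mem_prog]
    constructor
    · rintro ⟨y, hy, rfl⟩
      obtain ⟨i, hi, rfl⟩ := mem_prog.1 hy
      exact ⟨i, hi, by abel⟩
    · rintro ⟨i, hi, rfl⟩
      exact ⟨a + i • e, mem_prog.2 ⟨i, hi, rfl⟩, by abel⟩
  have h0 : (0 : G) ∈ translate T t := Finset.mem_image.2 ⟨t, ht, sub_self t⟩
  rw [h1] at h0 ⊢
  exact kappa_two_prog (by omega) h0 he (by omega)

end PairConfig

/-! ### Two cosets: conclusion -/

namespace Config

variable {G : Type*} [AddCommGroup G] [DecidableEq G]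
  {S T : Finset G} {H : AddSubgroup G} [DecidableEq (G ⧸ H)] {μ : ℕ}

/-- Walking from p around the cyclic group lists all elements p + d, ..., p + (q - 1)d other than p.
-/
theorem isProgression_compl_singleton {Q : Type*} [AddCommGroup Q] [DecidableEq Q] [Fintype Q]
    {d p : Q} (hd : AddSubgroup.zmultiples d = ⊤) {B : Finset Q} (hB : B.Nonempty)
    (hBp : ∀ x, x ∈ B ↔ x ≠ p) : IsProgression d (B : Set Q) := by
  have ho : addOrderOf d = Fintype.card Q := by
    rw [← Nat.card_zmultiples, hd, ← Nat.card_eq_fintype_card]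
    exact Nat.card_congr AddSubgroup.topEquiv.toEquiv
  obtain ⟨y, hy⟩ := hB
  have hcard : 1 < Fintype.card Q := Fintype.one_lt_card_iff.2 ⟨y, p, (hBp y).1 hy⟩
  refine ⟨p + d, Fintype.card Q - 1, by omega, ?_⟩
  ext x
  rw [Finset.mem_coe, hBp, Set.mem_ofPred_eq]
  constructor
  · intro hx
    have h1 : x - p ∈ AddSubgroup.zmultiples d := by rw [hd]; trivial
    rw [mem_zmultiples_iff_mem_range_addOrderOf, Finset.mem_image] at h1
    obtain ⟨i, hi, h2⟩ := h1
    rw [Finset.mem_range, ho] at hi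
    obtain ⟨j, rfl⟩ : ∃ j, i = j + 1 := by
      refine ⟨i - 1, ?_⟩
      have : i ≠ 0 := by
        rintro rfl
        rw [zero_nsmul] at h2
        exact hx (sub_eq_zero.1 h2.symm)
      omega
    refine ⟨j, by omega, ?_⟩
    rw [succ_nsmul] at h2
    have : x = p + (x - p) := by abel
    rw [this, ← h2]; abel
  · rintro ⟨i, hi, rfl⟩ h
    have h1 : (i + 1) • d = 0 := by
      rw [succ_nsmul]
      have h2 : p + (i • d + d) = p := by
        calc p + (i • d + d) = p + d + i • d := by abel
          _ = p := h
      simpa using h2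
    have := Nat.le_of_dvd (by omega) (addOrderOf_dvd_of_nsmul_eq_zero h1)
    omega

/-- The theorem when `S` meets exactly two cosets of `H`. -/
theorem of_card_eq_two (C : Config S T H μ) (hu : (img H S).card = 2) :
    (μ = 0 ∧ Nat.card G = 12 ∧ 3 * S.card = 12 ∧ 3 * T.card = 12 ∧
      ∀ t ∈ T, 4 * kappa 2 (translate T t) = 12) ∨
    ((img H S + img H T).card + 1 = (img H S).card + (img H T).card ∧
      ∃ d, IsProgression d (img H S : Set (G ⧸ H)) ∧
        IsProgression d (img H T : Set (G ⧸ H))) := by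
  have h0 : (0 : G ⧸ H) ∈ img H S := mem_img.2 ⟨0, C.data.zero_mem, rfl⟩
  obtain ⟨d, hd0, hA⟩ : ∃ d, d ≠ 0 ∧ img H S = {0, d} := by
    obtain ⟨x, y, hxy, h⟩ := Finset.card_eq_two.1 hu
    rw [h, Finset.mem_insert, Finset.mem_singleton] at h0
    rcases h0 with rfl | rfl
    · exact ⟨y, hxy.symm, h⟩
    · exact ⟨x, hxy, by rw [h, Finset.pair_comm]⟩
  have hd : AddSubgroup.zmultiples d = ⊤ := by
    rw [eq_top_iff, ← C.closure_img, hA, AddSubgroup.closure_le]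
    intro x hx
    rw [Finset.mem_coe, Finset.mem_insert, Finset.mem_singleton] at hx
    rcases hx with rfl | rfl
    · exact zero_mem _
    · exact AddSubgroup.mem_zmultiples x
  have hAP : IsProgression d (img H S : Set (G ⧸ H)) := by
    have : img H S = prog 0 d 2 := by
      rw [hA]
      ext x
      rw [mem_prog, Finset.mem_insert, Finset.mem_singleton]
      constructor
      · rintro (rfl | rfl)
        · exact ⟨0, by omega, by simp⟩
        · exact ⟨1, by omega, by simp⟩
      · rintro ⟨i, hi, rfl⟩
        interval_cases i <;> simp
    rw [this]
    exact isProgression_prog 0 d (by omega)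
  have hlt := C.card_img_add_lt
  have hBne : (img H T).Nonempty := by
    obtain ⟨t, ht⟩ := C.nonempty_right
    exact ⟨_, mem_img.2 ⟨t, ht, rfl⟩⟩
  by_cases hp : ∃ p, p ∉ img H S + img H T
  · have hcd := C.card_img_add hBne hp
    exact Or.inr ⟨by omega, d, hAP, C.isProgression_img_right hd hAP hp⟩
  · have hout : ¬ TwoOut (img H S + img H T) := fun ⟨p, _, _, h, _⟩ => hp ⟨p, h⟩
    have hfin := finite_of_not_twoOut hout
    have := Fintype.ofFinite (G ⧸ H)
    push Not at hp
    have hw : (img H S + img H T).card = Fintype.card (G ⧸ H) := by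
      rw [Finset.eq_univ_iff_forall.2 hp, Finset.card_univ]
    by_cases hB : ∀ b, b ∈ img H T
    · left
      have D : PairConfig S T H μ d := ⟨C, hA, hd0, hd, hB⟩
      have hex := D.exceptional
      have h1 := D.card_left_eq
      have h2 := (PairConfig.Exceptional.eq_prog D hex).1
      have h3 := card_group H
      rw [hex.1, hex.2.1] at h3
      rw [hex.2.1] at h1
      exact ⟨D.mu_eq_zero, h3, by omega, by omega, fun t ht => by
        rw [PairConfig.Exceptional.kappa_eq D hex ht]⟩
    · right
      push Not at hB
      obtain ⟨p, hpB⟩ := hB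
      have h1 := Finset.card_lt_univ_of_notMem hpB
      -- As q = |A + B| < 2 + |B|, the set B misses exactly the point p.
      refine ⟨by omega, d, hAP, isProgression_compl_singleton (p := p) hd hBne fun x => ⟨?_, ?_⟩⟩
      · rintro hx rfl
        exact hpB hx
      · intro hx
        by_contra hxB
        have h2 : (insert x (insert p (img H T))).card ≤ Fintype.card (G ⧸ H) :=
          Finset.card_le_univ _
        rw [Finset.card_insert_of_notMem, Finset.card_insert_of_notMem hpB] at h2
        · omega
        · rw [Finset.mem_insert, not_or]
          exact ⟨hx, hxB⟩

end Config

end SmallSum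

theorem mainTheorem4 {G : Type*} [AddCommGroup G] [DecidableEq G]
    (S T : Finset G) (H : AddSubgroup G) (μ : ℕ) (hμ : μ ≤ 1)
    (hS0 : (0 : G) ∈ S) (hSgen : AddSubgroup.closure (S : Set G) = ⊤)
    (hSdeg : SmallSum.IsDegenerate S) (hH : SmallSum.IsHyperAtom S H)
    (hScard : 3 - μ ≤ S.card) (hTcard : max (4 - 2 * μ) S.card ≤ T.card)
    (haper : SmallSum.IsAperiodic (S + T))
    (hsum : (S + T).card + μ = S.card + T.card)
    (hsize : 3 * ((S + T).card : ℕ∞) ≤ 2 * ENat.card G + 2 * (μ : ℕ∞)) :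
    (μ = 0 ∧ Nat.card G = 12 ∧ 3 * S.card = 12 ∧ 3 * T.card = 12 ∧
      ∀ t ∈ T, 4 * SmallSum.kappa 2 (SmallSum.translate T t) = 12) ∨
    (((QuotientAddGroup.mk' H '' ((S + T : Finset G) : Set G)).ncard + 1 =
        (QuotientAddGroup.mk' H '' (S : Set G)).ncard +
          (QuotientAddGroup.mk' H '' (T : Set G)).ncard) ∧
      ∃ d : G ⧸ H,
        SmallSum.IsProgression d (QuotientAddGroup.mk' H '' (S : Set G)) ∧
        SmallSum.IsProgression d (QuotientAddGroup.mk' H '' (T : Set G))) := by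
  classical
  have himg : ∀ X : Finset G,
      QuotientAddGroup.mk' H '' (X : Set G) = (SmallSum.img H X : Set (G ⧸ H)) := fun X => by
    simp [SmallSum.img]
  have C : SmallSum.Config S T H μ := by
    refine ⟨hH.data hS0 hSgen, hμ, by omega, by omega, by omega, haper, hsum, fun hfin => ?_⟩
    rw [ENat.card_eq_coe_natCard] at hsize
    exact_mod_cast hsize
  simp only [himg, Set.ncard_coe_finset, SmallSum.img_add]
  have h2 := C.data.two_le_img
  rcases Nat.lt_or_ge (SmallSum.img H S).card 3 with h | h
  · exact C.of_card_eq_two (by omega)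
  · exact Or.inr (C.exists_isProgression_of_three_le h)
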